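/- **Setting.** Let $\mathcal F=(F;+,\cdot,0,1,D)$ be a countable saturated differentially closed field of characteristic $0$, let $R$ be a countable collection of sets $P\subseteq F^n$ definable without parameters in $\mathcal F$, let $\mathcal F_R=(F;+,\cdot,0,1,P)_{P\in R}$ and let $\mathfrak L_R$ be its language. Let $\mathfrak C$ be a class of $\mathfrak L_R$-structures that is closed under isomorphism and under intersections (of substructures, belonging to $\mathfrak C$, of a member of $\mathfrak C$), has the joint embedding property and has a smallest structure $\emptyset$ (contained in each member of $\mathfrak C$ as its least substructure in $\mathfrak C$). For $X\subseteq B\in\mathfrak C$ let $\langle X\rangle_B=\langle X\rangle^{\mathfrak C}_B$ be the intersection of all substructures of $B$ that lie in $\mathfrak C$ and contain $X$; $A\in\mathfrak C$ is finitely generated, $A\in\mathfrak C_{f.g.}$, if $A=\langle X\rangle_A$ for a finite $X$. Write $A\subseteq_{f.g.}B$ if $A$ is a finitely generated substructure of $B$, and $AB$ for $\langle A\cup B\rangle$ inside a common extension. Let $\delta:\mathfrak C_{f.g.}\to\mathbb Z$ be a non-negative predimension: $\delta(\emptyset)=0$, $\delta$ is invariant under isomorphism, and $\delta(AB)+\delta(A\cap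 B)\le\delta(A)+\delta(B)$ for all $A,B\subseteq_{f.g.}M\in\mathfrak C$. For $A\subseteq B$ in $\mathfrak C$, $A$ is strong in $B$, $A\le B$, if for all $X\subseteq_{f.g.}B$ and $Y\subseteq_{f.g.}A$ there is $Y'$ with $Y\subseteq Y'\subseteq_{f.g.}A$ and $\delta(XY')-\delta(Y')\ge 0$; an embedding is strong if its image is strong. For finite $X\subseteq B\in\mathfrak C$ put $d_B(X)=\min\{\delta(Y):X\subseteq Y\subseteq_{f.g.}B\}$ and $d_B(b/X)=d_B(X\cup\{b\})-d_B(X)$. Let $\hat{\mathfrak C}\subseteq\mathfrak C$ be a subclass closed under isomorphism and intersections; $\langle\cdot\rangle^{\hat{\mathfrak C}}$ and $\hat{\mathfrak C}_{f.g.}$ are defined as above with $\hat{\mathfrak C}$ in place of $\mathfrak C$. Structures in $\mathfrak C_{f.g.}$ and in $\hat{\mathfrak C}_{f.g.}$ are assumed countable. The standing assumptions are: * FG: if $A\subseteq B$, $A\in\mathfrak C$ and $B\in\mathfrak C_{f.g.}$, then $A\in\mathfrak C_{f.g.}$. * DCC: $\mathfrak C_{f.g.}$ has no infinite strictly descending strong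 chain. * C1: each $A\in\mathfrak C_{f.g.}$ has at most countably many finitely generated strong extensions up to isomorphism over $A$. * C2, C5: $\mathfrak C$ and $\hat{\mathfrak C}$ are closed under unions of countable strong chains. * C3: each $A\in\mathfrak C$ has a strong extension $\hat A\in\hat{\mathfrak C}$ that is $\hat{\mathfrak C}$-generated by $A$, unique up to isomorphism over $A$; and $\hat A\in\hat{\mathfrak C}_{f.g.}$ if $A\in\mathfrak C_{f.g.}$. * C4: each strong embedding $A\hookrightarrow B$ of members of $\mathfrak C$ extends to a strong embedding $\hat A\hookrightarrow\hat B$. * AAP: if $A_0,A_1,A_2\in\hat{\mathfrak C}_{f.g.}$, $A_0\hookrightarrow A_1$ is a strong embedding and $A_0\hookrightarrow A_2$ is an embedding, then there are $B\in\hat{\mathfrak C}_{f.g.}$, an embedding $A_1\hookrightarrow B$ and a strong embedding $A_2\hookrightarrow B$ that agree on $A_0$; if $A_0\hookrightarrow A_2$ is strong then so is $A_1\hookrightarrow B$. The strong Fraïssé limit $U$ of $\mathfrak C_{f.g.}$ is the countable structure in $\mathfrak C$ such that every countable member of $\mathfrak C$ embeds strongly into $U$ and, for $A,B\in\mathfrak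 C_{f.g.}$ with strong embeddings $A\hookrightarrow U$ and $A\hookrightarrow B$, there is a strong embedding of $B$ into $U$ over $A$. The predimension $\delta$ is strongly adequate for a countable $M\in\mathfrak C$ if all of the above holds, $M\cong U$, and $\delta$ is universally definable in $M$: for all $n,m$ the set $\{\bar a\in M^n:\delta(\langle\bar a\rangle_M)\ge m\}$ is defined by some $\bigwedge_{i<\omega}\bigvee_{j<\omega}\varphi_{i,j}(\bar x)$ with universal first-order formulas $\varphi_{i,j}$. **Theorem.** Assume that every structure in $\mathfrak C_{f.g.}$ has as underlying field an algebraically closed field of characteristic $0$ and of finite transcendence degree over $\mathbb Q$. Assume that $d$-generic $1$-types over finite sets are not algebraic: whenever $X\subseteq F$ is finite and $b\in F$ satisfies $d_{\mathcal F_R}(b/X)\geq 1$, every set containing $b$ that is definable in $\mathcal F_R$ over $X$ is infinite. If $D$ is definable (without parameters) in $\mathcal F_R$ and $\delta$ is strongly adequate for $\mathcal F_R$, then $D$ is existentially definable (without parameters) in $\mathcal F_R$, the theory $\mathrm{Th}(\mathcal F_R)$ is model complete, and $\delta$ is trivial, i.e. all embeddings between structures in $\hat{\mathfrak C}$ are strong.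 -/

import Mathlib

universe u v

open FirstOrder FirstOrder.Language Cardinal

namespace Predim

section General

variable {L : FirstOrder.Language.{0, v}}

/-! ### General model theory -/

/-- A structure is saturated: every finitely satisfiable set of formulas in one variable, over a
parameter set of cardinality smaller than the structure, is realised. -/
def IsSaturated (L : FirstOrder.Language.{0, v}) (M : Type u) [L.Structure M] : Prop :=
  ∀ A : Set M, #A < #M → ∀ Φ : Set (L[[A]].Formula Unit),
    (∀ Φ₀ : Set (L[[A]].Formula Unit), Φ₀.Finite → Φ₀ ⊆ Φ →
      ∃ x : M, ∀ φ ∈ Φ₀, φ.Realize (fun _ => x)) →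
    ∃ x : M, ∀ φ ∈ Φ, φ.Realize (fun _ => x)

/-- A theory is model complete: every embedding between two of its models is elementary. -/
def IsModelComplete (T : L.Theory) : Prop :=
  ∀ (M N : Type u) [L.Structure M] [L.Structure N], M ⊨ T → N ⊨ T → ∀ f : M ↪[L] N,
    ∀ (n : ℕ) (φ : L.Formula (Fin n)) (x : Fin n → M), φ.Realize (f ∘ x) ↔ φ.Realize x

/-- A set of `n`-tuples is existentially definable (without parameters). -/
def ExistentiallyDefinable (L : FirstOrder.Language.{0, v}) {M : Type u} [L.Structure M] {n : ℕ}
    (s : Set (Fin n → M)) : Prop :=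
  ∃ φ : L.Formula (Fin n), φ.IsExistential ∧ ∀ x : Fin n → M, x ∈ s ↔ φ.Realize x

/-! ### Classes of structures and closures

A class of structures is a predicate `C` on `L`-structures (with carrier in a fixed universe).
A substructure is always regarded as a structure in its own right, so `C S` makes sense for
`S : L.Substructure M`. -/

/-- A class of `L`-structures. -/
abbrev StrClass (L : FirstOrder.Language.{0, v}) := ∀ (A : Type u) [L.Structure A], Prop

/-- The substructure of `B` that is `C`-generated by `X`: the intersection of all substructures of
`B` that belong to `C` and contain `X`. -/
def gen (C : StrClass.{u} L) {B : Type u} [L.Structure B] (X : Set B) : L.Substructure B :=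
  sInf {A : L.Substructure B | C A ∧ X ⊆ A}

/-- `A` belongs to `C` and is `C`-generated by a finite subset. -/
def IsFG (C : StrClass.{u} L) (A : Type u) [L.Structure A] : Prop :=
  C A ∧ ∃ X : Set A, X.Finite ∧ gen C X = ⊤

/-- `C` is closed under isomorphism. -/
def IsoClosed (C : StrClass.{u} L) : Prop :=
  ∀ (A B : Type u) [L.Structure A] [L.Structure B], C A → Nonempty (A ≃[L] B) → C B

/-- `C` is closed under intersections of families of substructures of a member of `C`. -/
def InterClosed (C : StrClass.{u} L) : Prop :=
  ∀ (A : Type u) [L.Structure A], C A → ∀ 𝒮 : Set (L.Substructure A), 𝒮.Nonempty →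
    (∀ S ∈ 𝒮, C S) → C (sInf 𝒮 : L.Substructure A)

/-- The joint embedding property. -/
def JointEmbedding (C : StrClass.{u} L) : Prop :=
  ∀ (A B : Type u) [L.Structure A] [L.Structure B], C A → C B →
    ∃ (M : Type u) (_ : L.Structure M), C M ∧ Nonempty (A ↪[L] M) ∧ Nonempty (B ↪[L] M)

/-- `C` has a smallest structure: some `S` in `C` sits inside every `A` in `C` as the least
substructure of `A` belonging to `C`. -/
def HasSmallest (C : StrClass.{u} L) : Prop :=
  ∃ (S : Type u) (_ : L.Structure S), C S ∧ ∀ (A : Type u) [L.Structure A], C A →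
    ∃ S₀ : L.Substructure A, Nonempty (S ≃[L] S₀) ∧ C S₀ ∧
      ∀ T : L.Substructure A, C T → S₀ ≤ T

/-- FG: a member of `C` that is a substructure of a finitely generated one is finitely generated. -/
def CondFG (C : StrClass.{u} L) : Prop :=
  ∀ (B : Type u) [L.Structure B], IsFG C B → ∀ A : L.Substructure B, C A → IsFG C A

/-! ### Predimensions and strong embeddings

The function `δ` is a function on all structures, but only its values on finitely generated members
of `C` are ever used. -/

/-- An integer-valued function on structures. -/
abbrev StrFun (L : FirstOrder.Language.{0, v}) := ∀ (A : Type u) [L.Structure A], ℤ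

/-- `δ` is a predimension on the finitely generated members of `C`. -/
structure IsPredimension (C : StrClass.{u} L) (δ : StrFun.{u} L) : Prop where
  empty : ∀ (A : Type u) [L.Structure A], C A → δ (gen C (∅ : Set A)) = 0
  iso : ∀ (A B : Type u) [L.Structure A] [L.Structure B], IsFG C A → IsFG C B →
    Nonempty (A ≃[L] B) → δ A = δ B
  submodular : ∀ (M : Type u) [L.Structure M], C M → ∀ A B : L.Substructure M,
    IsFG C A → IsFG C B →
    δ (gen C ((A : Set M) ∪ B)) + δ (A ⊓ B : L.Substructure M) ≤ δ A + δ B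

/-- `δ(X/A) ≥ k`, for substructures `X`, `A` of an ambient structure `B`. -/
def RelGe (C : StrClass.{u} L) (δ : StrFun.{u} L) {B : Type u} [L.Structure B]
    (X A : L.Substructure B) (k : ℤ) : Prop :=
  ∀ Y : L.Substructure B, IsFG C Y → Y ≤ A →
    ∃ Y' : L.Substructure B, IsFG C Y' ∧ Y ≤ Y' ∧ Y' ≤ A ∧
      k ≤ δ (gen C ((X : Set B) ∪ Y')) - δ Y'

/-- `A` is strong (self-sufficient) in `B`. -/
def IsStrong (C : StrClass.{u} L) (δ : StrFun.{u} L) {B : Type u} [L.Structure B]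
    (A : L.Substructure B) : Prop :=
  ∀ X : L.Substructure B, IsFG C X → RelGe C δ X A 0

/-- An embedding is strong if its image is strong. -/
def IsStrongEmb (C : StrClass.{u} L) (δ : StrFun.{u} L) {A B : Type u} [L.Structure A]
    [L.Structure B] (f : A ↪[L] B) : Prop :=
  IsStrong C δ f.toHom.range

/-- DCC: there is no infinite strictly descending strong chain of finitely generated members. -/
def CondDCC (C : StrClass.{u} L) (δ : StrFun.{u} L) : Prop :=
  ∀ (M : Type u) [L.Structure M], IsFG C M →
    ¬ ∃ (s : ℕ → L.Substructure M) (h : ∀ i, s (i + 1) < s i),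
      (∀ i, IsFG C (s i)) ∧ ∀ i, IsStrongEmb C δ (Substructure.inclusion (h i).le)

/-- The dimension `d_M(X)` of a (finite) subset `X` of `M`, the minimum of `δ(Y)` over the finitely
generated substructures `Y` of `M` containing `X`. -/
noncomputable def dim (C : StrClass.{u} L) (δ : StrFun.{u} L) {M : Type u} [L.Structure M]
    (X : Set M) : ℤ :=
  sInf {k : ℤ | ∃ Y : L.Substructure M, IsFG C Y ∧ X ⊆ Y ∧ δ Y = k}

/-- `δ` is universally definable in `M`: each set `{a ∈ Mⁿ : δ(a) ≥ m}` is defined by a formula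
`⋀ i, ⋁ j, φ i j` with `i, j < ω` and all `φ i j` universal. -/
def UniversallyDefinable (C : StrClass.{u} L) (δ : StrFun.{u} L) (M : Type u)
    [L.Structure M] : Prop :=
  ∀ n m : ℕ, ∃ φ : ℕ → ℕ → L.Formula (Fin n), (∀ i j, (φ i j).IsUniversal) ∧
    ∀ a : Fin n → M, (m : ℤ) ≤ δ (gen C (Set.range a)) ↔ ∀ i, ∃ j, (φ i j).Realize a

/-! ### Amalgamation -/

/-- C1: a finitely generated member has at most countably many finitely generated strong extensions,
up to isomorphism over it. -/
def CondC1 (C : StrClass.{u} L) (δ : StrFun.{u} L) : Prop :=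
  ∀ (A : Type u) [L.Structure A], IsFG C A →
    ∃ (E : ℕ → Type u) (_ : ∀ n, L.Structure (E n)) (e : ∀ n, A ↪[L] E n),
      ∀ (B : Type u) [L.Structure B] (f : A ↪[L] B), IsFG C B → IsStrongEmb C δ f →
        ∃ (n : ℕ) (g : B ≃[L] E n), ∀ a, g (f a) = e n a

/-- C2 and C5: the class `K` is closed under unions of countable strong chains (strong with respect
to `C` and `δ`). -/
def ChainClosed (K C : StrClass.{u} L) (δ : StrFun.{u} L) : Prop :=
  ∀ (M : Type u) [L.Structure M] (s : ℕ → L.Substructure M) (h : ∀ i, s i ≤ s (i + 1)),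
    (∀ i, K (s i)) → (∀ i, IsStrongEmb C δ (Substructure.inclusion (h i))) →
    (∀ x : M, ∃ i, x ∈ s i) → K M

/-- `ι : A ↪ B` is a strong extension with `B` in `K` and `K`-generated by `A`. -/
structure IsHull (K C : StrClass.{u} L) (δ : StrFun.{u} L) {A B : Type u} [L.Structure A]
    [L.Structure B] (ι : A ↪[L] B) : Prop where
  mem : K B
  strong : IsStrongEmb C δ ι
  generated : gen K (Set.range ι) = ⊤

/-- C3: every `A` in `C` has a strong extension in `K` that is `K`-generated by `A`, unique up to
isomorphism over `A`; it is finitely `K`-generated if `A` is finitely generated. -/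
structure CondC3 (K C : StrClass.{u} L) (δ : StrFun.{u} L) : Prop where
  exists_hull : ∀ (A : Type u) [L.Structure A], C A →
    ∃ (B : Type u) (_ : L.Structure B) (ι : A ↪[L] B), IsHull K C δ ι
  unique : ∀ (A B B' : Type u) [L.Structure A] [L.Structure B] [L.Structure B']
    (ι : A ↪[L] B) (ι' : A ↪[L] B'), C A → IsHull K C δ ι → IsHull K C δ ι' →
    ∃ g : B ≃[L] B', ∀ a, g (ι a) = ι' a
  fg : ∀ (A B : Type u) [L.Structure A] [L.Structure B] (ι : A ↪[L] B), IsFG C A →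
    IsHull K C δ ι → IsFG K B

/-- C4: strong embeddings extend to strong embeddings of the hulls. -/
def CondC4 (K C : StrClass.{u} L) (δ : StrFun.{u} L) : Prop :=
  ∀ (A B A' B' : Type u) [L.Structure A] [L.Structure B] [L.Structure A'] [L.Structure B']
    (ιA : A ↪[L] A') (ιB : B ↪[L] B') (f : A ↪[L] B), C A → C B →
    IsHull K C δ ιA → IsHull K C δ ιB → IsStrongEmb C δ f →
    ∃ g : A' ↪[L] B', IsStrongEmb C δ g ∧ ∀ a, g (ιA a) = ιB (f a)

/-- AAP: the asymmetric amalgamation property of the finitely generated members of `K`. -/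
def CondAAP (K C : StrClass.{u} L) (δ : StrFun.{u} L) : Prop :=
  ∀ (A₀ A₁ A₂ : Type u) [L.Structure A₀] [L.Structure A₁] [L.Structure A₂]
    (f₁ : A₀ ↪[L] A₁) (f₂ : A₀ ↪[L] A₂), IsFG K A₀ → IsFG K A₁ → IsFG K A₂ →
    IsStrongEmb C δ f₁ →
    ∃ (B : Type u) (_ : L.Structure B) (g₁ : A₁ ↪[L] B) (g₂ : A₂ ↪[L] B), IsFG K B ∧
      IsStrongEmb C δ g₂ ∧ (∀ a, g₁ (f₁ a) = g₂ (f₂ a)) ∧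
      (IsStrongEmb C δ f₂ → IsStrongEmb C δ g₁)

/-- The standing assumptions on the class `C`, its subclass `K` and the non-negative predimension
`δ` on the finitely generated members of `C`. -/
structure IsAmalgamationSetting (C K : StrClass.{u} L) (δ : StrFun.{u} L) : Prop where
  isoClosed : IsoClosed C
  interClosed : InterClosed C
  jointEmbedding : JointEmbedding C
  hasSmallest : HasSmallest C
  countable_fg : ∀ (A : Type u) [L.Structure A], IsFG C A → Countable A
  condFG : CondFG C
  predimension : IsPredimension C δ
  nonneg : ∀ (A : Type u) [L.Structure A], IsFG C A → 0 ≤ δ A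
  condDCC : CondDCC C δ
  condC1 : CondC1 C δ
  condC2 : ChainClosed C C δ
  sub_le : ∀ (A : Type u) [L.Structure A], K A → C A
  sub_isoClosed : IsoClosed K
  sub_interClosed : InterClosed K
  sub_countable_fg : ∀ (A : Type u) [L.Structure A], IsFG K A → Countable A
  condC3 : CondC3 K C δ
  condC4 : CondC4 K C δ
  condC5 : ChainClosed K C δ
  condAAP : CondAAP K C δ

/-- `U` is the strong Fraïssé limit of the finitely generated members of `C`. -/
structure IsStrongFraisseLimit (C : StrClass.{u} L) (δ : StrFun.{u} L) (U : Type u)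
    [L.Structure U] : Prop where
  mem : C U
  countable : Countable U
  universal : ∀ (A : Type u) [L.Structure A], C A → Countable A →
    ∃ f : A ↪[L] U, IsStrongEmb C δ f
  rich : ∀ (A B : Type u) [L.Structure A] [L.Structure B] (f : A ↪[L] U) (g : A ↪[L] B),
    IsFG C A → IsFG C B → IsStrongEmb C δ f → IsStrongEmb C δ g →
    ∃ h : B ↪[L] U, IsStrongEmb C δ h ∧ ∀ a, h (g a) = f a

/-- `δ` is strongly adequate for `M`. -/
structure IsStronglyAdequate (C K : StrClass.{u} L) (δ : StrFun.{u} L) (M : Type u)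
    [L.Structure M] : Prop where
  setting : IsAmalgamationSetting C K δ
  mem : C M
  countable : Countable M
  universallyDefinable : UniversallyDefinable C δ M
  limit : ∃ (U : Type u) (_ : L.Structure U), IsStrongFraisseLimit C δ U ∧ Nonempty (M ≃[L] U)

/-- `δ` is trivial on `K`: all embeddings between members of `K` are strong. -/
def IsTrivialOn (K C : StrClass.{u} L) (δ : StrFun.{u} L) : Prop :=
  ∀ (A B : Type u) [L.Structure A] [L.Structure B], K A → K B → ∀ f : A ↪[L] B,
    IsStrongEmb C δ f

/-- The `d`-generic `1`-types of `M` over finite sets are not algebraic. Here `b` is `d`-generic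
over `X` if `d(b/X) = d(X ∪ {b}) - d(X)` is positive, and its type over `X` is not algebraic if
every `X`-definable set containing `b` is infinite. -/
def GenericNonAlgebraic (C : StrClass.{u} L) (δ : StrFun.{u} L) (M : Type u)
    [L.Structure M] : Prop :=
  ∀ (X : Set M) (b : M), X.Finite → 1 ≤ dim C δ (insert b X) - dim C δ X →
    ∀ S : Set M, X.Definable₁ L S → b ∈ S → S.Infinite

end General

/-! ### Differentially closed fields and their reducts -/

/-- Differentially closed fields of characteristic `0` (Blum's axioms). A differential polynomial in
one differential variable is a polynomial in variables `0, 1, 2, …`, the variable `i` standing for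
the `i`-th derivative; `n` is the order of `f` and the order of `g` is smaller. -/
def IsDifferentiallyClosed {F : Type u} [Field F] (D : Derivation ℤ F F) : Prop :=
  CharZero F ∧ ∀ (n : ℕ) (f g : MvPolynomial ℕ F), n ∈ f.vars → (∀ i ∈ f.vars, i ≤ n) →
    (∀ i ∈ g.vars, i < n) → g ≠ 0 →
    ∃ x : F, MvPolynomial.eval (fun i => D^[i] x) f = 0 ∧
      MvPolynomial.eval (fun i => D^[i] x) g ≠ 0

/-- The only symbol for a derivation is unary. -/
inductive DerivFunc : ℕ → Type
  | deriv : DerivFunc 1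

/-- The language with one unary function symbol. -/
def derivLang : FirstOrder.Language.{0, 0} := ⟨DerivFunc, fun _ => Empty⟩

/-- The language of differential rings. -/
abbrev diffRing : FirstOrder.Language.{0, 0} := Language.ring.sum derivLang

/-- The field `F`, regarded as a structure in the language of differential rings via `D`. -/
def DiffField {F : Type u} [Field F] (_D : Derivation ℤ F F) : Type u := F

section

variable {F : Type u} [Field F]

instance (D : Derivation ℤ F F) : Language.ring.Structure (DiffField D) :=
  (Ring.compatibleRingOfRing F).toStructure

instance (D : Derivation ℤ F F) : derivLang.Structure (DiffField D) where
  funMap := fun {_} f => match f with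
    | DerivFunc.deriv => fun x => D (x 0)
  RelMap := fun {_} r => nomatch r

/-- The relational language with `Rel n` as set of `n`-ary relation symbols. -/
def relLang (Rel : ℕ → Type v) : FirstOrder.Language.{0, v} := ⟨fun _ => Empty, Rel⟩

/-- The language of reducts: the language of rings with the relation symbols in `Rel`. -/
abbrev reductLang (Rel : ℕ → Type v) : FirstOrder.Language.{0, v} := Language.ring.sum (relLang Rel)

variable {Rel : ℕ → Type v}

/-- The field `F` together with the relations `P`, a structure in the language of reducts. -/
def Reduct (_P : ∀ n, Rel n → Set (Fin n → F)) : Type u := F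

instance (P : ∀ n, Rel n → Set (Fin n → F)) : Language.ring.Structure (Reduct P) :=
  (Ring.compatibleRingOfRing F).toStructure

instance (P : ∀ n, Rel n → Set (Fin n → F)) : (relLang Rel).Structure (Reduct P) where
  funMap := fun {_} f => nomatch f
  RelMap := fun {n} r x => (x : Fin n → F) ∈ P n r

/-- The graph of the derivation, as a set of pairs of elements of the reduct. -/
def derivGraph (D : Derivation ℤ F F) (P : ∀ n, Rel n → Set (Fin n → F)) :
    Set (Fin 2 → Reduct P) :=
  {x | (show F from x 1) = D (show F from x 0)}

/-- All relations `P` are definable without parameters in the differential field. -/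
def AllDefinable (D : Derivation ℤ F F) (P : ∀ n, Rel n → Set (Fin n → F)) : Prop :=
  ∀ n r, (∅ : Set (DiffField D)).Definable diffRing (P n r : Set (Fin n → DiffField D))

end

/-- The ring operations of `A` make it an algebraically closed field of characteristic `0` and of
finite transcendence degree over `ℚ`. -/
def IsACFOfFiniteTrdeg (Rel : ℕ → Type v) (A : Type u) [(reductLang Rel).Structure A] : Prop :=
  ∃ (_ : Field A) (_ : CharZero A), IsAlgClosed A ∧ Algebra.trdeg ℚ A < ℵ₀ ∧
    (∀ x : Fin 2 → A,
      Structure.funMap (L := reductLang Rel) (Sum.inl ringFunc.add) x = x 0 + x 1) ∧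
    (∀ x : Fin 2 → A,
      Structure.funMap (L := reductLang Rel) (Sum.inl ringFunc.mul) x = x 0 * x 1) ∧
    (∀ x : Fin 1 → A,
      Structure.funMap (L := reductLang Rel) (Sum.inl ringFunc.neg) x = - x 0) ∧
    (∀ x : Fin 0 → A,
      Structure.funMap (L := reductLang Rel) (Sum.inl ringFunc.zero) x = 0) ∧
    (∀ x : Fin 0 → A,
      Structure.funMap (L := reductLang Rel) (Sum.inl ringFunc.one) x = 1)

end Predim

open Predim

/-!
Write `U` for the reduct `(F, P)` and `N` for the differential field `(F, D)`. All three conclusions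
follow from the fact that *every endomorphism of `U` preserves `D`* (`reductHom_deriv`).

**From endomorphisms to the conclusions.** Since `N` is countable and saturated, an inclusion
between the existential types of two finite tuples of `U` is realised by an endomorphism of `U`
(`ELe.exists_end`), and a set definable in `N` is existentially definable in `U` as soon as it is
preserved by all endomorphisms of `U` (`eDef_of_preserved`). If endomorphisms preserve `D`, then on
a finite set each of them agrees with an automorphism of `N`, because `N` is homogeneous with
quantifier elimination: a relation whose two coordinates satisfy the same algebraic differential
equations extends to an automorphism (`DGood.exists_equiv`). Hence every set definable in `N` is
existentially definable in `U`, which gives the existential definition of `D` and model completeness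
(`isModelComplete_of_existential`). Moreover inclusions of existential types in `U` preserve the
dimension `d`. Triviality follows: an embedding is strong exactly if it does not decrease the
dimension of finite sets (`isStrongEmb_iff`), and for an embedding `A → B` in `K` the asymmetric
amalgamation property transports existential formulas along it, after finitely generated parts of
`A` and `B` have been strongly embedded in `U` (`mem_of_exSet_of_hull`).

**Endomorphisms preserve `D`.** Let `f` be an endomorphism of `U`.

* If `d(f a) = d(a)`, then `f (D a) = D (f a)` (`reductHom_deriv_of_dim_eq`). Indeed `D a` is
  definable over `a`, so the hypothesis on `d`-generic types gives `d(a, D a) = d(a)`. Hence `D a`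
  lies in a strong substructure around `a` whose image is strong around `f a`, and by homogeneity
  of the Fraïssé limit (`StrongIso.exists_equiv`) `f` agrees there with an automorphism of `U`; as
  `D` is definable in `U`, automorphisms preserve it.
* Differentially transcendental elements are conjugate in `N` and so have the same dimension. Thus
  `D` is preserved at `g` if `g` and its image are differentially transcendental. If `D` is not
  preserved at `a`, then no endomorphism that agrees with `f` on `a` and `D a` maps an element `g`
  differentially transcendental over `a` to one differentially transcendental over `f a, f (D a)`,
  for otherwise `D` would be preserved at `g` and at `g + a`. By saturation and homogeneity, `f g`
  satisfies one and the same nonzero differential equation for all `g` differentially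
  transcendental over `a`.
* As `g` may be translated, this forces the jets of the elements of `f(F)` to lie in a proper
  subspace, that is, `f(F)` satisfies a linear differential equation
  (`eq_zero_of_eval_jet_eq_zero`). A subring with a nonconstant element satisfies no nontrivial
  one, since commutators with multiplication operators lower the order (`leadingCoeff_eq_zero`).
  So `D` vanishes on `f(F)`.
* This is impossible (`exists_deriv_reductHom_ne_zero`): for every field automorphism `σ` of `F`
  the fields of constants `f(F)` and `f(σ(F))` are conjugate by automorphisms of `N` on finite
  sets, so that `σ` preserves the relations `P` and therefore `D`; but some `σ` fixes a
  differentially transcendental element `a` and moves `D a`.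
-/

namespace Predim

/-! ### Existentially definable sets -/

section Existential

open BoundedFormula

variable {L : FirstOrder.Language.{0, v}} {M : Type u} [L.Structure M]

/-- A set of tuples defined by a block of existential quantifiers, over an arbitrary finite type of
variables, in front of a quantifier-free formula. -/
def ExSet (L : FirstOrder.Language.{0, v}) {M : Type u} [L.Structure M] {α : Type}
    (s : Set (α → M)) : Prop :=
  ∃ (κ : Type) (_ : Finite κ) (ψ : L.Formula (α ⊕ κ)), ψ.IsQF ∧
    ∀ x, x ∈ s ↔ ∃ y : κ → M, ψ.Realize (Sum.elim x y)

lemma isExistential_exs {α : Type} {n : ℕ} {φ : L.BoundedFormula α n} (h : φ.IsExistential) :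
    φ.exs.IsExistential := by
  induction n with
  | zero => exact h
  | succ n ih => exact ih h.ex

lemma isQF_formula_relabel {α β : Type} (g : α → β) {φ : L.Formula α} (h : φ.IsQF) :
    (φ.relabel g).IsQF :=
  IsQF.relabel h _

lemma boundedFormula_realize_iff {α : Type} (φ : L.Formula α) (v : α → M) (xs : Fin 0 → M) :
    BoundedFormula.Realize φ v xs ↔ φ.Realize v := by
  rw [Formula.Realize, Subsingleton.elim xs default]

lemma ExSet.existentiallyDefinable {n : ℕ} {s : Set (Fin n → M)} (h : ExSet L s) :
    ExistentiallyDefinable L s := by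
  obtain ⟨κ, _, ψ, hψ, hs⟩ := h
  obtain ⟨k, ⟨e⟩⟩ := Finite.exists_equiv_fin κ
  refine ⟨(BoundedFormula.relabel (n := k) (Sum.map id e) ψ).exs, ?_, fun x => ?_⟩
  · exact isExistential_exs (IsQF.relabel hψ _).isExistential
  · rw [hs, realize_exs]
    constructor
    · rintro ⟨y, hy⟩
      refine ⟨y ∘ e.symm, ?_⟩
      refine realize_relabel.trans ((boundedFormula_realize_iff _ _ _).trans ?_) |>.2 hy
      rw [show Sum.elim x ((y ∘ e.symm) ∘ Fin.castAdd 0) ∘ Sum.map id e = Sum.elim x y by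
        ext i; rcases i with i | i <;> simp]
    · rintro ⟨y, hy⟩
      refine ⟨y ∘ e, (realize_relabel.trans ((boundedFormula_realize_iff _ _ _).trans ?_)).1 hy⟩
      rw [show Sum.elim x (y ∘ Fin.castAdd 0) ∘ Sum.map id ⇑e = Sum.elim x (y ∘ e) by
        ext i; rcases i with i | i <;> simp]

lemma exSet_of_isQF {α : Type} {φ : L.Formula α} (h : φ.IsQF) :
    ExSet L {x : α → M | φ.Realize x} := by
  refine ⟨PEmpty, inferInstance, φ.relabel Sum.inl, isQF_formula_relabel _ h, fun x => ?_⟩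
  simp [Formula.realize_relabel, Set.mem_ofPred_eq]

lemma ExSet.inter {α : Type} {s t : Set (α → M)} (hs : ExSet L s) (ht : ExSet L t) :
    ExSet L (s ∩ t) := by
  obtain ⟨κ, _, φ, hφ, hs⟩ := hs
  obtain ⟨κ', _, ψ, hψ, ht⟩ := ht
  refine ⟨κ ⊕ κ', inferInstance, φ.relabel (Sum.map id Sum.inl) ⊓ ψ.relabel (Sum.map id Sum.inr),
    (isQF_formula_relabel _ hφ).inf (isQF_formula_relabel _ hψ), fun x => ?_⟩
  simp only [Set.mem_inter_iff, hs, ht, Formula.realize_inf, Formula.realize_relabel]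
  constructor
  · rintro ⟨⟨y, hy⟩, z, hz⟩
    refine ⟨Sum.elim y z, ?_, ?_⟩
    · convert hy using 1; ext i; rcases i with i | i <;> simp
    · convert hz using 1; ext i; rcases i with i | i <;> simp
  · rintro ⟨y, hy, hz⟩
    refine ⟨⟨y ∘ Sum.inl, ?_⟩, ⟨y ∘ Sum.inr, ?_⟩⟩
    · convert hy using 1; ext i; rcases i with i | i <;> simp
    · convert hz using 1; ext i; rcases i with i | i <;> simp

lemma ExSet.union [Nonempty M] {α : Type} {s t : Set (α → M)} (hs : ExSet L s) (ht : ExSet L t) :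
    ExSet L (s ∪ t) := by
  obtain ⟨κ, _, φ, hφ, hs⟩ := hs
  obtain ⟨κ', _, ψ, hψ, ht⟩ := ht
  refine ⟨κ ⊕ κ', inferInstance, φ.relabel (Sum.map id Sum.inl) ⊔ ψ.relabel (Sum.map id Sum.inr),
    (isQF_formula_relabel _ hφ).sup (isQF_formula_relabel _ hψ), fun x => ?_⟩
  simp only [Set.mem_union, hs, ht, Formula.realize_sup, Formula.realize_relabel]
  constructor
  · rintro (⟨y, hy⟩ | ⟨z, hz⟩)
    · refine ⟨Sum.elim y fun _ => Classical.arbitrary M, Or.inl ?_⟩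
      convert hy using 1; ext i; rcases i with i | i <;> simp
    · refine ⟨Sum.elim (fun _ => Classical.arbitrary M) z, Or.inr ?_⟩
      convert hz using 1; ext i; rcases i with i | i <;> simp
  · rintro ⟨y, hy | hz⟩
    · refine Or.inl ⟨y ∘ Sum.inl, ?_⟩
      convert hy using 1; ext i; rcases i with i | i <;> simp
    · refine Or.inr ⟨y ∘ Sum.inr, ?_⟩
      convert hz using 1; ext i; rcases i with i | i <;> simp

lemma ExSet.preimage_comp {α β : Type} (ρ : α → β) {s : Set (α → M)} (hs : ExSet L s) :
    ExSet L {x : β → M | x ∘ ρ ∈ s} := by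
  obtain ⟨κ, _, φ, hφ, hs⟩ := hs
  refine ⟨κ, inferInstance, φ.relabel (Sum.map ρ id), isQF_formula_relabel _ hφ, fun x => ?_⟩
  simp only [Set.mem_ofPred_eq, hs, Formula.realize_relabel]
  refine exists_congr fun y => ?_
  rw [show Sum.elim x y ∘ Sum.map ρ id = Sum.elim (x ∘ ρ) y by
    ext i; rcases i with i | i <;> simp]

/-- Existentially definable sets are closed under projections. -/
lemma ExSet.exists_snoc {n : ℕ} {s : Set (Fin (n + 1) → M)} (hs : ExSet L s) :
    ExSet L {x : Fin n → M | ∃ y, (Fin.snoc x y : Fin (n + 1) → M) ∈ s} := by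
  obtain ⟨κ, _, φ, hφ, hs⟩ := hs
  refine ⟨Option κ, inferInstance,
    φ.relabel (Sum.elim (Fin.snoc (α := fun _ => Fin n ⊕ Option κ) Sum.inl (Sum.inr none))
      (Sum.inr ∘ some)), isQF_formula_relabel _ hφ, fun x => ?_⟩
  have key : ∀ y : Option κ → M, Sum.elim x y ∘
      (Sum.elim (Fin.snoc (α := fun _ => Fin n ⊕ Option κ) Sum.inl (Sum.inr none))
      (Sum.inr ∘ some)) = Sum.elim (Fin.snoc x (y none) : Fin (n + 1) → M) (y ∘ some) := by
    intro y
    ext i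
    rcases i with i | i
    · induction i using Fin.lastCases <;> simp
    · simp
  simp only [Set.mem_ofPred_eq, hs, Formula.realize_relabel, key]
  constructor
  · rintro ⟨a, y, hy⟩
    exact ⟨fun o => o.elim a y, by simpa [Function.comp_def] using hy⟩
  · rintro ⟨y, hy⟩
    exact ⟨_, _, hy⟩

lemma ExSet.definable {α : Type} {s : Set (α → M)} (hs : ExSet L s) :
    (∅ : Set M).Definable L s := by
  obtain ⟨κ, _, φ, hφ, hs⟩ := hs
  have : (∅ : Set M).Definable L {x : α ⊕ κ → M | φ.Realize x} :=
    Set.empty_definable_iff.2 ⟨φ, rfl⟩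
  have h2 := this.exists_of_finite
  convert h2 using 1
  ext x
  rw [hs]; rfl

/-- Existentially definable sets are preserved by endomorphisms. -/
lemma ExSet.mem_comp {α : Type} {s : Set (α → M)} (hs : ExSet L s)
    (f : M ↪[L] M) {x : α → M} (hx : x ∈ s) : f ∘ x ∈ s := by
  obtain ⟨κ, _, φ, hφ, hs⟩ := hs
  rw [hs] at hx ⊢
  obtain ⟨y, hy⟩ := hx
  refine ⟨f ∘ y, ?_⟩
  rw [← Sum.comp_elim]
  exact (boundedFormula_realize_iff _ _ _).1
    ((IsQF.realize_embedding hφ f (v := Sum.elim x y) (xs := default)).2 hy)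

end Existential

/-! ### Definable sets of the differential field and of its reduct -/

section Definability

variable {F : Type u} [Field F]

/-- Sets of tuples definable without parameters in the differential field `(F, D)`. The tuples are
tuples of elements of `F`, which is the carrier of `DiffField D` up to unfolding. -/
def DDef (D : Derivation ℤ F F) {α : Type} (s : Set (α → F)) : Prop :=
  (∅ : Set (DiffField D)).Definable diffRing (s : Set (α → DiffField D))

/-- Sets of tuples existentially definable without parameters in the reduct. -/
def EDef {Rel : ℕ → Type v} (P : ∀ n, Rel n → Set (Fin n → F)) {α : Type}
    (s : Set (α → F)) : Prop :=
  ExSet (reductLang Rel) (M := Reduct P) s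

variable {Rel : ℕ → Type v} {P : ∀ n, Rel n → Set (Fin n → F)} {D : Derivation ℤ F F}

lemma exists_diffRing_term {γ : Type} (t : (reductLang Rel).Term γ) :
    ∃ t' : diffRing.Term γ, ∀ x : γ → F,
      (t'.realize (M := DiffField D) x : F) = t.realize (M := Reduct P) x := by
  induction t with
  | var i => exact ⟨.var i, fun x => rfl⟩
  | func f ts ih =>
    choose ts' h using ih
    rcases f with f | f
    · refine ⟨.func (Sum.inl f) ts', fun x => ?_⟩
      have : (fun i => (ts' i).realize (M := DiffField D) x) =
          fun i => (ts i).realize (M := Reduct P) x := funext fun i => h i x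
      simp only [Term.realize]
      erw [this]
      rfl
    · exact nomatch f

/-- Since the relations of the reduct are definable in `(F, D)`, each formula of the reduct can be
rewritten as a formula in the language of differential rings. -/
lemma exists_diffRing_formula (hP : AllDefinable D P) {α : Type} {n : ℕ}
    (φ : (reductLang Rel).BoundedFormula α n) :
    ∃ φ' : diffRing.BoundedFormula α n, ∀ (x : α → F) (y : Fin n → F),
      φ'.Realize (M := DiffField D) x y ↔ φ.Realize (M := Reduct P) x y := by
  induction φ with
  | falsum => exact ⟨⊥, fun x y => Iff.rfl⟩
  | equal t₁ t₂ =>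
    obtain ⟨t₁', h₁⟩ := exists_diffRing_term (P := P) (D := D) t₁
    obtain ⟨t₂', h₂⟩ := exists_diffRing_term (P := P) (D := D) t₂
    refine ⟨t₁'.bdEqual t₂', fun x y => ?_⟩
    have e₁ := h₁ (Sum.elim x y)
    have e₂ := h₂ (Sum.elim x y)
    refine (BoundedFormula.realize_bdEqual _ _).trans ?_
    exact Eq.congr e₁ e₂
  | rel R ts =>
    rcases R with R | R
    · exact nomatch R
    · choose ts' h using fun i => exists_diffRing_term (P := P) (D := D) (ts i)
      obtain ⟨χ, hχ⟩ := Set.empty_definable_iff.1 (hP _ R)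
      refine ⟨BoundedFormula.relabel (L := diffRing) id (χ.subst ts'), fun x y => ?_⟩
      refine BoundedFormula.realize_relabel.trans ?_
      refine (boundedFormula_realize_iff (M := DiffField D) _ _ _).trans ?_
      refine BoundedFormula.realize_subst.trans ?_
      have key : ∀ z, χ.Realize (M := DiffField D) z ↔ (z : Fin _ → F) ∈ P _ R := fun z =>
        (Set.ext_iff.1 hχ z).symm
      refine (key _).trans ?_
      refine iff_of_eq (congrArg (· ∈ P _ R) (funext fun i => ?_))
      exact h i (Sum.elim x y)
  | imp φ ψ ihφ ihψ =>
    obtain ⟨φ', hφ⟩ := ihφ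
    obtain ⟨ψ', hψ⟩ := ihψ
    exact ⟨φ'.imp ψ', fun x y => imp_congr (hφ x y) (hψ x y)⟩
  | all φ ih =>
    obtain ⟨φ', hφ⟩ := ih
    exact ⟨φ'.all, fun x y => forall_congr' fun a => hφ x _⟩

lemma ddef_of_definable (hP : AllDefinable D P) {α : Type} {s : Set (α → F)}
    (hs : (∅ : Set (Reduct P)).Definable (reductLang Rel) s) : DDef D s := by
  obtain ⟨φ, hφ⟩ := Set.empty_definable_iff.1 hs
  obtain ⟨φ', h⟩ := exists_diffRing_formula hP φ
  refine Set.empty_definable_iff.2 ⟨φ', Set.ext fun x => ?_⟩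
  exact (Set.ext_iff.1 hφ x).trans (h x _).symm

lemma EDef.ddef (hP : AllDefinable D P) {α : Type} {s : Set (α → F)} (hs : EDef P s) :
    DDef D s :=
  ddef_of_definable hP (ExSet.definable hs)

lemma DDef.sdiff {α : Type} {s t : Set (α → F)} (hs : DDef D s) (ht : DDef D t) :
    DDef D (s \ t) :=
  Set.Definable.sdiff hs ht

lemma DDef.exists_snoc {n : ℕ} {s : Set (Fin (n + 1) → F)} (hs : DDef D s) :
    DDef D {x : Fin n → F | ∃ y, (Fin.snoc x y : Fin (n + 1) → F) ∈ s} := by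
  have := Set.Definable.exists_of_finite (α := Fin n) (β := Unit)
    (Set.Definable.preimage_comp
    (Fin.snoc (α := fun _ => Fin n ⊕ Unit) Sum.inl (Sum.inr ())) hs)
  refine Eq.subst (motive := fun t => Set.Definable _ diffRing t) (Set.ext fun z => ?_) this
  let x : Fin n → F := z
  have key : ∀ u : Unit → F, (fun i => Sum.elim x u
      ((Fin.snoc (α := fun _ => Fin n ⊕ Unit) Sum.inl (Sum.inr ()) : Fin (n + 1) → _) i)) =
      (Fin.snoc x (u ()) : Fin (n + 1) → F) := by
    intro u
    ext i
    induction i using Fin.lastCases <;> simp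
  constructor
  · rintro ⟨u, hu⟩
    exact ⟨u (), key u ▸ hu⟩
  · rintro ⟨y, hy⟩
    refine ⟨fun _ => y, ?_⟩
    have h := (key fun _ => y).symm
    exact Eq.subst (motive := fun t => t ∈ s) h hy

/-! ### Automorphisms and definable sets -/

/-- A field automorphism commuting with `D`, as an automorphism of the structure `(F, D)`. -/
def diffEquiv (σ : F ≃+* F) (hσ : ∀ x, σ (D x) = D (σ x)) :
    DiffField D ≃[diffRing] DiffField D where
  toEquiv := σ.toEquiv
  map_fun' := by
    intro n f x
    rcases f with f | f
    · cases f
      · exact map_add σ (show F from x 0) (show F from x 1)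
      · exact map_mul σ (show F from x 0) (show F from x 1)
      · exact map_neg σ (show F from x 0)
      · exact map_zero σ
      · exact map_one σ
    · cases f
      exact hσ (x 0)
  map_rel' := by
    intro n r x
    rcases r with r | r <;> exact nomatch r

/-- Definable sets are invariant under differential automorphisms. -/
lemma DDef.comp_mem_iff (σ : F ≃+* F) (hσ : ∀ x, σ (D x) = D (σ x)) {α : Type}
    {s : Set (α → F)} (hs : DDef D s) (x : α → F) : σ ∘ x ∈ s ↔ x ∈ s := by
  obtain ⟨φ, hφ⟩ := Set.empty_definable_iff.1 hs
  have h1 := Set.ext_iff.1 hφ x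
  have h2 := Set.ext_iff.1 hφ (σ ∘ x)
  have h3 := StrongHomClass.realize_formula (M := DiffField D) (N := DiffField D)
    (diffEquiv σ hσ) φ (v := x)
  exact h2.trans (h3.trans h1.symm)

/-- A field automorphism preserving the relations, as an automorphism of the reduct. -/
def reductEquiv (σ : F ≃+* F) (hσ : ∀ n (r : Rel n) x, σ ∘ x ∈ P n r ↔ x ∈ P n r) :
    Reduct P ≃[reductLang Rel] Reduct P where
  toEquiv := σ.toEquiv
  map_fun' := by
    intro n f x
    rcases f with f | f
    · cases f
      · exact map_add σ (show F from x 0) (show F from x 1)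
      · exact map_mul σ (show F from x 0) (show F from x 1)
      · exact map_neg σ (show F from x 0)
      · exact map_zero σ
      · exact map_one σ
    · exact nomatch f
  map_rel' := by
    intro n r x
    rcases r with r | r
    · exact nomatch r
    · exact hσ n r x

/-- The ring homomorphism underlying an embedding between reducts. -/
def reductHom (f : Reduct P ↪[reductLang Rel] Reduct P) : F →+* F where
  toFun := f
  map_add' x y := HomClass.map_fun f (Sum.inl ringFunc.add : (reductLang Rel).Functions 2) ![x, y]
  map_mul' x y := HomClass.map_fun f (Sum.inl ringFunc.mul : (reductLang Rel).Functions 2) ![x, y]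
  map_zero' := HomClass.map_fun f (Sum.inl ringFunc.zero : (reductLang Rel).Functions 0) ![]
  map_one' := HomClass.map_fun f (Sum.inl ringFunc.one : (reductLang Rel).Functions 0) ![]

/-- Definable sets are invariant under automorphisms of the reduct. -/
lemma definable_comp_mem_iff (σ : Reduct P ≃[reductLang Rel] Reduct P) {α : Type}
    {s : Set (α → F)} (hs : (∅ : Set (Reduct P)).Definable (reductLang Rel) s) (x : α → F) :
    (σ ∘ x : α → F) ∈ s ↔ x ∈ s := by
  obtain ⟨φ, hφ⟩ := Set.empty_definable_iff.1 hs
  have h1 := Set.ext_iff.1 hφ x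
  have h2 := Set.ext_iff.1 hφ (σ ∘ x)
  have h3 := StrongHomClass.realize_formula (M := Reduct P) (N := Reduct P) σ φ (v := x)
  exact h2.trans (h3.trans h1.symm)

end Definability

/-! ### Going forth, and back and forth -/

section BackAndForth

variable {α : Type u} [Countable α] {Good : Set (α × α) → Prop}

/-- Going forth: if each finite good relation can be extended to any further point of its domain,
then it extends to a function all of whose finite parts are contained in good relations. -/
lemma exists_fun_of_forth
    (forth : ∀ R : Set (α × α), R.Finite → Good R → ∀ a, ∃ b, Good (insert (a, b) R))
    {R₀ : Set (α × α)} (hfin : R₀.Finite) (h₀ : Good R₀) :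
    ∃ f : α → α, ∀ T : Set α, T.Finite → ∃ R, Good R ∧ R₀ ⊆ R ∧ ∀ a ∈ T, (a, f a) ∈ R := by
  rcases isEmpty_or_nonempty α with hα | hα
  · exact ⟨id, fun T _ => ⟨R₀, h₀, subset_rfl, fun a => hα.elim a⟩⟩
  obtain ⟨c, hc⟩ := exists_surjective_nat α
  choose g hg using fun (R : {R : Set (α × α) // R.Finite ∧ Good R}) a => forth R.1 R.2.1 R.2.2 a
  let s : ℕ → {R : Set (α × α) // R.Finite ∧ Good R} := fun n => Nat.rec ⟨R₀, hfin, h₀⟩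
    (fun n R => ⟨insert (c n, g R (c n)) R.1, R.2.1.insert _, hg R (c n)⟩) n
  have hs : ∀ n, (s (n + 1)).1 = insert (c n, g (s n) (c n)) (s n).1 := fun n => rfl
  have hmono : Monotone fun n => (s n).1 := monotone_nat_of_le_succ fun n => by
    rw [hs]; exact Set.subset_insert _ _
  have hex : ∀ a, ∃ b, ∃ n, (a, b) ∈ (s n).1 := fun a => by
    obtain ⟨n, rfl⟩ := hc a
    exact ⟨_, n + 1, by rw [hs]; exact Set.mem_insert _ _⟩
  choose f k hk using hex
  refine ⟨f, fun T hT => ?_⟩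
  obtain ⟨N, hN⟩ := (hT.image k).bddAbove
  exact ⟨(s N).1, (s N).2.2, hmono (Nat.zero_le N), fun a ha =>
    hmono (hN (Set.mem_image_of_mem _ ha)) (hk a)⟩

/-- Back and forth: if finite good relations are graphs of partial bijections and can be extended
to any further point on either side, then they extend to bijections all of whose finite parts are
contained in good relations. -/
lemma exists_equiv_of_back_and_forth
    (inj : ∀ R, Good R → ∀ p ∈ R, ∀ q ∈ R, p.1 = q.1 ↔ p.2 = q.2)
    (forth : ∀ R : Set (α × α), R.Finite → Good R → ∀ a, ∃ b, Good (insert (a, b) R))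
    (back : ∀ R : Set (α × α), R.Finite → Good R → ∀ b, ∃ a, Good (insert (a, b) R))
    {R₀ : Set (α × α)} (hfin : R₀.Finite) (h₀ : Good R₀) :
    ∃ σ : α ≃ α, (∀ p ∈ R₀, σ p.1 = p.2) ∧
      ∀ T : Set α, T.Finite → ∃ R, Good R ∧ ∀ a ∈ T, (a, σ a) ∈ R := by
  rcases isEmpty_or_nonempty α with hα | hα
  · exact ⟨Equiv.refl _, fun p => hα.elim p.1, fun T _ => ⟨R₀, h₀, fun a => hα.elim a⟩⟩
  obtain ⟨c, hc⟩ := exists_surjective_nat α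
  choose g hg using fun (R : {R : Set (α × α) // R.Finite ∧ Good R}) a => forth R.1 R.2.1 R.2.2 a
  choose g' hg' using fun (R : {R : Set (α × α) // R.Finite ∧ Good R}) a => back R.1 R.2.1 R.2.2 a
  -- the `n`-th step adds the `n`-th element of `α` first to the domain and then to the range
  let s : ℕ → {R : Set (α × α) // R.Finite ∧ Good R} := fun n => Nat.rec ⟨R₀, hfin, h₀⟩
    (fun n R =>
      let R' : {R : Set (α × α) // R.Finite ∧ Good R} :=
        ⟨insert (c n, g R (c n)) R.1, R.2.1.insert _, hg R (c n)⟩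
      ⟨insert (g' R' (c n), c n) R'.1, R'.2.1.insert _, hg' R' (c n)⟩) n
  have hs : ∀ n, ∃ a b, (s (n + 1)).1 = insert (a, c n) (insert (c n, b) (s n).1) :=
    fun n => ⟨_, _, rfl⟩
  have hmono : Monotone fun n => (s n).1 := monotone_nat_of_le_succ fun n => by
    obtain ⟨a, b, h⟩ := hs n
    rw [h]; exact (Set.subset_insert _ _).trans (Set.subset_insert _ _)
  have hex : ∀ a, ∃ b, ∃ n, (a, b) ∈ (s n).1 := fun a => by
    obtain ⟨n, rfl⟩ := hc a
    obtain ⟨a, b, h⟩ := hs n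
    exact ⟨b, n + 1, by rw [h]; exact Set.mem_insert_of_mem _ (Set.mem_insert _ _)⟩
  have hex' : ∀ b, ∃ a, ∃ n, (a, b) ∈ (s n).1 := fun a => by
    obtain ⟨n, rfl⟩ := hc a
    obtain ⟨a, b, h⟩ := hs n
    exact ⟨a, n + 1, by rw [h]; exact Set.mem_insert _ _⟩
  choose f k hk using hex
  choose f' k' hk' using hex'
  have key : ∀ a b n, (a, b) ∈ (s n).1 → f a = b ∧ f' b = a := fun a b n h => by
    refine ⟨(inj _ (s (max n (k a))).2.2 (a, f a) (hmono (le_max_right _ _) (hk a)) (a, b)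
      (hmono (le_max_left _ _) h)).1 rfl, (inj _ (s (max n (k' b))).2.2 (f' b, b)
      (hmono (le_max_right _ _) (hk' b)) (a, b) (hmono (le_max_left _ _) h)).2 rfl⟩
  refine ⟨⟨f, f', fun a => (key _ _ _ (hk a)).2, fun b => (key _ _ _ (hk' b)).1⟩,
    fun p hp => (key p.1 p.2 0 hp).1, fun T hT => ?_⟩
  obtain ⟨N, hN⟩ := (hT.image k).bddAbove
  exact ⟨(s N).1, (s N).2.2, fun a ha => hmono (hN (Set.mem_image_of_mem _ ha)) (hk a)⟩

end BackAndForth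

/-! ### Saturation -/

section Saturation

/-- Saturation for a downward directed family of definable sets. -/
lemma IsSaturated.exists_mem_of_directed {L : FirstOrder.Language.{0, v}} {M : Type u}
    [L.Structure M] [Infinite M] (hSat : IsSaturated L M) {A : Set M} (hA : A.Finite)
    {ι : Type*} [Nonempty ι] {s : ι → Set M}
    (hdef : ∀ i, A.Definable L {x : Unit → M | x () ∈ s i})
    (hdir : Directed (· ⊇ ·) s) (hne : ∀ i, (s i).Nonempty) :
    ∃ x, ∀ i, x ∈ s i := by
  choose φ hφ using hdef
  have key : ∀ i x, x ∈ s i ↔ (φ i).Realize fun _ => x := fun i x =>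
    Set.ext_iff.1 (hφ i) fun _ => x
  obtain ⟨x, hx⟩ := hSat A ((Cardinal.lt_aleph0_iff_set_finite.2 hA).trans_le
    (Cardinal.aleph0_le_mk M)) (Set.range φ) (fun Φ₀ hfin hsub => by
      obtain ⟨t, ht⟩ : ∃ t : Finset ι, Φ₀ ⊆ φ '' t := by
        choose g hg using fun p : Φ₀ => hsub p.2
        have := hfin.to_subtype
        refine ⟨(Set.finite_range g).toFinset, fun p hp => ⟨g ⟨p, hp⟩, by simp, hg ⟨p, hp⟩⟩⟩
      obtain ⟨z, hz⟩ := hdir.finset_le t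
      obtain ⟨x, hx⟩ := hne z
      refine ⟨x, fun p hp => ?_⟩
      obtain ⟨i, hi, rfl⟩ := ht hp
      exact (key i x).1 (hz i hi hx))
  exact ⟨x, fun i => (key i x).2 (hx _ ⟨i, rfl⟩)⟩

variable {F : Type u} [Field F] {D : Derivation ℤ F F}

/-- Subsets of `F` definable in `(F, D)` with parameters from `A`. -/
def ADef (D : Derivation ℤ F F) (A : Set F) (s : Set F) : Prop :=
  Set.Definable (M := DiffField D) A diffRing {x : Unit → DiffField D | (x () : F) ∈ s}

/-- Unary functions definable in `(F, D)` with parameters from `A`. -/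
def AFun (D : Derivation ℤ F F) (A : Set F) (h : F → F) : Prop :=
  Set.DefinableFun (M := DiffField D) diffRing A (α := Unit)
    (fun x : Unit → DiffField D => (h (x ()) : F))

variable {A : Set F}

lemma ADef.inter {s t : Set F} (hs : ADef D A s) (ht : ADef D A t) : ADef D A (s ∩ t) :=
  Set.Definable.inter hs ht

lemma ADef.compl {s : Set F} (hs : ADef D A s) : ADef D A sᶜ :=
  Set.Definable.compl hs

lemma aFun_const {a : F} (ha : a ∈ A) : AFun D A fun _ => a :=
  definableFun_const (L := diffRing) (M := DiffField D) Unit ha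

lemma aFun_id : AFun D A fun x => x :=
  Set.DefinableFun.proj (M := DiffField D) diffRing

lemma AFun.funMap {n : ℕ} (f : diffRing.Functions n) {h : Fin n → F → F}
    (hh : ∀ i, AFun D A (h i)) :
    AFun D A fun x => Structure.funMap (M := DiffField D) f fun i => h i x :=
  Set.DefinableFun.comp (M := DiffField D) (β := Unit)
    (g := fun (x : Unit → DiffField D) i => h i (x ())) hh
    (Set.DefinableFun.of_empty (Set.DefinableFun.fun_symbol f))

lemma AFun.add {h k : F → F} (hh : AFun D A h) (hk : AFun D A k) :
    AFun D A fun x => h x + k x :=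
  AFun.funMap (Sum.inl ringFunc.add : diffRing.Functions 2) (h := ![h, k])
    (by intro i; fin_cases i <;> assumption)

lemma AFun.mul {h k : F → F} (hh : AFun D A h) (hk : AFun D A k) :
    AFun D A fun x => h x * k x :=
  AFun.funMap (Sum.inl ringFunc.mul : diffRing.Functions 2) (h := ![h, k])
    (by intro i; fin_cases i <;> assumption)

lemma AFun.neg {h : F → F} (hh : AFun D A h) : AFun D A fun x => -h x :=
  AFun.funMap (Sum.inl ringFunc.neg : diffRing.Functions 1) (h := ![h])
    (by intro i; fin_cases i; assumption)

lemma aFun_zero : AFun D A fun _ => 0 :=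
  AFun.funMap (Sum.inl ringFunc.zero : diffRing.Functions 0) (h := ![]) (fun i => i.elim0)

lemma aFun_one : AFun D A fun _ => 1 :=
  AFun.funMap (Sum.inl ringFunc.one : diffRing.Functions 0) (h := ![]) (fun i => i.elim0)

lemma AFun.deriv {h : F → F} (hh : AFun D A h) : AFun D A fun x => D (h x) :=
  AFun.funMap (Sum.inr DerivFunc.deriv : diffRing.Functions 1) (h := ![h])
    (by intro i; fin_cases i; assumption)

lemma AFun.iterate {h : F → F} (hh : AFun D A h) (n : ℕ) : AFun D A fun x => D^[n] (h x) := by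
  induction n with
  | zero => exact hh
  | succ n ih => simpa only [Function.iterate_succ_apply'] using ih.deriv

lemma AFun.zeros {h : F → F} (hh : AFun D A h) : ADef D A {x | h x = 0} :=
  Set.DefinableFun.ofPred_eq (M := DiffField D) hh aFun_zero

lemma DDef.fiber {n : ℕ} {s : Set (Fin (n + 1) → F)} (hs : DDef D s) {e : Fin n → F}
    (he : ∀ i, e i ∈ A) : ADef D A {x | (Fin.snoc e x : Fin (n + 1) → F) ∈ s} := by
  refine Set.Definable.preimage_map (M := DiffField D) (L := diffRing) (A := A)
    (F := fun (x : Unit → DiffField D) => (Fin.snoc e (x ()) : Fin (n + 1) → F))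
    (fun i => ?_) (Set.Definable.mono hs (Set.empty_subset _))
  change AFun D A fun x => (Fin.snoc e x : Fin (n + 1) → F) i
  induction i using Fin.lastCases with
  | last => simpa using aFun_id
  | cast i => simpa using aFun_const (he i)

variable [Infinite F]

lemma exists_mem_of_directed (hSat : IsSaturated diffRing (DiffField D)) (hA : A.Finite)
    {ι : Type*} [Nonempty ι] {s : ι → Set F}
    (hdef : ∀ i, ADef D A (s i)) (hdir : Directed (· ⊇ ·) s) (hne : ∀ i, (s i).Nonempty) :
    ∃ x, ∀ i, x ∈ s i :=
  have : Infinite (DiffField D) := inferInstanceAs (Infinite F)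
  IsSaturated.exists_mem_of_directed hSat hA hdef hdir hne

/-- Saturation for a downward directed family of definable sets of tuples. -/
lemma exists_mem_tuple_of_directed (hSat : IsSaturated diffRing (DiffField D)) {n : ℕ}
    {ι : Type*} [Nonempty ι] {s : ι → Set (Fin n → F)}
    (hdef : ∀ i, DDef D (s i)) (hdir : Directed (· ⊇ ·) s) (hne : ∀ i, (s i).Nonempty) :
    ∃ x, ∀ i, x ∈ s i := by
  induction n with
  | zero =>
    refine ⟨default, fun i => ?_⟩
    obtain ⟨x, hx⟩ := hne i
    rwa [Subsingleton.elim default x]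
  | succ n ih =>
    obtain ⟨e, he⟩ := ih (fun i => (hdef i).exists_snoc) (fun i j => by
        obtain ⟨k, hk⟩ := hdir i j
        exact ⟨k, fun x ⟨y, hy⟩ => ⟨y, hk.1 hy⟩, fun x ⟨y, hy⟩ => ⟨y, hk.2 hy⟩⟩) (fun i => by
        obtain ⟨x, hx⟩ := hne i
        refine ⟨Fin.init x, x (Fin.last n), ?_⟩
        rwa [Fin.snoc_init_self])
    obtain ⟨y, hy⟩ := exists_mem_of_directed hSat (Set.finite_range e)
      (fun i => (hdef i).fiber (fun j => Set.mem_range_self j)) (fun i j => by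
        obtain ⟨k, hk⟩ := hdir i j
        exact ⟨k, fun x hx => hk.1 hx, fun x hx => hk.2 hx⟩) he
    exact ⟨_, hy⟩

end Saturation

/-! ### Existential types and endomorphisms of the reduct -/

section ExistentialTypes

open BoundedFormula

variable {F : Type u} [Field F] {D : Derivation ℤ F F} {Rel : ℕ → Type v}
  {P : ∀ n, Rel n → Set (Fin n → F)}

/-- Each existential formula of the reduct that holds of `e` also holds of `e'`. -/
def ELe (P : ∀ n, Rel n → Set (Fin n → F)) {α : Type} (e e' : α → F) : Prop :=
  ∀ s : Set (α → F), EDef P s → e ∈ s → e' ∈ s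

lemma eDef_univ {α : Type} : EDef P (Set.univ : Set (α → F)) := by
  have := exSet_of_isQF (L := reductLang Rel) (M := Reduct P) (IsQF.top (α := α) (n := 0))
  refine Eq.subst (motive := fun t => ExSet (M := Reduct P) (reductLang Rel) t)
    (Set.ext fun x => ?_) this
  exact iff_of_true (by rw [Set.mem_ofPred_eq]; exact Formula.realize_top.2 trivial) trivial

lemma eDef_empty {α : Type} : EDef P (∅ : Set (α → F)) := by
  have := exSet_of_isQF (L := reductLang Rel) (M := Reduct P) (isQF_bot (α := α) (n := 0))
  refine Eq.subst (motive := fun t => ExSet (M := Reduct P) (reductLang Rel) t)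
    (Set.ext fun x => ?_) this
  exact iff_of_false id id

lemma EDef.inter {α : Type} {s t : Set (α → F)} (hs : EDef P s) (ht : EDef P t) :
    EDef P (s ∩ t) :=
  ExSet.inter hs ht

lemma EDef.union {α : Type} {s t : Set (α → F)} (hs : EDef P s) (ht : EDef P t) :
    EDef P (s ∪ t) :=
  have : Nonempty (Reduct P) := inferInstanceAs (Nonempty F)
  ExSet.union hs ht

lemma EDef.comp_mem {α : Type} {s : Set (α → F)} (hs : EDef P s)
    (f : Reduct P ↪[reductLang Rel] Reduct P) {x : α → F} (hx : x ∈ s) :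
    (f ∘ x : α → F) ∈ s :=
  ExSet.mem_comp hs f hx

lemma ELe.reindex {α β : Type} {e e' : α → F} (h : ELe P e e') (ρ : β → α) :
    ELe P (e ∘ ρ) (e' ∘ ρ) :=
  fun _ hs he => h _ (ExSet.preimage_comp ρ hs) he

/-- The forth step: an inclusion of existential types extends to one further element. -/
lemma ELe.exists_snoc [Infinite F] (hSat : IsSaturated diffRing (DiffField D))
    (hP : AllDefinable D P) {n : ℕ} {e e' : Fin n → F} (h : ELe P e e') (c : F) :
    ∃ c', ELe P (Fin.snoc e c : Fin (n + 1) → F) (Fin.snoc e' c') := by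
  have : Nonempty {s : Set (Fin (n + 1) → F) // EDef P s ∧ (Fin.snoc e c : _ → F) ∈ s} :=
    ⟨⟨_, eDef_univ, trivial⟩⟩
  obtain ⟨c', hc'⟩ := exists_mem_of_directed hSat (Set.finite_range e')
    (s := fun s : {s : Set (Fin (n + 1) → F) // EDef P s ∧ (Fin.snoc e c : _ → F) ∈ s} =>
      {x | (Fin.snoc e' x : Fin (n + 1) → F) ∈ s.1})
    (fun s => (s.2.1.ddef hP).fiber fun i => Set.mem_range_self i)
    (fun s t => ⟨⟨_, s.2.1.inter t.2.1, s.2.2, t.2.2⟩, fun _ hx => hx.1, fun _ hx => hx.2⟩)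
    (fun s => h _ (ExSet.exists_snoc s.2.1) ⟨c, s.2.2⟩)
  exact ⟨c', fun s hs hm => hc' ⟨s, hs, hm⟩⟩

lemma ELe.eq_iff {α : Type} {e e' : α → F} (h : ELe P e e') (i j : α) :
    e i = e j ↔ e' i = e' j := by
  have key : ∀ φ : (reductLang Rel).Formula α, φ.IsQF →
      φ.Realize (M := Reduct P) e → φ.Realize (M := Reduct P) e' := fun φ hφ =>
    h _ (exSet_of_isQF hφ)
  have h1 := key _ (IsAtomic.equal (Term.var (Sum.inl i)) (Term.var (Sum.inl j))).isQF
  have h2 := key _ (IsAtomic.equal (Term.var (Sum.inl i)) (Term.var (Sum.inl j))).isQF.not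
  exact ⟨h1, fun h' => by_contra fun hn => h2 hn h'⟩

/-- Quantifier-free formulas transfer in both directions along an inclusion of existential types. -/
lemma ELe.realize_iff {α : Type} {e e' : α → F} (h : ELe P e e')
    {φ : (reductLang Rel).Formula α} (hφ : φ.IsQF) :
    φ.Realize (M := Reduct P) e ↔ φ.Realize (M := Reduct P) e' := by
  have key : ∀ φ : (reductLang Rel).Formula α, φ.IsQF →
      φ.Realize (M := Reduct P) e → φ.Realize (M := Reduct P) e' := fun φ hφ =>
    h _ (exSet_of_isQF hφ)
  exact ⟨key _ hφ, fun h' => by_contra fun hn => key _ hφ.not hn h'⟩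

lemma map_funMap_of_eLe (f : F → F) (hf : ∀ n (x : Fin n → F), ELe P x (f ∘ x)) {n : ℕ}
    (g : (reductLang Rel).Functions n) (x : Fin n → F) :
    f (Structure.funMap (M := Reduct P) g x) =
      Structure.funMap (M := Reduct P) g fun i => f (x i) := by
  set y : F := Structure.funMap (M := Reduct P) g x with hy
  have h := (hf (n + 1) (Fin.snoc x y : Fin (n + 1) → F)).realize_iff
    (φ := (Term.func g fun i => Term.var (Sum.inl i.castSucc)).bdEqual
      (Term.var (Sum.inl (Fin.last n)))) (IsAtomic.equal _ _).isQF
  have e₁ : (fun i : Fin n => (Fin.snoc x y : Fin (n + 1) → F) i.castSucc) = x := by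
    ext i; rw [Fin.snoc_castSucc]
  have e₂ : (Fin.snoc x y : Fin (n + 1) → F) (Fin.last n) = y := Fin.snoc_last _ _
  have e₃ : (fun i : Fin n => f ((Fin.snoc x y : Fin (n + 1) → F) i.castSucc)) =
      fun i => f (x i) := by ext i; rw [Fin.snoc_castSucc]
  have h' : Structure.funMap (M := Reduct P) g
        (fun i : Fin n => (Fin.snoc x y : Fin (n + 1) → F) i.castSucc) =
        (Fin.snoc x y : Fin (n + 1) → F) (Fin.last n) ↔
      Structure.funMap (M := Reduct P) g
        (fun i : Fin n => f ((Fin.snoc x y : Fin (n + 1) → F) i.castSucc)) =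
        f ((Fin.snoc x y : Fin (n + 1) → F) (Fin.last n)) := h
  rw [e₁, e₂, e₃] at h'
  exact (h'.1 hy.symm).symm

/-- A map all of whose finite parts preserve existential formulas is an endomorphism. -/
def endOfELe (f : F → F) (hf : ∀ n (x : Fin n → F), ELe P x (f ∘ x)) :
    Reduct P ↪[reductLang Rel] Reduct P where
  toFun := f
  inj' x y hxy := ((hf 2 ![x, y]).eq_iff 0 1).2 hxy
  map_fun' g x := map_funMap_of_eLe f hf g x
  map_rel' := by
    intro n r x
    exact ((hf n x).realize_iff (φ := r.boundedFormula fun i => Term.var (Sum.inl i))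
      (IsAtomic.rel _ _).isQF).symm

/-- In the countable saturated field, an inclusion between the existential types of two finite
tuples is realised by an endomorphism of the reduct. -/
lemma ELe.exists_end [Countable F] [Infinite F] (hSat : IsSaturated diffRing (DiffField D))
    (hP : AllDefinable D P) {n : ℕ} {e e' : Fin n → F} (h : ELe P e e') :
    ∃ f : Reduct P ↪[reductLang Rel] Reduct P, (f ∘ e : Fin n → F) = e' := by
  let Good : Set (F × F) → Prop := fun R => ∀ m (p : Fin m → F × F), (∀ i, p i ∈ R) →
    ELe P (fun i => (p i).1) (fun i => (p i).2)
  have hgood : ∀ {m : ℕ} {a a' : Fin m → F}, ELe P a a' →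
      Good (Set.range fun i => (a i, a' i)) := by
    intro m a a' ha k p hp
    choose ρ hρ using hp
    have e₁ : (fun i => (p i).1) = a ∘ ρ := funext fun i => congrArg Prod.fst (hρ i).symm
    have e₂ : (fun i => (p i).2) = a' ∘ ρ := funext fun i => congrArg Prod.snd (hρ i).symm
    rw [e₁, e₂]
    exact ha.reindex ρ
  obtain ⟨f, hf⟩ := exists_fun_of_forth (Good := Good) (fun R hR hg c => by
      have := hR.to_subtype
      obtain ⟨m, ⟨q⟩⟩ := Finite.exists_equiv_fin R
      obtain ⟨c', hc'⟩ := (hg m (fun i => (q.symm i).1) (fun i => (q.symm i).2)).exists_snoc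
        hSat hP c
      refine ⟨c', fun k p hp => hgood hc' k p fun i => ?_⟩
      rcases hp i with hi | hi
      · exact ⟨Fin.last m, by simp [hi]⟩
      · exact ⟨(q ⟨_, hi⟩).castSucc, by simp⟩) (Set.finite_range fun i => (e i, e' i)) (hgood h)
  refine ⟨endOfELe f fun k x => ?_, funext fun i => ?_⟩
  · obtain ⟨R, hR, -, hx⟩ := hf (Set.range x) (Set.finite_range x)
    exact hR k (fun i => (x i, f (x i))) fun i => hx _ ⟨i, rfl⟩
  · obtain ⟨R, hR, h₀, hx⟩ := hf (Set.range e) (Set.finite_range e)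
    have := (hR 2 ![(e i, e' i), (e i, f (e i))] (by
      intro j
      fin_cases j
      · exact h₀ ⟨i, rfl⟩
      · exact hx _ ⟨i, rfl⟩)).eq_iff 0 1
    exact (this.1 rfl).symm

/-- A set definable in `(F, D)` that is preserved by all endomorphisms of the reduct is
existentially definable in the reduct. -/
lemma eDef_of_preserved [Countable F] [Infinite F] (hSat : IsSaturated diffRing (DiffField D))
    (hP : AllDefinable D P) {n : ℕ} {s : Set (Fin n → F)} (hs : DDef D s)
    (hpres : ∀ (f : Reduct P ↪[reductLang Rel] Reduct P) (x : Fin n → F), x ∈ s →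
      (f ∘ x : Fin n → F) ∈ s) : EDef P s := by
  by_contra hcon
  -- a point of `s` that lies in no existentially definable subset of `s`
  have : Nonempty {t : Set (Fin n → F) // EDef P t ∧ t ⊆ s} :=
    ⟨⟨∅, eDef_empty, Set.empty_subset _⟩⟩
  obtain ⟨x, hx⟩ := exists_mem_tuple_of_directed hSat
    (s := fun t : {t : Set (Fin n → F) // EDef P t ∧ t ⊆ s} => s \ t.1)
    (fun t => hs.sdiff (t.2.1.ddef hP))
    (fun t u => ⟨⟨_, t.2.1.union u.2.1, Set.union_subset t.2.2 u.2.2⟩,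
      fun _ hx => ⟨hx.1, fun h => hx.2 (Or.inl h)⟩, fun _ hx => ⟨hx.1, fun h => hx.2 (Or.inr h)⟩⟩)
    (fun t => Set.sdiff_nonempty.2 fun hst => hcon (hst.antisymm t.2.2 ▸ t.2.1))
  -- a point outside `s` satisfying all existential formulas true of `x`
  have : Nonempty {t : Set (Fin n → F) // EDef P t ∧ x ∈ t} := ⟨⟨_, eDef_univ, trivial⟩⟩
  obtain ⟨y, hy⟩ := exists_mem_tuple_of_directed hSat
    (s := fun t : {t : Set (Fin n → F) // EDef P t ∧ x ∈ t} => t.1 \ s)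
    (fun t => (t.2.1.ddef hP).sdiff hs)
    (fun t u => ⟨⟨_, t.2.1.inter u.2.1, t.2.2, u.2.2⟩,
      fun _ hx => ⟨hx.1.1, hx.2⟩, fun _ hx => ⟨hx.1.2, hx.2⟩⟩)
    (fun t => Set.sdiff_nonempty.2 fun hts => (hx ⟨t.1, t.2.1, hts⟩).2 t.2.2)
  obtain ⟨f, rfl⟩ := ELe.exists_end hSat hP (e := x) (e' := y) fun t ht hxt =>
    (hy ⟨t, ht, hxt⟩).1
  exact (hy ⟨_, eDef_univ, trivial⟩).2 (hpres f x (hx ⟨∅, eDef_empty, Set.empty_subset _⟩).1)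

end ExistentialTypes

/-! ### Roots of irreducible polynomials over a field of fractions -/

section FractionField

open Polynomial

variable {B : Type*} [CommRing B] [IsDomain B] {F : Type*} [Field F]

/-- If `w` is a root of `f`, and `f` is irreducible over the field of fractions, then which polynomials
vanish at `w` is determined by `f`, whatever the embedding `e`. -/
lemma eval₂_eq_zero_iff_dvd {e : B →+* F} (he : Function.Injective e) {w : F} {f : B[X]}
    (hf : Irreducible (f.map (algebraMap B (FractionRing B)))) (hw : f.eval₂ e w = 0) (p : B[X]) :
    p.eval₂ e w = 0 ↔
      f.map (algebraMap B (FractionRing B)) ∣ p.map (algebraMap B (FractionRing B)) := by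
  have key : ∀ q : B[X], q.eval₂ e w =
      (q.map (algebraMap B (FractionRing B))).eval₂ (IsFractionRing.lift he) w := by
    intro q
    rw [eval₂_map]
    congr 1
    ext b
    simp
  rw [key] at hw ⊢
  constructor
  · intro hp
    rcases (dvd_or_isCoprime _ (p.map (algebraMap B (FractionRing B))) hf).symm with h | h
    · obtain ⟨a, b, hab⟩ := h
      have := congrArg (eval₂ (IsFractionRing.lift he) w) hab
      simp [hw, hp] at this
    · exact h
  · rintro ⟨q, hq⟩
    rw [hq, eval₂_mul, hw, zero_mul]

/-- An element algebraic over the image of a domain `B` is a root of a polynomial over `B` that is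
irreducible over the field of fractions: clear denominators in the minimal polynomial. -/
lemma exists_irreducible_eval₂_eq_zero {e : B →+* F} (he : Function.Injective e) {w : F} {q : B[X]}
    (hq : q ≠ 0) (hw : q.eval₂ e w = 0) :
    ∃ f : B[X], Irreducible (f.map (algebraMap B (FractionRing B))) ∧ f.eval₂ e w = 0 := by
  let : Algebra (FractionRing B) F := (IsFractionRing.lift he).toAlgebra
  have halg : ∀ b, algebraMap (FractionRing B) F (algebraMap B (FractionRing B) b) = e b :=
    fun b => by
      change IsFractionRing.lift he _ = _
      simp
  have key : ∀ q : B[X], q.eval₂ e w =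
      aeval w (q.map (algebraMap B (FractionRing B))) := by
    intro q
    rw [aeval_def, eval₂_map]
    congr 1
    ext b
    simp [halg]
  have hint : IsIntegral (FractionRing B) w := by
    refine IsAlgebraic.isIntegral ⟨q.map (algebraMap B (FractionRing B)), ?_, by rw [← key, hw]⟩
    exact (Polynomial.map_ne_zero_iff (IsFractionRing.injective B _)).2 hq
  obtain ⟨b, hbm, hb⟩ := IsLocalization.integerNormalization_spec (nonZeroDivisors B)
    (minpoly (FractionRing B) w)
  have hsmul : b • minpoly (FractionRing B) w =
      C (algebraMap B (FractionRing B) b) * minpoly (FractionRing B) w := by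
    rw [← smul_eq_C_mul, algebraMap_smul]
  refine ⟨IsLocalization.integerNormalization (nonZeroDivisors B) (minpoly (FractionRing B) w),
    ?_, ?_⟩
  · rw [hb]
    have hb0 : algebraMap B (FractionRing B) b ≠ 0 :=
      IsFractionRing.to_map_ne_zero_of_mem_nonZeroDivisors hbm
    rw [hsmul]
    exact (irreducible_isUnit_mul (isUnit_C.2 hb0.isUnit)).2 (minpoly.irreducible hint)
  · rw [key, hb, hsmul, map_mul, minpoly.aeval, mul_zero]

lemma eval₂_derivative_ne_zero [CharZero B] {e : B →+* F} (he : Function.Injective e) {w : F}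
    {f : B[X]} (hf : Irreducible (f.map (algebraMap B (FractionRing B))))
    (hw : f.eval₂ e w = 0) : (derivative f).eval₂ e w ≠ 0 := by
  intro h
  rw [eval₂_eq_zero_iff_dvd he hf hw, ← derivative_map] at h
  have hd := hf.natDegree_pos
  have : CharZero (FractionRing B) :=
    charZero_of_injective_algebraMap (IsFractionRing.injective B (FractionRing B))
  refine Polynomial.not_dvd_of_degree_lt ?_ (degree_derivative_lt hf.ne_zero) h
  intro h0
  exact hd.ne' (derivative_eq_zero.1 h0)

end FractionField

/-! ### Differential polynomials in a saturated differentially closed field -/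

section DifferentialPolynomials

variable {F : Type u} [Field F]

/-- The jet of an element: the sequence of its iterated derivatives. -/
def jet (D : Derivation ℤ F F) (c : F) (i : ℕ) : F := D^[i] c

/-- The differential subring generated by a set. -/
def dring (D : Derivation ℤ F F) (X : Set F) : Subring F :=
  Subring.closure {z | ∃ x ∈ X, ∃ i, z = jet D x i}

variable {D : Derivation ℤ F F} {X : Set F}

lemma jet_zero (c : F) : jet D c 0 = c := rfl

lemma jet_succ (c : F) (i : ℕ) : jet D c (i + 1) = D (jet D c i) :=
  Function.iterate_succ_apply' _ _ _

lemma jet_mem_dring {x : F} (hx : x ∈ X) (i : ℕ) : jet D x i ∈ dring D X :=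
  Subring.subset_closure ⟨x, hx, i, rfl⟩

lemma aFun_const_of_mem_dring {a : F} (ha : a ∈ dring D X) : AFun D X fun _ => a := by
  induction ha using Subring.closure_induction with
  | mem a h =>
    obtain ⟨x, hx, i, rfl⟩ := h
    exact (aFun_const hx).iterate i
  | zero => exact aFun_zero
  | one => exact aFun_one
  | add a b _ _ ha hb => exact ha.add hb
  | neg a _ ha => exact ha.neg
  | mul a b _ _ ha hb => exact ha.mul hb

variable {A : Type*} [CommRing A] {j : A →+* F}

lemma aFun_eval₂ (hX : ∀ a, j a ∈ dring D X) (p : MvPolynomial ℕ A) :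
    AFun D X fun x => p.eval₂ j (jet D x) := by
  induction p using MvPolynomial.induction_on with
  | C a => simpa using aFun_const_of_mem_dring (hX a)
  | add p q hp hq => simpa using hp.add hq
  | mul_X p i hp => simpa [jet] using hp.mul (aFun_id.iterate i)

/-- Blum's axioms, for differential polynomials with coefficients in a ring embedded in `F`. -/
lemma IsDifferentiallyClosed.exists_eval₂ (hDCF : IsDifferentiallyClosed D)
    (hj : Function.Injective j) {n : ℕ} {f g : MvPolynomial ℕ A} (hn : n ∈ f.vars)
    (hf : ∀ i ∈ f.vars, i ≤ n) (hg : ∀ i ∈ g.vars, i < n) (hg0 : g ≠ 0) :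
    ∃ x, f.eval₂ j (jet D x) = 0 ∧ g.eval₂ j (jet D x) ≠ 0 := by
  have hv := fun p : MvPolynomial ℕ A => MvPolynomial.vars_map_of_injective p hj
  obtain ⟨x, hx⟩ := hDCF.2 n (MvPolynomial.map j f) (MvPolynomial.map j g) (by rwa [hv])
    (by rwa [hv]) (by rwa [hv])
    ((map_ne_zero_iff _ (MvPolynomial.map_injective j hj)).2 hg0)
  rw [MvPolynomial.eval_map, MvPolynomial.eval_map] at hx
  exact ⟨x, hx⟩

variable [Infinite F] [IsDomain A]

/-- In a saturated differentially closed field, a differential equation of order `n` over a finitely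
generated differential ring has a solution which satisfies no equation of smaller order. -/
lemma exists_root_of_order (hDCF : IsDifferentiallyClosed D)
    (hSat : IsSaturated diffRing (DiffField D)) (hfin : X.Finite) (hj : Function.Injective j)
    (hX : ∀ a, j a ∈ dring D X) {n : ℕ} {f : MvPolynomial ℕ A} (hn : n ∈ f.vars)
    (hf : ∀ i ∈ f.vars, i ≤ n) :
    ∃ x, f.eval₂ j (jet D x) = 0 ∧
      ∀ g : MvPolynomial ℕ A, (∀ i ∈ g.vars, i < n) → g ≠ 0 → g.eval₂ j (jet D x) ≠ 0 := by
  classical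
  let ι := {g : MvPolynomial ℕ A // (∀ i ∈ g.vars, i < n) ∧ g ≠ 0}
  have : Nonempty ι := ⟨⟨1, by simp, one_ne_zero⟩⟩
  obtain ⟨x, hx⟩ := exists_mem_of_directed hSat hfin
    (s := fun g : ι => {x | f.eval₂ j (jet D x) = 0} ∩ {x | g.1.eval₂ j (jet D x) = 0}ᶜ)
    (fun g => ((aFun_eval₂ hX f).zeros).inter ((aFun_eval₂ hX g.1).zeros).compl)
    (fun g h => ⟨⟨g.1 * h.1, fun i hi => by
        rcases Finset.mem_union.1 (MvPolynomial.vars_mul _ _ hi) with hi | hi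
        · exact g.2.1 i hi
        · exact h.2.1 i hi, mul_ne_zero g.2.2 h.2.2⟩,
      fun x hx => ⟨hx.1, fun h0 => hx.2 (by
        rw [Set.mem_ofPred_eq, MvPolynomial.eval₂_mul, show g.1.eval₂ j (jet D x) = 0 from h0,
          zero_mul])⟩,
      fun x hx => ⟨hx.1, fun h0 => hx.2 (by
        rw [Set.mem_ofPred_eq, MvPolynomial.eval₂_mul, show h.1.eval₂ j (jet D x) = 0 from h0,
          mul_zero])⟩⟩)
    (fun g => hDCF.exists_eval₂ hj hn hf g.2.1 g.2.2)
  exact ⟨x, (hx ⟨1, by simp, one_ne_zero⟩).1, fun g hg hg0 => (hx ⟨g, hg, hg0⟩).2⟩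

/-- A saturated differentially closed field has differentially transcendental elements over each
finitely generated differential ring. -/
lemma exists_differentially_transcendental (hDCF : IsDifferentiallyClosed D)
    (hSat : IsSaturated diffRing (DiffField D)) (hfin : X.Finite) (hj : Function.Injective j)
    (hX : ∀ a, j a ∈ dring D X) :
    ∃ x, ∀ g : MvPolynomial ℕ A, g ≠ 0 → g.eval₂ j (jet D x) ≠ 0 := by
  classical
  let ι := {g : MvPolynomial ℕ A // g ≠ 0}
  have : Nonempty ι := ⟨⟨1, one_ne_zero⟩⟩
  obtain ⟨x, hx⟩ := exists_mem_of_directed hSat hfin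
    (s := fun g : ι => {x | g.1.eval₂ j (jet D x) = 0}ᶜ)
    (fun g => ((aFun_eval₂ hX g.1).zeros).compl)
    (fun g h => ⟨⟨g.1 * h.1, mul_ne_zero g.2 h.2⟩,
      fun x hx h0 => hx (by
        rw [Set.mem_ofPred_eq, MvPolynomial.eval₂_mul, show g.1.eval₂ j (jet D x) = 0 from h0,
          zero_mul]),
      fun x hx h0 => hx (by
        rw [Set.mem_ofPred_eq, MvPolynomial.eval₂_mul, show h.1.eval₂ j (jet D x) = 0 from h0,
          mul_zero])⟩)
    (fun g => by
      obtain ⟨n, hn⟩ := g.1.vars.bddAbove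
      obtain ⟨x, -, hx⟩ := hDCF.exists_eval₂ hj (n := n + 1) (f := MvPolynomial.X (n + 1))
        (by simp) (by simp) (fun i hi => Nat.lt_succ_of_le (hn hi)) g.2
      exact ⟨x, hx⟩)
  exact ⟨x, fun g hg => hx ⟨g, hg⟩⟩

end DifferentialPolynomials

/-! ### Homogeneity of the differential field -/

section Homogeneity

variable {F : Type u} [Field F]

/-- The derivation of `F × F` that is `D` in both coordinates. -/
def prodDeriv (D : Derivation ℤ F F) : Derivation ℤ (F × F) (F × F) :=
  Derivation.mk' (LinearMap.prodMap D.toLinearMap D.toLinearMap) fun a b => by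
    ext <;> simp

variable {D : Derivation ℤ F F}

@[simp] lemma prodDeriv_apply (z : F × F) : prodDeriv D z = (D z.1, D z.2) := rfl

/-- The differential subring of `F × F` generated by a relation `R`. -/
def dclosure (D : Derivation ℤ F F) (R : Set (F × F)) : Subring (F × F) :=
  Subring.closure {z | ∃ r ∈ R, ∃ i, z = (jet D r.1 i, jet D r.2 i)}

/-- A relation `R` between elements of `F` is a partial differential isomorphism if first and second
coordinates satisfy the same algebraic differential equations over the integers. -/
def DGood (D : Derivation ℤ F F) (R : Set (F × F)) : Prop :=
  ∀ z ∈ dclosure D R, z.1 = 0 ↔ z.2 = 0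

lemma jet_mem_dclosure {R : Set (F × F)} {r : F × F} (hr : r ∈ R) (i : ℕ) :
    (jet D r.1 i, jet D r.2 i) ∈ dclosure D R :=
  Subring.subset_closure ⟨r, hr, i, rfl⟩

lemma dclosure_le {R : Set (F × F)} {W : Subring (F × F)}
    (h : ∀ r ∈ R, ∀ i, (jet D r.1 i, jet D r.2 i) ∈ W) : dclosure D R ≤ W :=
  Subring.closure_le.2 fun _ ⟨r, hr, i, hz⟩ => hz ▸ h r hr i

lemma subset_dclosure {R : Set (F × F)} : R ⊆ dclosure D R := fun _ hr =>
  jet_mem_dclosure hr 0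

lemma prodDeriv_mem_dclosure {R : Set (F × F)} {z : F × F} (hz : z ∈ dclosure D R) :
    prodDeriv D z ∈ dclosure D R := by
  induction hz using Subring.closure_induction with
  | mem z h =>
    obtain ⟨r, hr, i, rfl⟩ := h
    rw [prodDeriv_apply, ← jet_succ, ← jet_succ]
    exact jet_mem_dclosure hr _
  | zero => rw [map_zero]; exact zero_mem _
  | one => rw [Derivation.map_one_eq_zero]; exact zero_mem _
  | add a b _ _ ha hb => rw [map_add]; exact add_mem ha hb
  | neg a _ ha => rw [map_neg]; exact neg_mem ha
  | mul a b ha' hb' ha hb =>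
    rw [Derivation.leibniz, smul_eq_mul, smul_eq_mul]
    exact add_mem (mul_mem ha' hb) (mul_mem hb' ha)

lemma snd_mem_dring {R : Set (F × F)} {z : F × F} (hz : z ∈ dclosure D R) :
    z.2 ∈ dring D (Prod.snd '' R) := by
  have : dclosure D R ≤ (dring D (Prod.snd '' R)).comap (RingHom.snd F F) :=
    dclosure_le fun r hr i => jet_mem_dring (Set.mem_image_of_mem _ hr) i
  exact this hz

lemma swap_mem_dclosure {R : Set (F × F)} {z : F × F}
    (hz : z ∈ dclosure D (Prod.swap '' R)) : z.swap ∈ dclosure D R := by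
  have : dclosure D (Prod.swap '' R) ≤
      (dclosure D R).comap ((RingHom.snd F F).prod (RingHom.fst F F)) := by
    refine dclosure_le ?_
    rintro _ ⟨r, hr, rfl⟩ i
    exact jet_mem_dclosure hr i
  exact this hz

lemma DGood.swap {R : Set (F × F)} (h : DGood D R) : DGood D (Prod.swap '' R) :=
  fun _ hz => (h _ (swap_mem_dclosure hz)).symm

/-- A criterion for extending a partial differential isomorphism by a pair of elements. -/
lemma dGood_insert_of_forall {R : Set (F × F)} {c c' : F}
    (h : ∀ p : MvPolynomial ℕ (dclosure D R),
      p.eval₂ ((RingHom.fst F F).comp (dclosure D R).subtype) (jet D c) = 0 ↔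
      p.eval₂ ((RingHom.snd F F).comp (dclosure D R).subtype) (jet D c') = 0) :
    DGood D (insert (c, c') R) := by
  intro z hz
  let e := (MvPolynomial.eval₂Hom ((RingHom.fst F F).comp (dclosure D R).subtype) (jet D c)).prod
    (MvPolynomial.eval₂Hom ((RingHom.snd F F).comp (dclosure D R).subtype) (jet D c'))
  have : dclosure D (insert (c, c') R) ≤ e.range := by
    refine dclosure_le fun r hr i => ?_
    rcases hr with rfl | hr
    · exact ⟨MvPolynomial.X i, by ext <;> simp [e]⟩
    · exact ⟨MvPolynomial.C ⟨_, jet_mem_dclosure hr i⟩, by ext <;> simp [e]⟩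
  obtain ⟨p, rfl⟩ := this hz
  exact h p

/-! An algebraic differential equation of order `n` is treated as a polynomial in one variable over
the polynomial ring in `n` variables, the latter standing for the derivatives of order `< n`. -/

section Order

variable {A : Type*} [CommRing A] {n : ℕ}

/-- The differential polynomial of order at most `n` given by a polynomial whose variable stands for
the `n`-th derivative and whose coefficients are polynomials in the lower derivatives. -/
noncomputable def ofPoly (n : ℕ) :
    Polynomial (MvPolynomial (Fin n) A) →+* MvPolynomial ℕ A :=
  ((MvPolynomial.rename (R := A) (Fin.cons n fun i : Fin n => (i : ℕ))).toRingHom).comp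
    (MvPolynomial.finSuccEquiv A n).symm.toRingEquiv.toRingHom

lemma ofPoly_finSuccEquiv (q : MvPolynomial (Fin (n + 1)) A) :
    ofPoly n (MvPolynomial.finSuccEquiv A n q) =
      MvPolynomial.rename (Fin.cons n fun i : Fin n => (i : ℕ)) q := by
  simp [ofPoly]

lemma eval₂_ofPoly {F : Type*} [CommRing F] (j : A →+* F) (x : ℕ → F)
    (p : Polynomial (MvPolynomial (Fin n) A)) :
    (ofPoly n p).eval₂ j x =
      p.eval₂ (MvPolynomial.eval₂Hom j fun i : Fin n => x i) (x n) := by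
  obtain ⟨q, rfl⟩ := (MvPolynomial.finSuccEquiv A n).surjective p
  rw [ofPoly_finSuccEquiv, MvPolynomial.eval₂_rename]
  induction q using MvPolynomial.induction_on with
  | C a => simp [MvPolynomial.finSuccEquiv_apply]
  | add p q hp hq => simp [hp, hq, Polynomial.eval₂_add]
  | mul_X p i hp =>
    rw [MvPolynomial.eval₂_mul, map_mul, Polynomial.eval₂_mul, hp]
    congr 1
    induction i using Fin.cases <;> simp [MvPolynomial.finSuccEquiv_X_zero,
      MvPolynomial.finSuccEquiv_X_succ]

lemma cons_injective :
    Function.Injective (Fin.cons n fun i : Fin n => (i : ℕ) : Fin (n + 1) → ℕ) := by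
  rw [Fin.cons_injective_iff]
  refine ⟨?_, Fin.val_injective⟩
  rintro ⟨i, hi⟩
  exact i.2.ne hi

lemma mem_vars_ofPoly {p : Polynomial (MvPolynomial (Fin n) A)}
    (hp : 0 < p.natDegree) :
    n ∈ (ofPoly n p).vars := by
  obtain ⟨q, rfl⟩ := (MvPolynomial.finSuccEquiv A n).surjective p
  rw [MvPolynomial.natDegree_finSuccEquiv] at hp
  rw [ofPoly_finSuccEquiv, MvPolynomial.mem_vars_iff_degreeOf_ne_zero]
  have := MvPolynomial.degreeOf_rename_of_injective (p := q) cons_injective 0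
  rw [Fin.cons_zero] at this
  rw [this]
  exact hp.ne'

lemma le_of_mem_vars_ofPoly {p : Polynomial (MvPolynomial (Fin n) A)} {i : ℕ}
    (hi : i ∈ (ofPoly n p).vars) : i ≤ n := by
  classical
  obtain ⟨q, rfl⟩ := (MvPolynomial.finSuccEquiv A n).surjective p
  rw [ofPoly_finSuccEquiv] at hi
  obtain ⟨k, -, rfl⟩ := Finset.mem_image.1 (MvPolynomial.vars_rename _ _ hi)
  induction k using Fin.cases with
  | zero => simp
  | succ k => simp

lemma exists_ofPoly_eq {p : MvPolynomial ℕ A} (hp : ∀ i ∈ p.vars, i ≤ n) :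
    ∃ q, ofPoly n q = p := by
  obtain ⟨q, rfl⟩ := MvPolynomial.exists_rename_eq_of_vars_subset_range p
    (Fin.cons n fun i : Fin n => (i : ℕ)) cons_injective (by
      intro i hi
      rcases (hp i hi).lt_or_eq with h | h
      · exact ⟨Fin.succ ⟨i, h⟩, by rw [Fin.cons_succ]⟩
      · exact ⟨0, by simp [h]⟩)
  exact ⟨_, ofPoly_finSuccEquiv q⟩

end Order

variable {D : Derivation ℤ F F}

section Separant

variable {R : Set (F × F)} {n : ℕ} {c c' : F}

/-- Simultaneous evaluation at `c` and `c'` of the differential polynomials of order at most `n`. -/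
noncomputable def evalPair (D : Derivation ℤ F F) (R : Set (F × F)) (n : ℕ) (c c' : F) :
    Polynomial (MvPolynomial (Fin n) (dclosure D R)) →+* F × F :=
  (Polynomial.eval₂RingHom (MvPolynomial.eval₂Hom
    ((RingHom.fst F F).comp (dclosure D R).subtype) fun i : Fin n => jet D c i) (jet D c n)).prod
  (Polynomial.eval₂RingHom (MvPolynomial.eval₂Hom
    ((RingHom.snd F F).comp (dclosure D R).subtype) fun i : Fin n => jet D c' i) (jet D c' n))

/-- The subring of the values of the differential polynomials of order at most `n`. -/
noncomputable def ordSubring (D : Derivation ℤ F F) (R : Set (F × F)) (n : ℕ) (c c' : F) :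
    Subring (F × F) :=
  RingHom.range (R := Polynomial (MvPolynomial (Fin n) (dclosure D R))) (evalPair D R n c c')

lemma evalPair_C_C (a : dclosure D R) :
    evalPair D R n c c' (Polynomial.C (MvPolynomial.C a)) = a := by
  ext <;> simp [evalPair]

lemma evalPair_C_X (i : Fin n) :
    evalPair D R n c c' (Polynomial.C (MvPolynomial.X i)) = (jet D c i, jet D c' i) := by
  ext <;> simp [evalPair]

lemma evalPair_X :
    evalPair D R n c c' Polynomial.X = (jet D c n, jet D c' n) := by
  ext <;> simp [evalPair]

lemma jet_mem_ordSubring {i : ℕ} (hi : i ≤ n) :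
    (jet D c i, jet D c' i) ∈ ordSubring D R n c c' := by
  rcases hi.lt_or_eq with h | rfl
  · exact ⟨_, evalPair_C_X ⟨i, h⟩⟩
  · exact ⟨_, evalPair_X⟩

lemma prodDeriv_evalPair_C (b : MvPolynomial (Fin n) (dclosure D R)) :
    prodDeriv D (evalPair D R n c c' (Polynomial.C b)) ∈ ordSubring D R n c c' := by
  induction b using MvPolynomial.induction_on with
  | C a =>
    rw [evalPair_C_C]
    exact ⟨_, evalPair_C_C ⟨_, prodDeriv_mem_dclosure a.2⟩⟩
  | add p q hp hq => rw [map_add, map_add, map_add]; exact add_mem hp hq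
  | mul_X p i hp =>
    rw [map_mul, map_mul, Derivation.leibniz, smul_eq_mul, smul_eq_mul, evalPair_C_X,
      prodDeriv_apply, ← jet_succ, ← jet_succ]
    exact add_mem (mul_mem ⟨_, rfl⟩ (jet_mem_ordSubring i.2))
      (mul_mem (jet_mem_ordSubring i.2.le) hp)

/-- Differentiating a differential polynomial of order `n` yields the separant times the
`(n + 1)`-st derivative, up to terms of order at most `n`. -/
lemma prodDeriv_evalPair (p : Polynomial (MvPolynomial (Fin n) (dclosure D R))) :
    prodDeriv D (evalPair D R n c c' p) -
      evalPair D R n c c' (Polynomial.derivative p) * (jet D c (n + 1), jet D c' (n + 1)) ∈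
      ordSubring D R n c c' := by
  induction p using Polynomial.induction_on with
  | C a => simpa using prodDeriv_evalPair_C a
  | add p q hp hq =>
    convert add_mem hp hq using 1
    rw [map_add, map_add, map_add, map_add]
    ring
  | monomial m a h =>
    rw [pow_succ, ← mul_assoc, Polynomial.derivative_mul (g := Polynomial.X)]
    set q := Polynomial.C a * Polynomial.X ^ m
    clear_value q
    convert add_mem (mul_mem (⟨_, evalPair_X⟩ :
      (jet D c n, jet D c' n) ∈ ordSubring D R n c c') h) (zero_mem _) using 1
    rw [map_mul (evalPair D R n c c'), map_add (evalPair D R n c c'),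
      map_mul (evalPair D R n c c'), map_mul (evalPair D R n c c'), Derivation.leibniz,
      evalPair_X, smul_eq_mul,
      smul_eq_mul, Polynomial.derivative_X, map_one, prodDeriv_apply (jet D c n, jet D c' n),
      jet_succ, jet_succ, mul_one, add_zero]
    ring

/-- The subring of the elements of `F × F` that become values of differential polynomials of order
at most `n` after multiplication with a power of `s`. -/
noncomputable def fractionSubring (D : Derivation ℤ F F) (R : Set (F × F)) (n : ℕ) (c c' : F)
    {s : F × F} (hs : s ∈ ordSubring D R n c c') : Subring (F × F) where
  carrier := {z | ∃ m : ℕ, s ^ m * z ∈ ordSubring D R n c c'}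
  mul_mem' := by
    rintro x y ⟨k, hk⟩ ⟨l, hl⟩
    exact ⟨k + l, by convert mul_mem hk hl using 1; ring⟩
  one_mem' := ⟨0, by simp⟩
  add_mem' := by
    rintro x y ⟨k, hk⟩ ⟨l, hl⟩
    exact ⟨k + l, by
      convert add_mem (mul_mem (pow_mem hs l) hk) (mul_mem (pow_mem hs k) hl) using 1; ring⟩
  zero_mem' := ⟨0, by simp⟩
  neg_mem' := by
    rintro x ⟨k, hk⟩
    exact ⟨k, by convert neg_mem hk using 1; ring⟩

/-- If `f` vanishes at `c` and `c'`, then all derivatives of `c` and `c'` are, simultaneously,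
fractions of differential polynomials of order at most `n`, the denominators being powers of the
separant of `f`. -/
lemma jet_mem_fractionSubring {f : Polynomial (MvPolynomial (Fin n) (dclosure D R))}
    (hf : evalPair D R n c c' f = 0) (i : ℕ) :
    (jet D c i, jet D c' i) ∈ fractionSubring D R n c c'
      (s := evalPair D R n c c' (Polynomial.derivative f)) ⟨_, rfl⟩ := by
  set W := fractionSubring D R n c c'
      (s := evalPair D R n c c' (Polynomial.derivative f)) ⟨_, rfl⟩ with hW
  have hle : ordSubring D R n c c' ≤ W := fun z hz => ⟨0, by simpa using hz⟩
  have hdiv : ∀ (m : ℕ) (z : F × F),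
      evalPair D R n c c' (Polynomial.derivative f) ^ m * z ∈ W → z ∈ W := by
    rintro m z ⟨k, hk⟩
    exact ⟨k + m, by convert hk using 1; ring⟩
  have hsucc : (jet D c (n + 1), jet D c' (n + 1)) ∈ W := by
    refine hdiv 1 _ (hle ?_)
    have := neg_mem (prodDeriv_evalPair (c := c) (c' := c') f)
    rwa [hf, map_zero, zero_sub, neg_neg, ← pow_one (evalPair _ _ _ _ _ _)] at this
  have hD : ∀ z ∈ ordSubring D R n c c', prodDeriv D z ∈ W := by
    rintro _ ⟨p, rfl⟩
    have := add_mem (hle (prodDeriv_evalPair (c := c) (c' := c') p))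
      (mul_mem (hle ⟨Polynomial.derivative p, rfl⟩) hsucc)
    rwa [sub_add_cancel] at this
  have hDW : ∀ z ∈ W, prodDeriv D z ∈ W := by
    rintro z ⟨m, hm⟩
    refine hdiv m _ ?_
    have h1 := hD _ hm
    rw [Derivation.leibniz, smul_eq_mul, smul_eq_mul] at h1
    have h2 := hD _ (pow_mem (⟨Polynomial.derivative f, rfl⟩ :
      evalPair D R n c c' (Polynomial.derivative f) ∈ ordSubring D R n c c') m)
    have h3 : z ∈ W := ⟨m, hm⟩
    have := sub_mem h1 (mul_mem h3 h2)
    rwa [add_sub_cancel_right] at this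
  induction i with
  | zero => exact hle (jet_mem_ordSubring (Nat.zero_le n))
  | succ i ih => simpa [jet_succ] using hDW _ ih

end Separant

variable [Infinite F]

/-- Partial differential isomorphisms between finite sets can be extended in a saturated
differentially closed field. If `c` is not differentially transcendental, take for `c'` a solution,
of the same order as `c`, of a differential equation of `c` that is irreducible as a polynomial in the
highest derivative. Both sides then satisfy the same equations up to this order, and all higher
derivatives are rational functions of the lower ones, with a power of the separant as denominator. -/
lemma DGood.forth (hDCF : IsDifferentiallyClosed D)
    (hSat : IsSaturated diffRing (DiffField D)) {R : Set (F × F)} (hfin : R.Finite)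
    (hR : DGood D R) (c : F) : ∃ c', DGood D (insert (c, c') R) := by
  have := hDCF.1
  set j₁ := (RingHom.fst F F).comp (dclosure D R).subtype with hj₁
  set j₂ := (RingHom.snd F F).comp (dclosure D R).subtype with hj₂
  have inj₁ : Function.Injective j₁ := (injective_iff_map_eq_zero j₁).2 fun a ha =>
    Subtype.ext (Prod.ext ha ((hR a a.2).1 ha))
  have inj₂ : Function.Injective j₂ := (injective_iff_map_eq_zero j₂).2 fun a ha =>
    Subtype.ext (Prod.ext ((hR a a.2).2 ha) ha)
  have : IsDomain (dclosure D R) := inj₁.isDomain j₁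
  have hX : ∀ a, j₂ a ∈ dring D (Prod.snd '' R) := fun a => snd_mem_dring a.2
  by_cases htr : ∀ p : MvPolynomial ℕ (dclosure D R), p ≠ 0 → p.eval₂ j₁ (jet D c) ≠ 0
  · obtain ⟨c', hc'⟩ := exists_differentially_transcendental hDCF hSat (hfin.image _) inj₂ hX
    refine ⟨c', dGood_insert_of_forall fun p => ?_⟩
    rcases eq_or_ne p 0 with rfl | hp
    · simp
    · exact iff_of_false (htr p hp) (hc' p hp)
  have hex : ∃ n, ∃ p : MvPolynomial ℕ (dclosure D R), (∀ i ∈ p.vars, i < n) ∧ p ≠ 0 ∧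
      p.eval₂ j₁ (jet D c) = 0 := by
    push Not at htr
    obtain ⟨p, hp, h0⟩ := htr
    obtain ⟨N, hN⟩ := p.vars.bddAbove
    exact ⟨N + 1, p, fun i hi => Nat.lt_succ_of_le (hN hi), hp, h0⟩
  classical
  -- `n` is the least order of a differential equation satisfied by `c`
  obtain ⟨n, hn, hmin⟩ : ∃ n, (∃ p : MvPolynomial ℕ (dclosure D R), (∀ i ∈ p.vars, i ≤ n) ∧
      p ≠ 0 ∧ p.eval₂ j₁ (jet D c) = 0) ∧ ∀ p : MvPolynomial ℕ (dclosure D R),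
      (∀ i ∈ p.vars, i < n) → p ≠ 0 → p.eval₂ j₁ (jet D c) ≠ 0 := by
    rcases h : Nat.find hex with _ | n
    · obtain ⟨p, hp, hp0, he⟩ := Nat.find_spec hex
      rw [h] at hp
      have hv : p.vars = ∅ := Finset.eq_empty_of_forall_notMem fun i hi => by simpa using hp i hi
      obtain ⟨a, rfl⟩ : ∃ a, p = MvPolynomial.C a := ⟨_, MvPolynomial.vars_eq_empty_iff_eq_C.1 hv⟩
      rw [MvPolynomial.eval₂_C] at he
      exact absurd ((injective_iff_map_eq_zero j₁).1 inj₁ a he) fun ha => hp0 (by rw [ha, map_zero])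
    · obtain ⟨p, hp, hp0, he⟩ := Nat.find_spec hex
      rw [h] at hp
      refine ⟨n, ⟨p, fun i hi => Nat.lt_succ_iff.1 (hp i hi), hp0, he⟩, fun q hq hq0 hqe => ?_⟩
      exact Nat.find_min hex (m := n) (by omega) ⟨q, hq, hq0, hqe⟩
  -- embeddings of the ring of differential polynomials of order less than `n`
  have einj : ∀ (j : dclosure D R →+* F) (x : F), (∀ p : MvPolynomial ℕ (dclosure D R),
      (∀ i ∈ p.vars, i < n) → p ≠ 0 → p.eval₂ j (jet D x) ≠ 0) →
      Function.Injective (MvPolynomial.eval₂Hom j fun i : Fin n => jet D x i) := by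
    intro j x h
    rw [injective_iff_map_eq_zero]
    intro q hq
    by_contra hq0
    refine h (MvPolynomial.rename Fin.val q) (fun i hi => ?_)
      ((map_ne_zero_iff _ (MvPolynomial.rename_injective _ Fin.val_injective)).2 hq0) ?_
    · obtain ⟨k, -, rfl⟩ := Finset.mem_image.1 (MvPolynomial.vars_rename _ _ hi)
      exact k.2
    · rw [MvPolynomial.eval₂_rename]
      exact hq
  obtain ⟨p, hp, hp0, hpe⟩ := hn
  obtain ⟨q, rfl⟩ := exists_ofPoly_eq hp
  have hq0 : q ≠ 0 := by rintro rfl; simp at hp0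
  rw [eval₂_ofPoly] at hpe
  obtain ⟨f, hf, hfe⟩ := exists_irreducible_eval₂_eq_zero (einj j₁ c hmin) hq0 hpe
  have hdeg : 0 < f.natDegree := hf.natDegree_pos.trans_le Polynomial.natDegree_map_le
  obtain ⟨c', hfc', hc'⟩ := exists_root_of_order hDCF hSat (hfin.image _) inj₂ hX
    (mem_vars_ofPoly hdeg) fun i hi => le_of_mem_vars_ofPoly hi
  rw [eval₂_ofPoly] at hfc'
  refine ⟨c', fun z hz => ?_⟩
  have : CharZero (dclosure D R) := ⟨fun a b hab => by
    have := congrArg j₁ hab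
    simpa using this⟩
  have hval : ∀ r : Polynomial (MvPolynomial (Fin n) (dclosure D R)),
      (evalPair D R n c c' r).1 = 0 ↔ (evalPair D R n c c' r).2 = 0 := fun r =>
    (eval₂_eq_zero_iff_dvd (einj j₁ c hmin) hf hfe r).trans
      (eval₂_eq_zero_iff_dvd (einj j₂ c' hc') hf hfc' r).symm
  have hs₁ : (evalPair D R n c c' (Polynomial.derivative f)).1 ≠ 0 :=
    eval₂_derivative_ne_zero (einj j₁ c hmin) hf hfe
  have hs₂ : (evalPair D R n c c' (Polynomial.derivative f)).2 ≠ 0 :=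
    eval₂_derivative_ne_zero (einj j₂ c' hc') hf hfc'
  have hW : dclosure D (insert (c, c') R) ≤ fractionSubring D R n c c'
      (s := evalPair D R n c c' (Polynomial.derivative f)) ⟨_, rfl⟩ := by
    refine dclosure_le ?_
    rintro r (rfl | hr) i
    · exact jet_mem_fractionSubring (Prod.ext hfe hfc') i
    · exact ⟨0, Polynomial.C (MvPolynomial.C ⟨_, jet_mem_dclosure hr i⟩), by
        rw [evalPair_C_C, pow_zero, one_mul]⟩
  obtain ⟨m, r, hr⟩ := hW hz
  have h := hval r
  rw [hr, Prod.fst_mul, Prod.snd_mul, Prod.pow_fst, Prod.pow_snd,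
    mul_eq_zero_iff_left (pow_ne_zero m hs₁), mul_eq_zero_iff_left (pow_ne_zero m hs₂)] at h
  exact h

end Homogeneity

/-! ### Automorphisms of the differential field -/

section Automorphisms

variable {F : Type u} [Field F] {D : Derivation ℤ F F}

lemma DGood.fst_eq_iff {R : Set (F × F)} (h : DGood D R) {p q : F × F} (hp : p ∈ dclosure D R)
    (hq : q ∈ dclosure D R) : p.1 = q.1 ↔ p.2 = q.2 := by
  have := h _ (sub_mem hp hq)
  rwa [Prod.fst_sub, Prod.snd_sub, sub_eq_zero, sub_eq_zero] at this

variable [Countable F] [Infinite F]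

/-- The countable saturated differentially closed field is homogeneous. -/
lemma DGood.exists_equiv (hDCF : IsDifferentiallyClosed D)
    (hSat : IsSaturated diffRing (DiffField D)) {R : Set (F × F)} (hfin : R.Finite)
    (hR : DGood D R) :
    ∃ σ : F ≃+* F, (∀ x, σ (D x) = D (σ x)) ∧ ∀ r ∈ R, σ r.1 = r.2 := by
  obtain ⟨σ, hσR, hσ⟩ := exists_equiv_of_back_and_forth (Good := DGood D)
    (fun R hR p hp q hq => hR.fst_eq_iff (subset_dclosure hp) (subset_dclosure hq))
    (fun R hf hR a => hR.forth hDCF hSat hf a)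
    (fun R hf hR b => by
      obtain ⟨a, ha⟩ := hR.swap.forth hDCF hSat (hf.image _) b
      refine ⟨a, ?_⟩
      simpa [Set.image_insert_eq, Set.image_image] using ha.swap)
    hfin hR
  have hadd : ∀ x y, σ (x + y) = σ x + σ y := fun x y => by
    obtain ⟨R', hR', hT⟩ := hσ {x, y, x + y} (Set.toFinite _)
    refine (hR'.fst_eq_iff (subset_dclosure (hT (x + y) (by simp)))
      (add_mem (subset_dclosure (hT x (by simp))) (subset_dclosure (hT y (by simp))))).1 rfl
  have hmul : ∀ x y, σ (x * y) = σ x * σ y := fun x y => by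
    obtain ⟨R', hR', hT⟩ := hσ {x, y, x * y} (Set.toFinite _)
    refine (hR'.fst_eq_iff (subset_dclosure (hT (x * y) (by simp)))
      (mul_mem (subset_dclosure (hT x (by simp))) (subset_dclosure (hT y (by simp))))).1 rfl
  refine ⟨{ σ with map_add' := hadd, map_mul' := hmul }, fun x => ?_, hσR⟩
  obtain ⟨R', hR', hT⟩ := hσ {x, D x} (Set.toFinite _)
  exact (hR'.fst_eq_iff (subset_dclosure (hT (D x) (by simp)))
    (prodDeriv_mem_dclosure (subset_dclosure (hT x (by simp))))).1 rfl

/-- Let `f` and `g` be two embeddings in the differential field along which `D` restricts to the same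
operation `d`. Then they differ by an automorphism on finite sets. -/
lemma exists_equiv_of_jet {A : Type*} [Field A] (hDCF : IsDifferentiallyClosed D)
    (hSat : IsSaturated diffRing (DiffField D)) (f g : A →+* F) (d : A → A)
    (hf : ∀ x, D (f x) = f (d x)) (hg : ∀ x, D (g x) = g (d x)) {T : Set A} (hT : T.Finite) :
    ∃ σ : F ≃+* F, (∀ x, σ (D x) = D (σ x)) ∧ ∀ x ∈ T, σ (f x) = g x := by
  have hR : DGood D ((fun x => (f x, g x)) '' T) := by
    have hle : dclosure D ((fun x => (f x, g x)) '' T) ≤ (f.prod g).range := by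
      refine dclosure_le ?_
      rintro _ ⟨x, -, rfl⟩ i
      refine ⟨d^[i] x, Prod.ext ?_ ?_⟩
      · exact (Function.Semiconj.iterate_right (f := f) (fun x => (hf x).symm) i x :)
      · exact (Function.Semiconj.iterate_right (f := g) (fun x => (hg x).symm) i x :)
    intro z hz
    obtain ⟨y, rfl⟩ := hle hz
    exact (map_eq_zero f).trans (map_eq_zero g).symm
  obtain ⟨σ, hσ, h⟩ := hR.exists_equiv hDCF hSat (hT.image _)
  exact ⟨σ, hσ, fun x hx => h _ (Set.mem_image_of_mem _ hx)⟩

end Automorphisms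

/-! ### Differentially transcendental elements -/

section Transcendental

variable {F : Type u} [Field F]

/-- The sequence `x` satisfies no nontrivial polynomial equation with coefficients in `A`, where `A`
acts on `F` via `e`. -/
def IndepAlong {A : Type*} [CommRing A] (e : A →+* F) (x : ℕ → F) : Prop :=
  ∀ p : MvPolynomial ℕ A, p.eval₂ e x = 0 → p = 0

/-- `g` is differentially transcendental over (the differential ring generated by) `X`. -/
def DTrans (D : Derivation ℤ F F) (X : Set F) (g : F) : Prop :=
  IndepAlong (dring D X).subtype (jet D g)

variable {D : Derivation ℤ F F} {X Y : Set F} {g : F}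

lemma deriv_mem_dring {a : F} (ha : a ∈ dring D X) : D a ∈ dring D X := by
  induction ha using Subring.closure_induction with
  | mem a h =>
    obtain ⟨x, hx, i, rfl⟩ := h
    rw [← jet_succ]
    exact jet_mem_dring hx _
  | zero => rw [map_zero]; exact zero_mem _
  | one => rw [D.map_one_eq_zero]; exact zero_mem _
  | add a b _ _ ha hb => rw [map_add]; exact add_mem ha hb
  | neg a _ ha => rw [map_neg]; exact neg_mem ha
  | mul a b ha' hb' ha hb =>
    rw [D.leibniz]
    exact add_mem (mul_mem ha' hb) (mul_mem hb' ha)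

lemma jet_mem_dring_of_mem {a : F} (ha : a ∈ dring D X) (i : ℕ) : jet D a i ∈ dring D X := by
  induction i with
  | zero => exact ha
  | succ i ih => rw [jet_succ]; exact deriv_mem_dring ih

lemma dring_mono (h : X ⊆ Y) : dring D X ≤ dring D Y :=
  Subring.closure_mono fun _ ⟨x, hx, i, hz⟩ => ⟨x, h hx, i, hz⟩

lemma jet_add (a b : F) (i : ℕ) : jet D (a + b) i = jet D a i + jet D b i := by
  induction i with
  | zero => rfl
  | succ i ih => rw [jet_succ, jet_succ, jet_succ, ih, map_add]

lemma IndepAlong.comp {A B : Type*} [CommRing A] [CommRing B] {e : B →+* F} {x : ℕ → F}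
    (h : IndepAlong e x) {θ : A →+* B} (hθ : Function.Injective θ) : IndepAlong (e.comp θ) x := by
  intro p hp
  rw [← MvPolynomial.eval₂_map] at hp
  exact MvPolynomial.map_injective _ hθ ((h _ hp).trans (map_zero _).symm)

lemma IndepAlong.add {A : Type*} [CommRing A] {e : A →+* F} {x : ℕ → F} (h : IndepAlong e x)
    (α : ℕ → A) : IndepAlong e fun i => x i + e (α i) := by
  have hθ : (MvPolynomial.bind₁ fun i => MvPolynomial.X i - MvPolynomial.C (α i)).comp
      (MvPolynomial.bind₁ fun i => MvPolynomial.X i + MvPolynomial.C (α i)) =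
      AlgHom.id A (MvPolynomial ℕ A) := by
    refine MvPolynomial.algHom_ext fun i => ?_
    rw [AlgHom.comp_apply, MvPolynomial.bind₁_X_right, map_add, MvPolynomial.bind₁_X_right,
      MvPolynomial.bind₁_C_right, sub_add_cancel, AlgHom.id_apply]
  have key : ∀ p : MvPolynomial ℕ A,
      (MvPolynomial.bind₁ (fun i => MvPolynomial.X i + MvPolynomial.C (α i)) p).eval₂ e x =
        p.eval₂ e (fun i => x i + e (α i)) := by
    intro p
    induction p using MvPolynomial.induction_on with
    | C a => simp
    | add p q hp hq => rw [map_add, MvPolynomial.eval₂_add, MvPolynomial.eval₂_add, hp, hq]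
    | mul_X p i hp => simp [hp]
  intro p hp
  have := AlgHom.congr_fun hθ p
  rw [AlgHom.comp_apply, h _ ((key p).trans hp), map_zero] at this
  exact this.symm

lemma IndepAlong.mono {S T : Subring F} (h : S ≤ T) {x : ℕ → F} (hx : IndepAlong T.subtype x) :
    IndepAlong S.subtype x := by
  have := hx.comp (Subring.inclusion_injective h)
  rwa [show T.subtype.comp (Subring.inclusion h) = S.subtype from RingHom.ext fun _ => rfl] at this

lemma DTrans.mono (h : X ⊆ Y) (hg : DTrans D Y g) : DTrans D X g := by
  have h' := dring_mono (D := D) h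
  unfold DTrans at hg ⊢
  exact IndepAlong.mono h' hg

lemma DTrans.add (hg : DTrans D X g) {a : F} (ha : a ∈ dring D X) : DTrans D X (g + a) := by
  have := IndepAlong.add hg fun i => ⟨jet D a i, jet_mem_dring_of_mem ha i⟩
  rw [DTrans, funext (jet_add g a)]
  exact this

lemma DTrans.algebraicIndependent [CharZero F] (hg : DTrans D X g) :
    AlgebraicIndependent ℤ (jet D g) := by
  have hinj : Function.Injective (Int.castRingHom (dring D X)) := by
    intro a b h
    exact Int.cast_injective (α := F) (by simpa using congrArg (dring D X).subtype h)
  rw [algebraicIndependent_iff]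
  intro p hp
  refine IndepAlong.comp hg hinj p ?_
  rw [← hp, MvPolynomial.aeval_def]
  congr 1

lemma exists_dTrans [CharZero F] (hDCF : IsDifferentiallyClosed D)
    (hSat : IsSaturated diffRing (DiffField D)) (hfin : X.Finite) : ∃ g, DTrans D X g := by
  obtain ⟨x, hx⟩ := exists_differentially_transcendental hDCF hSat hfin
    (j := (dring D X).subtype) Subtype.val_injective (fun a => a.2)
  exact ⟨x, fun p hp => by_contra fun h => hx p h hp⟩

variable [Countable F] [Infinite F]

/-- Any two differentially transcendental elements over `X` are conjugate over `X`. -/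
lemma DTrans.exists_equiv (hDCF : IsDifferentiallyClosed D)
    (hSat : IsSaturated diffRing (DiffField D)) (hfin : X.Finite) {g' : F}
    (hg : DTrans D X g) (hg' : DTrans D X g') :
    ∃ σ : F ≃+* F, (∀ x, σ (D x) = D (σ x)) ∧ (∀ x ∈ X, σ x = x) ∧ σ g = g' := by
  let R : Set (F × F) := (fun x => (x, x)) '' X
  have hz : ∀ z ∈ dclosure D R, z.1 ∈ dring D X ∧ z.1 = z.2 := by
    have : dclosure D R ≤ ((RingHom.id F).prod (RingHom.id F)).range ⊓
        (dring D X).comap (RingHom.fst F F) := by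
      refine dclosure_le ?_
      rintro _ ⟨x, hx, rfl⟩ i
      exact ⟨⟨jet D x i, rfl⟩, jet_mem_dring hx i⟩
    intro z hz
    obtain ⟨⟨y, rfl⟩, h⟩ := this hz
    exact ⟨h, rfl⟩
  let θ : dclosure D R →+* dring D X :=
    ((RingHom.fst F F).comp (dclosure D R).subtype).codRestrict _ fun z => (hz z z.2).1
  have hθ : Function.Injective θ := by
    intro a b hab
    have h1 : a.1.1 = b.1.1 := congrArg Subtype.val hab
    exact Subtype.ext (Prod.ext h1 (by rw [← (hz _ a.2).2, ← (hz _ b.2).2, h1]))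
  have e₁ : (dring D X).subtype.comp θ = (RingHom.fst F F).comp (dclosure D R).subtype := rfl
  have e₂ : (dring D X).subtype.comp θ = (RingHom.snd F F).comp (dclosure D R).subtype :=
    RingHom.ext fun a => (hz _ a.2).2
  have hkey : ∀ {w : F}, DTrans D X w → ∀ p : MvPolynomial ℕ (dclosure D R),
      p.eval₂ ((dring D X).subtype.comp θ) (jet D w) = 0 ↔ p = 0 := by
    refine fun {w} hw p => ⟨fun h => ?_, fun h => by simp [h]⟩
    exact IndepAlong.comp hw hθ p h
  have hR : DGood D (insert (g, g') R) := by
    refine dGood_insert_of_forall fun p => ?_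
    rw [← e₁, hkey hg, ← hkey hg' p, e₂]
  obtain ⟨σ, hσ, h⟩ := hR.exists_equiv hDCF hSat ((hfin.image _).insert _)
  exact ⟨σ, hσ, fun x hx => h (x, x) (.inr ⟨x, hx, rfl⟩), h (g, g') (.inl rfl)⟩

end Transcendental

/-! ### Differential equations satisfied by a subring -/

section Equations

variable {F : Type u} [Field F]

/-- A polynomial vanishing at the translates of a point by the integral combinations of vectors that
span the space is zero. -/
lemma eq_zero_of_eval_add_sum_eq_zero [CharZero F] {n : ℕ} {ι : Type*} [Fintype ι]
    {v : ι → Fin n → F} (hv : ⊤ ≤ Submodule.span F (Set.range v)) (y : Fin n → F)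
    {p : MvPolynomial (Fin n) F}
    (hp : ∀ l : ι → ℤ, MvPolynomial.eval (fun i => y i + ∑ j, (l j : F) * v j i) p = 0) :
    p = 0 := by
  let q : MvPolynomial ι F := MvPolynomial.bind₁
    (fun i => MvPolynomial.C (y i) + ∑ j, MvPolynomial.X j * MvPolynomial.C (v j i)) p
  have hq : ∀ c : ι → F, MvPolynomial.eval c q =
      MvPolynomial.eval (fun i => y i + ∑ j, c j * v j i) p := by
    intro c
    rw [← MvPolynomial.coe_aeval_eq_eval, ← MvPolynomial.coe_aeval_eq_eval]
    simp only [q, RingHom.coe_coe, MvPolynomial.aeval_bind₁]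
    congr 2
    simp
  have hq0 : q = 0 := by
    refine MvPolynomial.funext_set (fun _ => Set.range ((↑) : ℤ → F))
      (fun _ => Set.infinite_range_of_injective Int.cast_injective) fun c hc => ?_
    choose l hl using fun j => hc j trivial
    obtain rfl : (fun j => (l j : F)) = c := funext hl
    rw [hq, hp, map_zero]
  refine MvPolynomial.funext fun z => ?_
  obtain ⟨c, hc⟩ := (Submodule.mem_span_range_iff_exists_fun F).1
    (hv (Submodule.mem_top (x := z - y)))
  have h0 := hq c
  rw [hq0, map_zero] at h0
  rw [map_zero, h0]
  congr 2
  ext i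
  have := congrFun hc i
  simp only [Finset.sum_apply, Pi.smul_apply, smul_eq_mul, Pi.sub_apply] at this
  rw [this]; ring

variable {D : Derivation ℤ F F}

variable (D) in
/-- The linear differential operators of order less than `n`, with coefficients in `F`. -/
def linOp (n : ℕ) : Submodule F (F → F) :=
  Submodule.span F ((fun j x => jet D x j) '' Set.Iio n)

lemma jet_mem_linOp {j n : ℕ} (h : j < n) : (fun x => jet D x j) ∈ linOp D n :=
  Submodule.subset_span ⟨j, h, rfl⟩

lemma linOp_mono {m n : ℕ} (h : m ≤ n) : linOp D m ≤ linOp D n :=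
  Submodule.span_mono (Set.image_mono (Set.Iio_subset_Iio h))

lemma deriv_mem_linOp {n : ℕ} {φ : F → F} (hφ : φ ∈ linOp D n) :
    (fun x => D (φ x)) ∈ linOp D (n + 1) := by
  induction hφ using Submodule.span_induction with
  | mem φ h =>
    obtain ⟨j, hj, rfl⟩ := h
    simp_rw [← jet_succ]
    exact jet_mem_linOp (Nat.succ_lt_succ hj)
  | zero => simp_rw [Pi.zero_apply, map_zero]; exact zero_mem _
  | add φ ψ _ _ hφ hψ => simp_rw [Pi.add_apply, map_add]; exact add_mem hφ hψ
  | smul c φ hφ' hφ =>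
    have : (fun x => D ((c • φ) x)) = c • (fun x => D (φ x)) + D c • φ := by
      ext x
      simp only [Pi.smul_apply, smul_eq_mul, Pi.add_apply, D.leibniz]
      ring
    rw [this]
    exact add_mem (Submodule.smul_mem _ _ hφ)
      (Submodule.smul_mem _ _ (linOp_mono n.le_succ hφ'))

/-- The leading terms of the Leibniz rule for higher derivatives. -/
lemma jet_mul_sub_mem_linOp (y : F) (m : ℕ) :
    (fun x => jet D (y * x) (m + 1) - y * jet D x (m + 1) - (m + 1) * D y * jet D x m) ∈
      linOp D m := by
  induction m with
  | zero =>
    convert zero_mem (linOp D 0) using 1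
    ext x
    simp only [jet_succ, jet_zero, D.leibniz, smul_eq_mul, Pi.zero_apply]
    push_cast
    ring
  | succ m ih =>
    have := add_mem (deriv_mem_linOp ih) (Submodule.smul_mem _ ((m + 1) * D (D y))
      (jet_mem_linOp (D := D) m.lt_succ_self))
    convert this using 1
    ext x
    simp only [jet_succ, D.leibniz, smul_eq_mul, Pi.add_apply, Pi.smul_apply, map_sub, map_add,
      D.map_natCast, D.map_one_eq_zero]
    push_cast
    ring

/-- The commutator of a differential operator with a multiplication has smaller order. -/
lemma mul_sub_mem_linOp (y : F) {n : ℕ} {φ : F → F} (hφ : φ ∈ linOp D (n + 1)) :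
    (fun x => φ (y * x) - y * φ x) ∈ linOp D n := by
  induction hφ using Submodule.span_induction with
  | mem φ h =>
    obtain ⟨j, hj, rfl⟩ := h
    rcases j with _ | j
    · convert zero_mem (linOp D n) using 1
      ext x
      simp [jet_zero]
    · have hj : j < n := Nat.lt_of_succ_lt_succ hj
      have := add_mem (linOp_mono hj.le (jet_mul_sub_mem_linOp y j))
        (Submodule.smul_mem _ ((j + 1) * D y) (jet_mem_linOp (D := D) hj))
      convert this using 1
      ext x
      simp
  | zero => simp only [Pi.zero_apply, mul_zero, sub_zero]; exact zero_mem _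
  | add φ ψ _ _ hφ hψ =>
    convert add_mem hφ hψ using 1
    ext x
    simp only [Pi.add_apply]
    ring
  | smul c φ _ hφ =>
    convert Submodule.smul_mem _ c hφ using 1
    ext x
    simp only [Pi.smul_apply, smul_eq_mul]
    ring

/-- If the operator `φ + c Dⁿ`, with `φ` of order less than `n`, vanishes on a subring with a
nonconstant element, then its leading coefficient `c` is zero. -/
lemma leadingCoeff_eq_zero [CharZero F] {S : Subring F} {y : F} (hy : y ∈ S) (hDy : D y ≠ 0)
    (n : ℕ) (c : F) {φ : F → F} (hφ : φ ∈ linOp D n)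
    (h : ∀ x ∈ S, φ x + c * jet D x n = 0) : c = 0 := by
  induction n generalizing c φ with
  | zero =>
    have h0 : φ = 0 := by simpa [linOp] using hφ
    simpa [h0, jet_zero] using h 1 (one_mem _)
  | succ n ih =>
    -- the commutator with the multiplication by `y` has smaller order
    have hψ := add_mem (mul_sub_mem_linOp y hφ)
      (Submodule.smul_mem _ c (jet_mul_sub_mem_linOp (D := D) y n))
    have := ih (c * ((n + 1) * D y)) hψ fun x hx => by
      have h1 := h _ (mul_mem hy hx)
      have h2 := h _ hx
      simp only [Pi.add_apply, Pi.smul_apply, smul_eq_mul]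
      linear_combination h1 - y * h2
    have hn : ((n : F) + 1) ≠ 0 := by exact_mod_cast n.succ_ne_zero
    simpa [hn, hDy] using this

/-- If a subring contains a nonconstant element, then it satisfies no nontrivial linear
differential equation. -/
lemma eq_zero_of_linear_deriv [CharZero F] {S : Subring F} {y : F} (hy : y ∈ S) (hDy : D y ≠ 0)
    (n : ℕ) (c : ℕ → F) (h : ∀ x ∈ S, ∑ j ∈ Finset.range n, c j * jet D x j = 0) :
    ∀ j < n, c j = 0 := by
  induction n with
  | zero => exact fun j hj => absurd hj (Nat.not_lt_zero _)
  | succ n ih =>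
    have hn : c n = 0 := by
      refine leadingCoeff_eq_zero hy hDy n (c n)
        (φ := ∑ j ∈ Finset.range n, c j • fun x => jet D x j) ?_ fun x hx => ?_
      · exact sum_mem fun j hj =>
          Submodule.smul_mem _ _ (jet_mem_linOp (Finset.mem_range.1 hj))
      · have := h x hx
        rw [Finset.sum_range_succ] at this
        simpa [Finset.sum_apply] using this
    intro j hj
    rcases (Nat.lt_succ_iff.1 hj).lt_or_eq with hj | rfl
    · refine ih (fun x hx => ?_) j hj
      have := h x hx
      rwa [Finset.sum_range_succ, hn, zero_mul, add_zero] at this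
    · exact hn

/-- The jets of the elements of a subring with a nonconstant element span the space. -/
lemma span_jet_eq_top [CharZero F] {S : Subring F} {y : F} (hy : y ∈ S) (hDy : D y ≠ 0) (n : ℕ) :
    Submodule.span F ((fun x (i : Fin n) => jet D x i) '' (S : Set F)) = ⊤ := by
  by_contra hne
  obtain ⟨ℓ, hℓ, hker⟩ := Submodule.exists_le_ker_of_lt_top _ (lt_top_iff_ne_top.2 hne)
  refine hℓ ?_
  let c : ℕ → F := fun j => if hj : j < n then ℓ (Pi.single ⟨j, hj⟩ 1) else 0
  have hc : ∀ v : Fin n → F, ℓ v = ∑ i : Fin n, c i * v i := by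
    intro v
    conv_lhs => rw [← Finset.univ_sum_single v, map_sum]
    refine Finset.sum_congr rfl fun i _ => ?_
    rw [show (Pi.single i (v i) : Fin n → F) = v i • Pi.single i 1 by
      rw [← Pi.single_smul, smul_eq_mul, mul_one], map_smul, smul_eq_mul, mul_comm]
    simp [c]
  have h0 := eq_zero_of_linear_deriv hy hDy n c fun x hx => by
    rw [← Fin.sum_univ_eq_sum_range (fun j => c j * jet D x j), ← hc fun i => jet D x i]
    exact hker (Submodule.subset_span ⟨x, hx, rfl⟩)
  ext v
  have h1 := hc (Pi.single v 1)
  rw [Finset.sum_eq_zero fun i _ => by rw [h0 i i.2, zero_mul] ] at h1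
  simpa using h1

lemma jet_sum_intCast_mul {ι : Type*} (s : Finset ι) (l : ι → ℤ) (x : ι → F) (i : ℕ) :
    jet D (∑ j ∈ s, (l j : F) * x j) i = ∑ j ∈ s, (l j : F) * jet D (x j) i := by
  induction i with
  | zero => rfl
  | succ i ih => simp [jet_succ, ih, D.leibniz]

/-- Let `S` be a subring with a nonconstant element. A differential polynomial is zero if for each
finite subset `T` of `S` it vanishes on some translate of the subring generated by `T`. -/
lemma eq_zero_of_eval_jet_eq_zero [CharZero F] {S : Subring F} {y : F} (hy : y ∈ S)
    (hDy : D y ≠ 0) {p : MvPolynomial ℕ F}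
    (hp : ∀ T : Set F, T.Finite → T ⊆ S → ∃ z : F, ∀ t ∈ Subring.closure T,
      MvPolynomial.eval (jet D (z + t)) p = 0) : p = 0 := by
  obtain ⟨n, hn⟩ : ∃ n, ∀ i ∈ p.vars, i < n :=
    ⟨p.vars.sup id + 1, fun i hi => Nat.lt_succ_iff.2 (Finset.le_sup (f := id) hi)⟩
  obtain ⟨q, rfl⟩ := MvPolynomial.exists_rename_eq_of_vars_subset_range p
    ((↑) : Fin n → ℕ) Fin.val_injective fun i hi => ⟨⟨i, hn i hi⟩, rfl⟩
  have hspan := span_jet_eq_top hy hDy n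
  -- translates of finitely many jets that form a basis of the space of jets suffice
  let b := Module.Basis.ofSpan hspan.ge
  have hb : ∀ j, ∃ x ∈ S, (fun i : Fin n => jet D x i) = b j := fun j =>
    Module.Basis.ofSpan_subset hspan.ge ⟨j, rfl⟩
  choose x hxS hx using hb
  have : Fintype _ := Module.Basis.fintypeIndexOfRankLtAleph0 b (Module.rank_lt_aleph0 F _)
  obtain ⟨z, hz⟩ := hp (Set.range x) (Set.finite_range x) (Set.range_subset_iff.2 hxS)
  have hq : q = 0 := by
    refine eq_zero_of_eval_add_sum_eq_zero (v := b) b.span_eq.ge (fun i => jet D z i) fun l => ?_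
    have := hz (∑ j, (l j : F) * x j) (sum_mem fun j _ =>
      mul_mem (intCast_mem _ _) (Subring.subset_closure ⟨j, rfl⟩))
    rw [MvPolynomial.eval_rename] at this
    rw [← this]
    congr 2
    ext i
    rw [Function.comp_apply, jet_add, jet_sum_intCast_mul]
    congr 1
    refine Finset.sum_congr rfl fun j _ => ?_
    rw [← hx j]
  rw [hq, map_zero]

end Equations

/-! ### Closures and finitely generated substructures -/

section Closure

variable {L : FirstOrder.Language.{0, v}} {C : StrClass.{u} L}
variable {A B M : Type u} [L.Structure A] [L.Structure B] [L.Structure M]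

lemma map_comap_of_le_range (f : A ↪[L] B) {T : L.Substructure B} (h : T ≤ f.toHom.range) :
    (T.comap f.toHom).map f.toHom = T := by
  refine le_antisymm Substructure.map_comap_le fun x hx => ?_
  obtain ⟨a, rfl⟩ := h hx
  exact ⟨a, hx, rfl⟩

lemma IsoClosed.iff_of_equiv (hi : IsoClosed C) (e : A ≃[L] B) : C A ↔ C B :=
  ⟨fun h => hi A B h ⟨e⟩, fun h => hi B A h ⟨e.symm⟩⟩

lemma IsoClosed.map_iff (hi : IsoClosed C) (f : A ↪[L] B) (S : L.Substructure A) :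
    C (S.map f.toHom) ↔ C S :=
  (hi.iff_of_equiv (f.substructureEquivMap S)).symm

lemma IsoClosed.range (hi : IsoClosed C) (f : A ↪[L] B) (hA : C A) : C f.toHom.range :=
  hi _ _ hA ⟨f.equivRange⟩

lemma IsoClosed.top (hi : IsoClosed C) (hM : C M) : C (⊤ : L.Substructure M) :=
  (hi.iff_of_equiv Substructure.topEquiv).2 hM

lemma InterClosed.inf (hn : InterClosed C) (hM : C M) {S T : L.Substructure M} (hS : C S)
    (hT : C T) : C (S ⊓ T : L.Substructure M) := by
  have := hn M hM {S, T} (Set.insert_nonempty _ _) (by rintro _ (rfl | rfl) <;> assumption)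
  rwa [sInf_pair] at this

lemma gen_mem (hi : IsoClosed C) (hn : InterClosed C) (hM : C M) (X : Set M) : C (gen C X) :=
  hn M hM _ ⟨⊤, hi.top hM, Set.subset_univ _⟩ fun _ h => h.1

lemma subset_gen (X : Set M) : X ⊆ gen C X := fun x hx => by
  rw [gen, SetLike.mem_coe, Substructure.mem_sInf]
  exact fun S hS => hS.2 hx

lemma gen_le {X : Set M} {S : L.Substructure M} (hS : C S) (h : X ⊆ S) : gen C X ≤ S :=
  sInf_le ⟨hS, h⟩

lemma gen_mono {X Y : Set M} (h : X ⊆ Y) : (gen C X : L.Substructure M) ≤ gen C Y :=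
  sInf_le_sInf fun _ hS => ⟨hS.1, h.trans hS.2⟩

/-- The closure is computed equally in a substructure belonging to the class. -/
lemma gen_image (hi : IsoClosed C) (hn : InterClosed C) (hA : C A) (hB : C B) (f : A ↪[L] B)
    (X : Set A) : gen C (f '' X) = (gen C X).map f.toHom := by
  refine le_antisymm (gen_le ((hi.map_iff f _).2 (gen_mem hi hn hA X))
    (Set.image_mono (subset_gen X))) ?_
  have hle : gen C (f '' X) ≤ f.toHom.range :=
    gen_le (hi.range f hA) (Set.image_subset_range _ _)
  rw [Substructure.map_le_iff_le_comap]
  refine gen_le ((hi.map_iff f _).1 ?_) fun x hx => subset_gen (C := C) _ ⟨x, hx, rfl⟩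
  rw [map_comap_of_le_range f hle]
  exact gen_mem hi hn hB _

lemma top_map_subtype (S : L.Substructure M) : (⊤ : L.Substructure S).map S.subtype.toHom = S := by
  rw [← Hom.range_eq_map, Substructure.range_subtype]

lemma IsFG.exists_eq_gen (hi : IsoClosed C) (hn : InterClosed C) (hM : C M)
    {S : L.Substructure M} (hS : IsFG C S) : ∃ X : Set M, X.Finite ∧ S = gen C X := by
  obtain ⟨hCS, X, hX, hgen⟩ := hS
  refine ⟨S.subtype '' X, hX.image _, ?_⟩
  rw [gen_image hi hn hCS hM, hgen, top_map_subtype]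

lemma isFG_gen (hi : IsoClosed C) (hn : InterClosed C) (hM : C M) {X : Set M} (hX : X.Finite) :
    IsFG C (gen C X) := by
  have hC := gen_mem hi hn hM X
  refine ⟨hC, (gen C X).subtype ⁻¹' X, hX.preimage (Subtype.val_injective.injOn), ?_⟩
  refine Substructure.map_injective_of_injective (f := (gen C X).subtype.toHom)
    (gen C X).subtype.injective ?_
  rw [← gen_image hi hn hC hM, top_map_subtype]
  congr 1
  exact Set.image_preimage_eq_of_subset fun x hx => ⟨⟨x, subset_gen X hx⟩, rfl⟩

lemma IsFG.of_equiv (hi : IsoClosed C) (hn : InterClosed C) (e : A ≃[L] B) (h : IsFG C A) :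
    IsFG C B := by
  obtain ⟨hA, X, hX, hgen⟩ := h
  have hB := hi _ _ hA ⟨e⟩
  refine ⟨hB, e '' X, hX.image _, ?_⟩
  have := gen_image hi hn hA hB e.toEmbedding X
  rw [hgen] at this
  refine this.trans (eq_top_iff.2 fun b _ => ⟨e.symm b, trivial, e.apply_symm_apply b⟩)

lemma isFG_map_iff (hi : IsoClosed C) (hn : InterClosed C) (f : A ↪[L] B) (S : L.Substructure A) :
    IsFG C (S.map f.toHom) ↔ IsFG C S :=
  ⟨fun h => h.of_equiv hi hn (f.substructureEquivMap S).symm,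
    fun h => h.of_equiv hi hn (f.substructureEquivMap S)⟩

lemma isFG_gen_union (hi : IsoClosed C) (hn : InterClosed C) (hM : C M) {S T : L.Substructure M}
    (hS : IsFG C S) (hT : IsFG C T) : IsFG C (gen C ((S : Set M) ∪ T)) := by
  obtain ⟨X, hX, rfl⟩ := hS.exists_eq_gen hi hn hM
  obtain ⟨Y, hY, rfl⟩ := hT.exists_eq_gen hi hn hM
  have : (gen C ((gen C X : Set M) ∪ gen C Y) : L.Substructure M) = gen C (X ∪ Y) :=
    le_antisymm (gen_le (gen_mem hi hn hM _) (Set.union_subset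
      (gen_mono Set.subset_union_left) (gen_mono Set.subset_union_right)))
      (gen_mono (Set.union_subset_union (subset_gen X) (subset_gen Y)))
  rw [this]
  exact isFG_gen hi hn hM (hX.union hY)

end Closure

/-! ### Dimension and strong embeddings -/

section Dimension

variable {L : FirstOrder.Language.{0, v}} {C K : StrClass.{u} L} {δ : StrFun.{u} L}
variable {A B M : Type u} [L.Structure A] [L.Structure B] [L.Structure M]

namespace IsAmalgamationSetting

lemma isFG_gen (hS : IsAmalgamationSetting C K δ) (hM : C M) {X : Set M} (hX : X.Finite) :
    IsFG C (gen C X) :=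
  Predim.isFG_gen hS.isoClosed hS.interClosed hM hX

lemma isFG_map_iff (hS : IsAmalgamationSetting C K δ) (f : A ↪[L] B) (S : L.Substructure A) :
    IsFG C (S.map f.toHom) ↔ IsFG C S :=
  Predim.isFG_map_iff hS.isoClosed hS.interClosed f S

lemma map_eq (hS : IsAmalgamationSetting C K δ) (f : A ↪[L] B) {S : L.Substructure A}
    (h : IsFG C S) : δ (S.map f.toHom) = δ S :=
  (hS.predimension.iso _ _ h ((hS.isFG_map_iff f S).2 h) ⟨f.substructureEquivMap S⟩).symm

lemma isFG_inf (hS : IsAmalgamationSetting C K δ) (hM : C M) {S T : L.Substructure M}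
    (h : IsFG C S) (hT : C T) : IsFG C (S ⊓ T : L.Substructure M) := by
  have hC := hS.interClosed.inf hM h.1 hT
  have hmap : ((S ⊓ T).comap S.subtype.toHom).map S.subtype.toHom = S ⊓ T :=
    map_comap_of_le_range _ (by rw [Substructure.range_subtype]; exact inf_le_left)
  rw [← hmap, hS.isFG_map_iff]
  exact hS.condFG _ h _ ((hS.isoClosed.map_iff S.subtype _).1 (by rwa [hmap]))

lemma dim_le (hS : IsAmalgamationSetting C K δ) {X : Set M} {Y : L.Substructure M}
    (hY : IsFG C Y) (h : X ⊆ Y) : dim C δ X ≤ δ Y :=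
  csInf_le ⟨0, fun _ ⟨_, hZ, _, e⟩ => e ▸ hS.nonneg _ hZ⟩ ⟨Y, hY, h, rfl⟩

lemma exists_eq_dim (hS : IsAmalgamationSetting C K δ) (hM : C M) {X : Set M} (hX : X.Finite) :
    ∃ Y : L.Substructure M, IsFG C Y ∧ X ⊆ Y ∧ δ Y = dim C δ X :=
  Int.csInf_mem (s := {k | ∃ Y : L.Substructure M, IsFG C Y ∧ X ⊆ Y ∧ δ Y = k})
    ⟨_, gen C X, hS.isFG_gen hM hX, subset_gen X, rfl⟩
    ⟨0, fun _ ⟨_, hZ, _, e⟩ => e ▸ hS.nonneg _ hZ⟩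

lemma dim_mono (hS : IsAmalgamationSetting C K δ) (hM : C M) {X Y : Set M} (hY : Y.Finite)
    (h : X ⊆ Y) : dim C δ X ≤ dim C δ Y := by
  obtain ⟨Z, hZ, hYZ, e⟩ := hS.exists_eq_dim hM hY
  exact e ▸ hS.dim_le hZ (h.trans hYZ)

lemma dim_image_le (hS : IsAmalgamationSetting C K δ) (hA : C A) (f : A ↪[L] B) {X : Set A}
    (hX : X.Finite) : dim C δ (f '' X) ≤ dim C δ X := by
  obtain ⟨Y, hY, hXY, e⟩ := hS.exists_eq_dim hA hX
  rw [← e, ← hS.map_eq f hY]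
  exact hS.dim_le ((hS.isFG_map_iff f Y).2 hY) (Set.image_mono hXY)

/-- An embedding is strong if and only if it does not decrease the dimension of finite sets. -/
lemma isStrongEmb_iff (hS : IsAmalgamationSetting C K δ) (hA : C A) (hB : C B) (f : A ↪[L] B) :
    IsStrongEmb C δ f ↔ ∀ X : Set A, X.Finite → dim C δ X ≤ dim C δ (f '' X) := by
  have hR := hS.isoClosed.range f hA
  constructor
  · intro h X hX
    obtain ⟨W, hW, hXW, e⟩ := hS.exists_eq_dim hB (hX.image f)
    have hWR := hS.isFG_inf hB hW hR
    obtain ⟨Y, hY, hle, hYR, hδ⟩ := h W hW _ hWR inf_le_right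
    have hWY : W ⊓ Y = W ⊓ f.toHom.range :=
      le_antisymm (inf_le_inf_left _ hYR) (le_inf inf_le_left hle)
    have hsub := hS.predimension.submodular B hB W Y hW hY
    rw [hWY] at hsub
    have hmap := map_comap_of_le_range f (inf_le_right : W ⊓ f.toHom.range ≤ _)
    have hfg : IsFG C ((W ⊓ f.toHom.range).comap f.toHom) := by
      rwa [← hS.isFG_map_iff f, hmap]
    have hδ' := hS.map_eq f hfg
    rw [hmap] at hδ'
    have := hS.dim_le hfg (X := X) fun x hx => ⟨hXW ⟨x, hx, rfl⟩, x, rfl⟩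
    linarith
  · intro h W hW Y hY hYR
    have hmap := map_comap_of_le_range f hYR
    have hfg : IsFG C (Y.comap f.toHom) := by rwa [← hS.isFG_map_iff f, hmap]
    obtain ⟨S, hSfin, hSY⟩ := hfg.exists_eq_gen hS.isoClosed hS.interClosed hA
    obtain ⟨Z, hZ, hSZ, e⟩ := hS.exists_eq_dim hA hSfin
    have hZ' := (hS.isFG_map_iff f Z).2 hZ
    refine ⟨Z.map f.toHom, hZ', ?_, Hom.map_le_range, ?_⟩
    · rw [← hmap]
      exact Substructure.monotone_map (hSY ▸ gen_le hZ.1 hSZ)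
    -- `δ(WZ) ≥ d(S) = δ(Z)`
    have h1 := hS.dim_le (isFG_gen_union hS.isoClosed hS.interClosed hB hW hZ')
      (X := f '' S) ((Set.image_mono hSZ).trans (Set.subset_union_right.trans (subset_gen _)))
    have h2 := h S hSfin
    rw [hS.map_eq f hZ]
    linarith

lemma isStrongEmb_comp (hS : IsAmalgamationSetting C K δ) (hA : C A) (hB : C B) (hM : C M)
    {f : A ↪[L] B} {g : B ↪[L] M} (hf : IsStrongEmb C δ f) (hg : IsStrongEmb C δ g) :
    IsStrongEmb C δ (g.comp f) := by
  rw [hS.isStrongEmb_iff hA hB] at hf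
  rw [hS.isStrongEmb_iff hB hM] at hg
  rw [hS.isStrongEmb_iff hA hM]
  intro X hX
  rw [show (g.comp f : A → M) = g ∘ f from rfl, Set.image_comp]
  exact (hf X hX).trans (hg _ (hX.image f))

lemma isStrongEmb_of_comp (hS : IsAmalgamationSetting C K δ) (hA : C A) (hB : C B) (hM : C M)
    {f : A ↪[L] B} {g : B ↪[L] M} (h : IsStrongEmb C δ (g.comp f)) : IsStrongEmb C δ f := by
  rw [hS.isStrongEmb_iff hA hM] at h
  rw [hS.isStrongEmb_iff hA hB]
  intro X hX
  have := h X hX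
  rw [show (g.comp f : A → M) = g ∘ f from rfl, Set.image_comp] at this
  exact this.trans (hS.dim_image_le hB g (hX.image f))

lemma isStrongEmb_equiv (hS : IsAmalgamationSetting C K δ) (hA : C A) (e : A ≃[L] B) :
    IsStrongEmb C δ e.toEmbedding := by
  have hB := hS.isoClosed _ _ hA ⟨e⟩
  rw [hS.isStrongEmb_iff hA hB]
  intro X hX
  have := hS.dim_image_le hB e.symm.toEmbedding (hX.image e.toEmbedding)
  rwa [← Set.image_comp, show (e.symm.toEmbedding ∘ e.toEmbedding : A → A) = id from
    funext fun x => e.symm_apply_apply x, Set.image_id] at this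

/-- A finitely generated substructure of least predimension over a set is strong. -/
lemma isStrongEmb_subtype_of_eq_dim (hS : IsAmalgamationSetting C K δ) (hM : C M) {X : Set M}
    {Y : L.Substructure M} (hY : IsFG C Y) (hXY : X ⊆ Y) (e : δ Y = dim C δ X) :
    IsStrongEmb C δ Y.subtype := by
  rw [hS.isStrongEmb_iff hY.1 hM]
  intro S hSfin
  obtain ⟨W, hW, hSW, e'⟩ := hS.exists_eq_dim hM (hSfin.image Y.subtype)
  have hsub := hS.predimension.submodular M hM W Y hW hY
  have h1 := hS.dim_le (isFG_gen_union hS.isoClosed hS.interClosed hM hW hY) (X := X)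
    (hXY.trans (Set.subset_union_right.trans (subset_gen _)))
  have hfg := hS.isFG_inf hM hW hY.1
  have hmap : ((W ⊓ Y).comap Y.subtype.toHom).map Y.subtype.toHom = W ⊓ Y :=
    map_comap_of_le_range _ (by rw [Substructure.range_subtype]; exact inf_le_right)
  have hfg' : IsFG C ((W ⊓ Y).comap Y.subtype.toHom) := by
    rwa [← hS.isFG_map_iff Y.subtype, hmap]
  have hδ := hS.map_eq Y.subtype hfg'
  rw [hmap] at hδ
  have h2 := hS.dim_le hfg' (X := S) fun x hx => ⟨hSW ⟨x, hx, rfl⟩, x.2⟩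
  linarith

/-- Each finite set is contained in a finitely generated strong substructure. -/
lemma exists_strong (hS : IsAmalgamationSetting C K δ) (hM : C M) {X : Set M} (hX : X.Finite) :
    ∃ Y : L.Substructure M, IsFG C Y ∧ X ⊆ Y ∧ δ Y = dim C δ X ∧ IsStrongEmb C δ Y.subtype := by
  obtain ⟨Y, hY, hXY, e⟩ := hS.exists_eq_dim hM hX
  exact ⟨Y, hY, hXY, e, hS.isStrongEmb_subtype_of_eq_dim hM hY hXY e⟩

end IsAmalgamationSetting

end Dimension

/-! ### The strong Fraïssé limit -/

section Limit

variable {L : FirstOrder.Language.{0, v}} {C K : StrClass.{u} L} {δ : StrFun.{u} L}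
variable {M U : Type u} [L.Structure M] [L.Structure U]

lemma IsStrongFraisseLimit.of_equiv (hS : IsAmalgamationSetting C K δ)
    (hU : IsStrongFraisseLimit C δ U) (e : U ≃[L] M) : IsStrongFraisseLimit C δ M where
  mem := hS.isoClosed _ _ hU.mem ⟨e⟩
  countable := have := hU.countable; e.symm.injective.countable
  universal A _ hA hc := by
    obtain ⟨f, hf⟩ := hU.universal A hA hc
    exact ⟨e.toEmbedding.comp f, hS.isStrongEmb_comp hA hU.mem (hS.isoClosed _ _ hU.mem ⟨e⟩) hf
      (hS.isStrongEmb_equiv hU.mem e)⟩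
  rich A B _ _ f g hA hB hf hg := by
    have hM := hS.isoClosed _ _ hU.mem ⟨e⟩
    obtain ⟨h, hh, hhg⟩ := hU.rich A B (e.symm.toEmbedding.comp f) g hA hB
      (hS.isStrongEmb_comp hA.1 hM hU.mem hf (hS.isStrongEmb_equiv hM e.symm)) hg
    refine ⟨e.toEmbedding.comp h,
      hS.isStrongEmb_comp hB.1 hU.mem hM hh (hS.isStrongEmb_equiv hU.mem e), fun a => ?_⟩
    exact (congrArg e (hhg a)).trans (e.apply_symm_apply (f a))

/-- A relation contained in an isomorphism between strong finitely generated substructures. -/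
def StrongIso (C : StrClass.{u} L) (δ : StrFun.{u} L) (R : Set (U × U)) : Prop :=
  ∃ (A B : L.Substructure U) (φ : A ≃[L] B), IsFG C A ∧ IsFG C B ∧ IsStrongEmb C δ A.subtype ∧
    IsStrongEmb C δ B.subtype ∧ ∀ r ∈ R, ∃ x : A, x = r.1 ∧ φ x = r.2

lemma StrongIso.swap {R : Set (U × U)} (h : StrongIso C δ R) :
    StrongIso C δ (Prod.swap '' R) := by
  obtain ⟨A, B, φ, hA, hB, hsA, hsB, hR⟩ := h
  refine ⟨B, A, φ.symm, hB, hA, hsB, hsA, ?_⟩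
  rintro _ ⟨r, hr, rfl⟩
  obtain ⟨x, hx, hx'⟩ := hR r hr
  exact ⟨φ x, hx', by rw [φ.symm_apply_apply, hx]; rfl⟩

lemma StrongIso.forth (hS : IsAmalgamationSetting C K δ) (hU : IsStrongFraisseLimit C δ U)
    {R : Set (U × U)} (h : StrongIso C δ R) (a : U) : ∃ b, StrongIso C δ (insert (a, b) R) := by
  obtain ⟨A, B, φ, hA, hB, hsA, hsB, hR⟩ := h
  obtain ⟨X, hX, hAX⟩ := hA.exists_eq_gen hS.isoClosed hS.interClosed hU.mem
  obtain ⟨A', hA', hXA', -, hsA'⟩ := hS.exists_strong hU.mem (hX.insert a)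
  have hle : A ≤ A' := hAX ▸ gen_le hA'.1 ((Set.subset_insert _ _).trans hXA')
  obtain ⟨h, hh, hhe⟩ := hU.rich A A' (B.subtype.comp φ.toEmbedding) (Substructure.inclusion hle)
    hA hA' (hS.isStrongEmb_comp hA.1 hB.1 hU.mem (hS.isStrongEmb_equiv hA.1 φ) hsB)
    (hS.isStrongEmb_of_comp hA.1 hA'.1 hU.mem (g := A'.subtype) hsA)
  have hfg := hA'.of_equiv hS.isoClosed hS.interClosed h.equivRange
  refine ⟨h ⟨a, hXA' (Set.mem_insert _ _)⟩, A', h.toHom.range, h.equivRange, hA', hfg, hsA', ?_, ?_⟩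
  · rwa [IsStrongEmb, Substructure.range_subtype]
  · rintro r (rfl | hr)
    · exact ⟨⟨a, hXA' (Set.mem_insert _ _)⟩, rfl, rfl⟩
    · obtain ⟨x, hx, hx'⟩ := hR r hr
      exact ⟨Substructure.inclusion hle x, hx, (hhe x).trans hx'⟩

/-- Isomorphisms between strong finitely generated substructures of the strong Fraïssé limit extend
to automorphisms. -/
lemma StrongIso.exists_equiv (hS : IsAmalgamationSetting C K δ) (hU : IsStrongFraisseLimit C δ U)
    {R : Set (U × U)} (hfin : R.Finite) (h : StrongIso C δ R) :
    ∃ σ : U ≃[L] U, ∀ r ∈ R, σ r.1 = r.2 := by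
  have := hU.countable
  obtain ⟨σ, hσR, hσ⟩ := exists_equiv_of_back_and_forth (Good := StrongIso (U := U) C δ)
    (fun R ⟨A, B, φ, _, _, _, _, hR⟩ p hp q hq => by
      obtain ⟨x, hx, hx'⟩ := hR p hp
      obtain ⟨y, hy, hy'⟩ := hR q hq
      rw [← hx, ← hy, ← hx', ← hy', SetLike.coe_eq_coe, SetLike.coe_eq_coe, φ.injective.eq_iff])
    (fun R _ hR a => hR.forth hS hU a)
    (fun R _ hR b => by
      obtain ⟨a, ha⟩ := hR.swap.forth hS hU b
      refine ⟨a, ?_⟩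
      simpa [Set.image_insert_eq, Set.image_image] using ha.swap)
    hfin h
  refine ⟨⟨σ, fun {n} f x => ?_, fun {n} r x => ?_⟩, hσR⟩
  · obtain ⟨R', ⟨A, B, φ, -, -, -, -, hR⟩, hT⟩ := hσ (insert (Structure.funMap f x) (Set.range x))
      ((Set.finite_range x).insert _)
    choose y hy hy' using fun i => hR _ (hT (x i) (.inr ⟨i, rfl⟩))
    obtain ⟨z, hz, hz'⟩ := hR _ (hT _ (Set.mem_insert _ _))
    have hzy : z = Structure.funMap f y := by
      refine Subtype.ext (hz.trans ?_)
      exact (congrArg (Structure.funMap f) (funext fun i => (hy i).symm)).trans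
        (A.subtype.map_fun f y).symm
    refine hz'.symm.trans ?_
    rw [hzy, φ.map_fun]
    exact (B.subtype.map_fun f _).trans (congrArg (Structure.funMap f) (funext hy'))
  · obtain ⟨R', ⟨A, B, φ, -, -, -, -, hR⟩, hT⟩ := hσ (Set.range x) (Set.finite_range x)
    choose y hy hy' using fun i => hR _ (hT (x i) ⟨i, rfl⟩)
    have e₁ : x = A.subtype ∘ y := funext fun i => (hy i).symm
    have e₂ : σ ∘ x = B.subtype ∘ (φ ∘ y) := funext fun i => (hy' i).symm
    change Structure.RelMap r (σ ∘ x) ↔ _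
    rw [e₂, e₁, B.subtype.map_rel, A.subtype.map_rel, φ.map_rel]

end Limit

/-! ### Field automorphisms -/

section FieldAutomorphisms

variable {F : Type u} [Field F]

/-- Differentially closed fields are algebraically closed: Blum's axioms for order `0`. -/
lemma IsDifferentiallyClosed.isAlgClosed {D : Derivation ℤ F F} (hDCF : IsDifferentiallyClosed D) :
    IsAlgClosed F := by
  have := hDCF.1
  have : Infinite F := CharZero.infinite F
  refine IsAlgClosed.of_exists_root F fun p _ hirr => ?_
  let f : MvPolynomial ℕ F := MvPolynomial.rename (fun _ : Unit => 0)
    ((MvPolynomial.uniqueAlgEquiv F Unit).symm p)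
  have hf : ∀ x : ℕ → F, MvPolynomial.eval x f = p.eval (x 0) := by
    intro x
    rw [MvPolynomial.eval_rename]
    conv_rhs => rw [← (MvPolynomial.uniqueAlgEquiv F Unit).apply_symm_apply p]
    generalize (MvPolynomial.uniqueAlgEquiv F Unit).symm p = q
    induction q using MvPolynomial.induction_on with
    | C a => simp
    | add p q hp hq => simp only [map_add, Polynomial.eval_add, hp, hq]
    | mul_X p i hp => simp [hp]
  have hle : ∀ i ∈ f.vars, i ≤ 0 := by
    classical
    intro i hi
    obtain ⟨_, -, rfl⟩ := Finset.mem_image.1 (MvPolynomial.vars_rename _ _ hi)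
    exact le_rfl
  have h0 : 0 ∈ f.vars := by
    by_contra h
    have hv : f.vars = ∅ := Finset.eq_empty_of_forall_notMem fun i hi =>
      h (Nat.le_zero.1 (hle i hi) ▸ hi)
    have hp : p = Polynomial.C (p.eval 0) := Polynomial.funext fun x => by
      rw [Polynomial.eval_C, ← hf fun _ => x, ← hf fun _ => 0]
      exact MvPolynomial.eval₂Hom_congr' rfl (fun i hi => by simp [hv] at hi) rfl
    rw [hp] at hirr
    exact absurd hirr.natDegree_pos (by simp)
  obtain ⟨x, hx, -⟩ := hDCF.2 0 f 1 h0 hle (by simp [MvPolynomial.vars_one]) one_ne_zero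
  exact ⟨x, by rw [hf] at hx; exact hx⟩

/-- In an algebraically closed field of characteristic zero, one of two algebraically independent
elements can be moved while the other one is fixed. -/
lemma exists_ringEquiv_of_algebraicIndependent [IsAlgClosed F] [CharZero F] {x : Fin 2 → F}
    (h : AlgebraicIndependent ℤ x) : ∃ σ : F ≃+* F, σ (x 0) = x 0 ∧ σ (x 1) = x 1 + 1 := by
  classical
  obtain ⟨t, hst, ht⟩ := exists_isTranscendenceBasis_superset (R := ℤ) (s := Set.range x)
    h.coe_range
  let x' : Fin 2 → t := fun i => ⟨x i, hst ⟨i, rfl⟩⟩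
  have hne : x' 0 ≠ x' 1 := fun e => by
    have := h.injective (congrArg Subtype.val e)
    exact absurd this (by decide)
  let θ : MvPolynomial t ℤ ≃ₐ[ℤ] MvPolynomial t ℤ := AlgEquiv.ofAlgHom
    (MvPolynomial.aeval fun i => if i = x' 1 then MvPolynomial.X i + 1 else MvPolynomial.X i)
    (MvPolynomial.aeval fun i => if i = x' 1 then MvPolynomial.X i - 1 else MvPolynomial.X i)
    (by
      refine MvPolynomial.algHom_ext fun i => ?_
      by_cases hi : i = x' 1 <;> simp [hi])
    (by
      refine MvPolynomial.algHom_ext fun i => ?_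
      by_cases hi : i = x' 1 <;> simp [hi])
  have := IsAlgClosed.isAlgClosure_of_transcendence_basis ((↑) : t → F) ht
  let e := ht.1.aevalEquiv
  let σ : F ≃+* F := IsAlgClosure.equivOfEquiv F F ((e.symm.trans θ).trans e).toRingEquiv
  have hσ : ∀ p, σ (e p) = e (θ p) := by
    intro p
    refine (IsAlgClosure.equivOfEquiv_algebraMap F F _ (e p)).trans ?_
    change ((e (θ (e.symm (e p)))) : F) = _
    rw [e.symm_apply_apply]
  have he : ∀ i, ((e (MvPolynomial.X i)) : F) = i := fun i => by
    simp [e]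
  refine ⟨σ, ?_, ?_⟩
  · have := hσ (MvPolynomial.X (x' 0))
    rw [he] at this
    refine this.trans ?_
    simp only [θ, AlgEquiv.ofAlgHom_apply, MvPolynomial.aeval_X, if_neg hne, he]
    rfl
  · have := hσ (MvPolynomial.X (x' 1))
    rw [he] at this
    refine this.trans ?_
    simp only [θ, AlgEquiv.ofAlgHom_apply, MvPolynomial.aeval_X, if_true, map_add, map_one]
    push_cast
    rw [he]

end FieldAutomorphisms

/-! ### Endomorphisms of the reduct preserve the derivation -/

section Endomorphisms

variable {F : Type u} [Field F] {D : Derivation ℤ F F} {Rel : ℕ → Type v}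
  {P : ∀ n, Rel n → Set (Fin n → F)} {C K : StrClass.{u} (reductLang Rel)}
  {δ : StrFun.{u} (reductLang Rel)}

lemma reductHom_comp_mem_iff (f : Reduct P ↪[reductLang Rel] Reduct P) {n : ℕ} (r : Rel n)
    (x : Fin n → F) : reductHom f ∘ x ∈ P n r ↔ x ∈ P n r :=
  f.map_rel (Sum.inr r : (reductLang Rel).Relations n) x

lemma map_deriv_of_equiv (hD : (∅ : Set (Reduct P)).Definable (reductLang Rel) (derivGraph D P))
    (σ : Reduct P ≃[reductLang Rel] Reduct P) (a : F) :
    (σ (show Reduct P from D a) : F) = D (σ (show Reduct P from a) : F) :=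
  (definable_comp_mem_iff σ hD ![a, D a]).2 rfl

/-- A differential automorphism, regarded as an automorphism of the reduct. -/
def derivReductEquiv (hP : AllDefinable D P) (σ : F ≃+* F) (hσ : ∀ x, σ (D x) = D (σ x)) :
    Reduct P ≃[reductLang Rel] Reduct P :=
  reductEquiv σ fun n r x => DDef.comp_mem_iff σ hσ (hP n r) x

/-- An endomorphism that does not decrease the dimension of a point preserves its derivative: the
derivative lies in each strong substructure around the point. -/
lemma reductHom_deriv_of_dim_eq (hS : IsAmalgamationSetting C K δ)
    (hU : IsStrongFraisseLimit C δ (Reduct P)) (hGen : GenericNonAlgebraic C δ (Reduct P))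
    (hD : (∅ : Set (Reduct P)).Definable (reductLang Rel) (derivGraph D P))
    (f : Reduct P ↪[reductLang Rel] Reduct P) (a : F)
    (h : dim C δ {(show Reduct P from reductHom f a)} = dim C δ {(show Reduct P from a)}) :
    reductHom f (D a) = D (reductHom f a) := by
  let a' : Reduct P := a
  let b' : Reduct P := D a
  -- the only element of the definable set `{D a}` cannot be `d`-generic over `a`
  have hdim : dim C δ {b', a'} = dim C δ {a'} := by
    refine le_antisymm ?_ (hS.dim_mono hU.mem (Set.toFinite _) (Set.subset_insert _ _))
    by_contra hlt
    refine hGen {a'} b' (Set.finite_singleton _) (by omega) {b'} ?_ rfl (Set.finite_singleton _)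
    refine Eq.subst (motive := fun s => Set.Definable (M := Reduct P) {a'} (reductLang Rel) s) ?_
      (Set.Definable.preimage_map (M := Reduct P) (L := reductLang Rel) (A := {a'})
        (F := fun x : Fin 1 → Reduct P => ![a', x 0]) (fun i => ?_)
        (Set.Definable.mono hD (Set.empty_subset _)))
    · exact Set.ext fun x => Iff.rfl
    · fin_cases i
      · exact definableFun_const (L := reductLang Rel) (M := Reduct P) (Fin 1) rfl
      · exact Set.DefinableFun.proj (M := Reduct P) (reductLang Rel)
  obtain ⟨B, hB, hXB, e, hsB⟩ := hS.exists_strong hU.mem (X := {b', a'}) (Set.toFinite _)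
  have hfB := (hS.isFG_map_iff f B).2 hB
  have ha : a' ∈ B := hXB (by simp)
  have hb : b' ∈ B := hXB (by simp)
  have hsfB := hS.isStrongEmb_subtype_of_eq_dim hU.mem hfB (X := {f a'})
    (Set.singleton_subset_iff.2 ⟨a', ha, rfl⟩) (by rw [hS.map_eq f hB, e, hdim]; exact h.symm)
  obtain ⟨σ, hσ⟩ := StrongIso.exists_equiv hS hU (R := {(a', f a'), (b', f b')}) (Set.toFinite _)
    ⟨B, _, f.substructureEquivMap B, hB, hfB, hsB, hsfB, by
      rintro r (rfl | rfl)
      exacts [⟨⟨a', ha⟩, rfl, rfl⟩, ⟨⟨b', hb⟩, rfl, rfl⟩]⟩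
  have h1 : σ a' = f a' := hσ (a', f a') (by simp)
  have h2 : σ b' = f b' := hσ (b', f b') (by simp)
  have h3 := map_deriv_of_equiv hD σ a
  exact h2.symm.trans (h3.trans (congrArg D h1))

variable [Countable F]

/-- No endomorphism of the reduct maps the field into the field of constants: otherwise all field
automorphisms would be automorphisms of the reduct. -/
lemma exists_deriv_reductHom_ne_zero (hDCF : IsDifferentiallyClosed D)
    (hSat : IsSaturated diffRing (DiffField D)) (hP : AllDefinable D P)
    (hD : (∅ : Set (Reduct P)).Definable (reductLang Rel) (derivGraph D P))
    (f : Reduct P ↪[reductLang Rel] Reduct P) : ∃ x, D (reductHom f x) ≠ 0 := by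
  by_contra! h
  have := hDCF.1
  have : Infinite F := CharZero.infinite F
  have := hDCF.isAlgClosed
  have key : ∀ (σ : F ≃+* F) (n : ℕ) (r : Rel n) (x : Fin n → F),
      σ ∘ x ∈ P n r ↔ x ∈ P n r := by
    intro σ n r x
    obtain ⟨τ, hτ, hx⟩ := exists_equiv_of_jet hDCF hSat (reductHom f)
      ((reductHom f).comp σ.toRingHom) (fun _ => 0) (fun x => by rw [h, map_zero])
      (fun x => by rw [map_zero]; exact h (σ x)) (Set.finite_range x)
    rw [← reductHom_comp_mem_iff f r x, ← reductHom_comp_mem_iff f r (σ ∘ x),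
      ← DDef.comp_mem_iff τ hτ (hP n r) (reductHom f ∘ x)]
    rw [show τ ∘ (reductHom f ∘ x) = reductHom f ∘ (σ ∘ x) from
      funext fun i => hx _ ⟨i, rfl⟩]
  obtain ⟨a, ha⟩ := exists_dTrans (X := ∅) hDCF hSat Set.finite_empty
  obtain ⟨σ, h0, h1⟩ := exists_ringEquiv_of_algebraicIndependent
    (ha.algebraicIndependent.comp ((↑) : Fin 2 → ℕ) Fin.val_injective)
  have h2 : σ (D a) = D (σ a) := map_deriv_of_equiv hD (reductEquiv σ (key σ)) a
  have h0 : σ a = a := h0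
  have h1 : σ (D a) = D a + 1 := h1
  rw [h0, h1] at h2
  exact one_ne_zero (add_eq_left.1 h2)

lemma dim_image_equiv {L : FirstOrder.Language.{0, v}} {C K : StrClass.{u} L} {δ : StrFun.{u} L}
    {U : Type u} [L.Structure U] (hS : IsAmalgamationSetting C K δ) (hU : C U) (σ : U ≃[L] U)
    {X : Set U} (hX : X.Finite) : dim C δ (σ '' X) = dim C δ X :=
  le_antisymm (hS.dim_image_le hU σ.toEmbedding hX)
    ((hS.isStrongEmb_iff hU hU _).1 (hS.isStrongEmb_equiv hU σ) X hX)

/-- Endomorphisms of the reduct preserve the derivation. -/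
theorem reductHom_deriv (hDCF : IsDifferentiallyClosed D)
    (hSat : IsSaturated diffRing (DiffField D)) (hP : AllDefinable D P)
    (hS : IsAmalgamationSetting C K δ) (hU : IsStrongFraisseLimit C δ (Reduct P))
    (hGen : GenericNonAlgebraic C δ (Reduct P))
    (hD : (∅ : Set (Reduct P)).Definable (reductLang Rel) (derivGraph D P))
    (f : Reduct P ↪[reductLang Rel] Reduct P) (a : F) :
    reductHom f (D a) = D (reductHom f a) := by
  have := hDCF.1
  have : Infinite F := CharZero.infinite F
  by_contra hne
  -- all differentially transcendental elements have the same dimension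
  have hdim : ∀ g g' : F, DTrans D ∅ g → DTrans D ∅ g' →
      dim C δ {(show Reduct P from g')} = dim C δ {(show Reduct P from g)} := by
    intro g g' hg hg'
    obtain ⟨σ, hσ, -, rfl⟩ := hg.exists_equiv hDCF hSat Set.finite_empty hg'
    have := dim_image_equiv hS hU.mem (derivReductEquiv hP σ hσ)
      (X := {(show Reduct P from g)}) (Set.finite_singleton _)
    rwa [Set.image_singleton] at this
  have hpres : ∀ (f' : Reduct P ↪[reductLang Rel] Reduct P) (g : F), DTrans D ∅ g →
      DTrans D ∅ (reductHom f' g) → reductHom f' (D g) = D (reductHom f' g) :=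
    fun f' g hg hg' => reductHom_deriv_of_dim_eq hS hU hGen hD f' g (hdim _ _ hg hg')
  let φ := reductHom f
  let e : Fin 2 → F := ![a, D a]
  let A : Set F := Set.range (φ ∘ e)
  obtain ⟨g, hg⟩ := exists_dTrans (X := {a}) hDCF hSat (Set.finite_singleton a)
  -- otherwise the derivative would be preserved at `g` and at `g + a`, hence at `a`
  have h1 : ∀ g', DTrans D A g' →
      ¬ ELe P (Fin.snoc e g : Fin 3 → F) (Fin.snoc (φ ∘ e) g') := by
    intro g' hg' hle
    obtain ⟨f', hf'⟩ := hle.exists_end hSat hP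
    have ha : reductHom f' a = φ a := congrFun hf' 0
    have hb : reductHom f' (D a) = φ (D a) := congrFun hf' 1
    have hc : reductHom f' g = g' := congrFun hf' 2
    have e₁ := hpres f' g (hg.mono (Set.empty_subset _))
      (by rw [hc]; exact hg'.mono (Set.empty_subset _))
    have e₂ := hpres f' (g + a)
      ((hg.add (jet_mem_dring (Set.mem_singleton a) 0)).mono (Set.empty_subset _))
      (by
        rw [map_add, hc, ha]
        exact (hg'.add (jet_mem_dring (show φ a ∈ A from ⟨0, rfl⟩) 0)).mono (Set.empty_subset _))
    rw [map_add, map_add, map_add, map_add, e₁, hb, ha, add_right_inj] at e₂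
    exact hne e₂
  -- by saturation, this is witnessed by one existential formula and one differential polynomial
  obtain ⟨E, p, hE, hgE, hp, hEp⟩ : ∃ (E : Set (Fin 3 → F)) (p : MvPolynomial ℕ (dring D A)),
      EDef P E ∧ (Fin.snoc e g : Fin 3 → F) ∈ E ∧ p ≠ 0 ∧
      ∀ x, (Fin.snoc (φ ∘ e) x : Fin 3 → F) ∈ E → p.eval₂ (dring D A).subtype (jet D x) = 0 := by
    by_contra! hcon
    let ι := {E : Set (Fin 3 → F) // EDef P E ∧ (Fin.snoc e g : Fin 3 → F) ∈ E} ×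
      {p : MvPolynomial ℕ (dring D A) // p ≠ 0}
    have : Nonempty ι := ⟨⟨_, eDef_univ, trivial⟩, ⟨1, one_ne_zero⟩⟩
    obtain ⟨x, hx⟩ := exists_mem_of_directed hSat (A := A) (Set.finite_range _)
      (s := fun i : ι => {x | (Fin.snoc (φ ∘ e) x : Fin 3 → F) ∈ i.1.1} ∩
        {x | i.2.1.eval₂ (dring D A).subtype (jet D x) = 0}ᶜ)
      (fun i => ((i.1.2.1.ddef hP).fiber fun j => Set.mem_range_self j).inter
        (aFun_eval₂ (fun r => r.2) i.2.1).zeros.compl)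
      (fun i j => ⟨⟨⟨_, i.1.2.1.inter j.1.2.1, i.1.2.2, j.1.2.2⟩,
          ⟨_, mul_ne_zero i.2.2 j.2.2⟩⟩,
        fun x hx => ⟨hx.1.1, fun h => hx.2 ((MvPolynomial.eval₂_mul _ _).trans
          (mul_eq_zero_of_left h _))⟩,
        fun x hx => ⟨hx.1.2, fun h => hx.2 ((MvPolynomial.eval₂_mul _ _).trans
          (mul_eq_zero_of_right _ h))⟩⟩)
      (fun i => by
        obtain ⟨x, hx, hx'⟩ := hcon _ i.2.1 i.1.2.1 i.1.2.2 i.2.2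
        exact ⟨x, hx, hx'⟩)
    refine h1 x (fun p hp => ?_) fun E hE hgE => ?_
    · by_contra h0
      exact (hx ⟨⟨_, eDef_univ, trivial⟩, ⟨p, h0⟩⟩).2 hp
    · exact (hx ⟨⟨E, hE, hgE⟩, ⟨1, one_ne_zero⟩⟩).1
  -- by homogeneity, the polynomial vanishes at the images of all generic elements
  have h2 : ∀ x, DTrans D {a} x →
      MvPolynomial.eval (jet D (φ x)) (MvPolynomial.map (dring D A).subtype p) = 0 := by
    intro x hx
    obtain ⟨σ, hσ, hσa, rfl⟩ := hg.exists_equiv hDCF hSat (Set.finite_singleton a) hx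
    have hσa := hσa a rfl
    have hσE : (Fin.snoc e (σ g) : Fin 3 → F) ∈ E := by
      rw [show (Fin.snoc e (σ g) : Fin 3 → F) = σ ∘ (Fin.snoc e g : Fin 3 → F) by
        rw [Fin.comp_snoc]
        congr 1
        ext i
        fin_cases i
        · exact hσa.symm
        · exact (congrArg D hσa).symm.trans (hσ a).symm]
      exact ((hE.ddef hP).comp_mem_iff σ hσ _).2 hgE
    have := hE.comp_mem f hσE
    rw [MvPolynomial.eval_map]
    refine hEp _ ?_
    rw [← Fin.comp_snoc]
    exact this
  -- translating a generic element shows that the polynomial is zero, a contradiction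
  obtain ⟨x₀, hx₀⟩ := exists_deriv_reductHom_ne_zero hDCF hSat hP hD f
  refine hp (MvPolynomial.map_injective (dring D A).subtype Subtype.val_injective ((eq_zero_of_eval_jet_eq_zero
    (S := φ.range) ⟨x₀, rfl⟩ hx₀ fun T hT hTφ => ?_).trans (map_zero _).symm))
  have hT' : φ '' (φ ⁻¹' T) = T := Set.image_preimage_eq_of_subset hTφ
  obtain ⟨x, hx⟩ := exists_dTrans (X := insert a (φ ⁻¹' T)) hDCF hSat
    ((hT.preimage φ.injective.injOn).insert a)
  refine ⟨φ x, fun t ht => ?_⟩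
  rw [← hT', ← RingHom.map_closure] at ht
  obtain ⟨y, hy, rfl⟩ := ht
  rw [← map_add]
  refine h2 _ ((hx.add ?_).mono (Set.singleton_subset_iff.2 (Set.mem_insert _ _)))
  exact (Subring.closure_le (t := dring D (insert a (φ ⁻¹' T)))).2
    (fun z hz => jet_mem_dring (.inr hz) 0) hy

end Endomorphisms

/-! ### Model completeness -/

section ModelCompleteness

variable {L : FirstOrder.Language.{0, v}} {M : Type u} [L.Structure M]

/-- If each formula is equivalent in `M` to an existential one, then `Th(M)` is model complete. -/
lemma isModelComplete_of_existential
    (h : ∀ (n : ℕ) (s : Set (Fin n → M)), (∅ : Set M).Definable L s → ExistentiallyDefinable L s) :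
    IsModelComplete.{u} (L.completeTheory M) := by
  intro N₁ N₂ _ _ h₁ h₂ f n
  have key : ∀ (φ : L.Formula (Fin n)) (x : Fin n → N₁), φ.Realize x → φ.Realize (f ∘ x) := by
    intro φ x hx
    obtain ⟨ψ, hψ, hφψ⟩ := h n {x | φ.Realize x} (Set.empty_definable_iff.2 ⟨φ, rfl⟩)
    let θ : L.Sentence := Formula.iAlls (Fin n) (Formula.relabel Sum.inr (φ.iff ψ))
    have hθ : ∀ (N : Type u) [L.Structure N], N ⊨ θ ↔
        ∀ y : Fin n → N, φ.Realize y ↔ ψ.Realize y := by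
      intro N _
      rw [Sentence.Realize, Formula.realize_iAlls]
      refine forall_congr' fun y => ?_
      rw [Formula.realize_relabel, Formula.realize_iff]
      rfl
    have hθM : θ ∈ L.completeTheory M := (hθ M).2 fun y => hφψ y
    have e₁ := (hθ N₁).1 (h₁.realize_of_mem θ hθM)
    have e₂ := (hθ N₂).1 (h₂.realize_of_mem θ hθM)
    refine (e₂ _).2 ((boundedFormula_realize_iff _ _ _).1
      (hψ.realize_embedding f (v := x) (xs := default) ((e₁ x).1 hx)))
  exact fun φ x => ⟨fun hx => by_contra fun hn => key φ.not x hn hx, key φ x⟩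

/-- Existential formulas are preserved by maps that extend to embeddings of substructures containing
any given finite set. -/
lemma ExSet.mem_of_forall_finite {α : Type} {s : Set (α → M)} (hs : ExSet L s) {x x' : α → M}
    (h : ∀ T : Set M, T.Finite → ∃ (Z : L.Substructure M) (k : Z ↪[L] M) (z : α → Z), T ⊆ Z ∧
      (∀ i, z i = x i) ∧ ∀ i, k (z i) = x' i) (hx : x ∈ s) : x' ∈ s := by
  obtain ⟨κ, _, φ, hφ, hs⟩ := hs
  rw [hs] at hx ⊢
  obtain ⟨y, hy⟩ := hx
  obtain ⟨Z, k, z, hT, hz, hk⟩ := h (Set.range y) (Set.finite_range y)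
  let y' : κ → Z := fun i => ⟨y i, hT ⟨i, rfl⟩⟩
  obtain rfl : Z.subtype ∘ z = x := funext hz
  obtain rfl : k ∘ z = x' := funext hk
  have hy' : y = Z.subtype ∘ y' := rfl
  rw [hy', ← Sum.comp_elim] at hy
  refine ⟨k ∘ y', ?_⟩
  rw [← Sum.comp_elim]
  have h1 := (BoundedFormula.IsQF.realize_embedding hφ Z.subtype (v := Sum.elim z y') (xs := default)).1
    ((boundedFormula_realize_iff φ (Z.subtype ∘ Sum.elim z y') (Z.subtype ∘ default)).2 hy)
  exact (boundedFormula_realize_iff _ _ _).1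
    ((BoundedFormula.IsQF.realize_embedding hφ k (v := Sum.elim z y') (xs := default)).2 h1)

end ModelCompleteness

/-! ### Triviality of the predimension -/

section Triviality

variable {L : FirstOrder.Language.{0, v}} {C K : StrClass.{u} L} {δ : StrFun.{u} L}
variable {A B M U : Type u} [L.Structure A] [L.Structure B] [L.Structure M] [L.Structure U]

/-- An embedding that maps generators into a substructure of the class maps everything into it. -/
lemma mem_of_gen_eq_top (hi : IsoClosed C) (hn : InterClosed C) (hA : C A) (hB : C B)
    (f : A ↪[L] B) {X : Set A} (hX : gen C X = ⊤) {Z : L.Substructure B} (hZ : C Z)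
    (h : ∀ x ∈ X, f x ∈ Z) (a : A) : f a ∈ Z := by
  have hmap : (Z.comap f.toHom).map f.toHom = Z ⊓ f.toHom.range := by
    ext b
    constructor
    · rintro ⟨a, ha, rfl⟩
      exact ⟨ha, a, rfl⟩
    · rintro ⟨hb, a, rfl⟩
      exact ⟨a, hb, rfl⟩
  have hC : C (Z.comap f.toHom) :=
    (hi.map_iff f _).1 (hmap ▸ hn.inf hB hZ (hi.range f hA))
  have hle : gen C X ≤ Z.comap f.toHom := gen_le hC h
  exact (hX ▸ hle) (Substructure.mem_top a)

/-- The embedding into a substructure through which an embedding factors. -/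
lemma exists_factor (f : A ↪[L] M) (g : B ↪[L] M) (h : ∀ a, f a ∈ g.toHom.range) :
    ∃ k : A ↪[L] B, ∀ a, g (k a) = f a := by
  refine ⟨g.equivRange.symm.toEmbedding.comp (f.codRestrict _ h), fun a => ?_⟩
  have := congrArg Subtype.val (g.equivRange.apply_symm_apply (f.codRestrict _ h a))
  exact this

/-- A strong embedding in a member of `K` extends to a strong embedding of the hull, since a member of
`K` is its own hull. -/
lemma exists_hull_extension (hS : IsAmalgamationSetting C K δ) (hB : K B) (hA : C A)
    (f : A ↪[L] B) (hf : IsStrongEmb C δ f) :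
    ∃ (A' : Type u) (_ : L.Structure A') (ι : A ↪[L] A') (g : A' ↪[L] B), IsHull K C δ ι ∧
      IsStrongEmb C δ g ∧ ∀ a, g (ι a) = f a := by
  obtain ⟨A', _, ι, hι⟩ := hS.condC3.exists_hull A hA
  have hid : IsHull K C δ (Embedding.refl L B) :=
    ⟨hB, hS.isStrongEmb_equiv (hS.sub_le _ hB) (FirstOrder.Language.Equiv.refl L B), by
      refine eq_top_iff.2 fun b _ => subset_gen _ ⟨b, rfl⟩⟩
  obtain ⟨g, hg, hgf⟩ := hS.condC4 A B A' B ι (Embedding.refl L B) f hA (hS.sub_le _ hB) hι hid hf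
  exact ⟨A', _, ι, g, hι, hg, hgf⟩

/-- Let `Y` and `T` be finitely generated members of `C`, with hulls `A₀` and `A₂`, both strongly
embedded in the limit. An embedding of `A₀` in `A₂` mapping `Y` into `T` preserves the existential
formulas of the limit: witnesses are moved along by the asymmetric amalgamation property. -/
lemma mem_of_exSet_of_hull (hS : IsAmalgamationSetting C K δ) (hU : IsStrongFraisseLimit C δ U)
    {Y T A₀ A₂ : Type u} [L.Structure Y] [L.Structure T] [L.Structure A₀] [L.Structure A₂]
    (hY : IsFG C Y) (hT : IsFG C T) {ι : Y ↪[L] A₀} {κ : T ↪[L] A₂} (hι : IsHull K C δ ι)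
    (hκ : IsHull K C δ κ) {s : A₀ ↪[L] U} {t : A₂ ↪[L] U} (hs : IsStrongEmb C δ s)
    (ht : IsStrongEmb C δ t) (f₀ : A₀ ↪[L] A₂) (p : Y → T) (hp : ∀ y, f₀ (ι y) = κ (p y))
    {n : ℕ} (x : Fin n → Y) {E : Set (Fin n → U)} (hE : ExSet L E)
    (hx : (fun i => s (ι (x i))) ∈ E) : (fun i => t (f₀ (ι (x i)))) ∈ E := by
  have hi := hS.isoClosed
  have hn := hS.interClosed
  have hC₀ := hS.sub_le _ hι.mem
  have hC₂ := hS.sub_le _ hκ.mem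
  refine hE.mem_of_forall_finite (fun W hW => ?_) hx
  obtain ⟨X, hX, hXY⟩ := hY.2
  obtain ⟨X', hX', hXT⟩ := hT.2
  -- a strong substructure `Z` of the limit around `Y` and `W`, with its hull `A₁`
  obtain ⟨Z, hZ, hWZ, -, hsZ⟩ := hS.exists_strong hU.mem (hW.union (hX.image (s.comp ι)))
  obtain ⟨r, hr⟩ := exists_factor (s.comp ι) Z.subtype (fun y => by
    rw [Substructure.range_subtype]
    exact mem_of_gen_eq_top hi hn hY.1 hU.mem _ hXY hZ.1
      (fun x hx => hWZ (.inr ⟨x, hx, rfl⟩)) y)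
  have hsr : IsStrongEmb C δ r := hS.isStrongEmb_of_comp hY.1 hZ.1 hU.mem (g := Z.subtype) (by
    rw [show Z.subtype.comp r = s.comp ι from DFunLike.ext _ _ hr]
    exact hS.isStrongEmb_comp hY.1 hC₀ hU.mem hι.strong hs)
  obtain ⟨A₁, _, ζ, hζ⟩ := hS.condC3.exists_hull Z hZ.1
  have hC₁ := hS.sub_le _ hζ.mem
  obtain ⟨f₁, hf₁, hf₁ι⟩ := hS.condC4 Y Z A₀ A₁ ι ζ r hY.1 hZ.1 hι hζ hsr
  obtain ⟨B, _, g₁, g₂, hB, hg₂, hg, -⟩ := hS.condAAP A₀ A₁ A₂ f₁ f₀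
    (hS.condC3.fg _ _ ι hY hι) (hS.condC3.fg _ _ ζ hZ hζ) (hS.condC3.fg _ _ κ hT hκ) hf₁
  have hCB := hS.sub_le _ hB.1
  -- a strong finitely generated substructure `V` of the amalgam around `T` and `Z`
  obtain ⟨X'', hX'', hXZ⟩ := hZ.2
  obtain ⟨V, hV, hTV, -, hsV⟩ := hS.exists_strong hCB
    ((hX'.image (g₂.comp κ)).union (hX''.image (g₁.comp ζ)))
  obtain ⟨vT, hvT⟩ := exists_factor (g₂.comp κ) V.subtype (fun y => by
    rw [Substructure.range_subtype]
    exact mem_of_gen_eq_top hi hn hT.1 hCB _ hXT hV.1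
      (fun x hx => hTV (.inl ⟨x, hx, rfl⟩)) y)
  obtain ⟨vZ, hvZ⟩ := exists_factor (g₁.comp ζ) V.subtype (fun y => by
    rw [Substructure.range_subtype]
    exact mem_of_gen_eq_top hi hn hZ.1 hCB _ hXZ hV.1
      (fun x hx => hTV (.inr ⟨x, hx, rfl⟩)) y)
  have hsv : IsStrongEmb C δ vT := hS.isStrongEmb_of_comp hT.1 hV.1 hCB (g := V.subtype) (by
    rw [show V.subtype.comp vT = g₂.comp κ from DFunLike.ext _ _ hvT]
    exact hS.isStrongEmb_comp hT.1 hC₂ hCB hκ.strong hg₂)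
  obtain ⟨h, -, hh⟩ := hU.rich T V (t.comp κ) vT hT hV
    (hS.isStrongEmb_comp hT.1 hC₂ hU.mem hκ.strong ht) hsv
  refine ⟨Z, h.comp vZ, r ∘ x, Set.subset_union_left.trans hWZ, fun i => hr (x i), fun i => ?_⟩
  have e : vZ (r (x i)) = vT (p (x i)) := V.subtype.injective (by
    rw [hvZ, hvT]
    change g₁ (ζ (r (x i))) = g₂ (κ (p (x i)))
    rw [← hf₁ι, hg, hp])
  change h (vZ (r (x i))) = _
  rw [e, hh, hp]
  rfl

/-- If inclusions of existential types of finite tuples of the limit preserve dimensions, then all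
embeddings between members of `K` are strong. -/
theorem isTrivialOn_of_dim_eq (hS : IsAmalgamationSetting C K δ)
    (hU : IsStrongFraisseLimit C δ U)
    (hdim : ∀ (n : ℕ) (x x' : Fin n → U), (∀ E, ExSet L E → x ∈ E → x' ∈ E) →
      dim C δ (Set.range x) = dim C δ (Set.range x')) : IsTrivialOn K C δ := by
  intro A B _ _ hA hB f
  have hi := hS.isoClosed
  have hn := hS.interClosed
  have hCA := hS.sub_le _ hA
  have hCB := hS.sub_le _ hB
  rw [hS.isStrongEmb_iff hCA hCB]
  intro S hSfin
  obtain ⟨Y, hY, hSY, -, hsY⟩ := hS.exists_strong hCA hSfin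
  obtain ⟨X, hX, hXY⟩ := hY.2
  obtain ⟨T, hT, hXT, -, hsT⟩ := hS.exists_strong hCB (hX.image (f.comp Y.subtype))
  have hfT := mem_of_gen_eq_top hi hn hY.1 hCB (f.comp Y.subtype) hXY hT.1
    fun x hx => hXT ⟨x, hx, rfl⟩
  obtain ⟨A₀, _, ι, j, hι, hj, hjι⟩ := exists_hull_extension hS hA hY.1 Y.subtype hsY
  obtain ⟨A₂, _, κ, j₂, hκ, hj₂, hj₂κ⟩ := exists_hull_extension hS hB hT.1 T.subtype hsT
  have hC₀ := hS.sub_le _ hι.mem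
  have hC₂ := hS.sub_le _ hκ.mem
  obtain ⟨f₀, hf₀⟩ := exists_factor (f.comp j) j₂ (mem_of_gen_eq_top hS.sub_isoClosed
    hS.sub_interClosed hι.mem hB (f.comp j) hι.generated (hS.sub_isoClosed.range j₂ hκ.mem) (by
      rintro _ ⟨y, rfl⟩
      refine ⟨κ ⟨f y, hfT y⟩, (hj₂κ _).trans ?_⟩
      change f y = f (j (ι y))
      rw [hjι]
      rfl))
  have hp : ∀ y, f₀ (ι y) = κ ⟨f y, hfT y⟩ := fun y => j₂.injective (by
    rw [hf₀, hj₂κ]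
    change f (j (ι y)) = f y
    rw [hjι]
    rfl)
  obtain ⟨s, hs⟩ := hU.universal A₀ hC₀ (hS.sub_countable_fg _ (hS.condC3.fg _ _ ι hY hι))
  obtain ⟨t, ht⟩ := hU.universal A₂ hC₂ (hS.sub_countable_fg _ (hS.condC3.fg _ _ κ hT hκ))
  -- the finite set `S`, enumerated in `Y`
  obtain ⟨n, x, hx⟩ : ∃ (n : ℕ) (x : Fin n → Y), Y.subtype '' Set.range x = S := by
    have := hSfin.to_subtype
    obtain ⟨n, ⟨e⟩⟩ := Finite.exists_equiv_fin S
    refine ⟨n, fun i => ⟨e.symm i, hSY (e.symm i).2⟩, Set.ext fun a => ⟨?_, fun ha => ?_⟩⟩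
    · rintro ⟨_, ⟨i, rfl⟩, rfl⟩
      exact (e.symm i).2
    · exact ⟨_, ⟨e ⟨a, ha⟩, rfl⟩, by simp⟩
  have e₁ : S = j '' Set.range (ι ∘ x) := by
    rw [← hx, ← Set.range_comp, ← Set.range_comp]
    exact congrArg Set.range (funext fun i => (hjι (x i)).symm)
  have e₂ : f '' S = j₂ '' Set.range (f₀ ∘ ι ∘ x) := by
    rw [e₁, ← Set.range_comp, ← Set.range_comp, ← Set.range_comp]
    exact congrArg Set.range (funext fun i => (hf₀ (ι (x i))).symm)
  calc dim C δ S ≤ dim C δ (Set.range (ι ∘ x)) := by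
        rw [e₁]; exact hS.dim_image_le hC₀ j (Set.finite_range _)
    _ ≤ dim C δ (s '' Set.range (ι ∘ x)) :=
        (hS.isStrongEmb_iff hC₀ hU.mem s).1 hs _ (Set.finite_range _)
    _ = dim C δ (t '' Set.range (f₀ ∘ ι ∘ x)) := by
        rw [← Set.range_comp, ← Set.range_comp]
        exact hdim n _ _ fun E hE hxE =>
          mem_of_exSet_of_hull hS hU hY hT hι hκ hs ht f₀ _ hp x hE hxE
    _ ≤ dim C δ (Set.range (f₀ ∘ ι ∘ x)) := hS.dim_image_le hC₂ t (Set.finite_range _)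
    _ ≤ dim C δ (f '' S) := by
        rw [e₂]
        exact (hS.isStrongEmb_iff hC₂ hCB j₂).1 hj₂ _ (Set.finite_range _)

end Triviality

end Predim

theorem mainTheorem4 {F : Type u} [Field F] [Countable F] (D : Derivation ℤ F F)
    (hDCF : IsDifferentiallyClosed D) (hSat : IsSaturated diffRing (DiffField D))
    {Rel : ℕ → Type v} [∀ n, Countable (Rel n)] (P : ∀ n, Rel n → Set (Fin n → F))
    (hP : AllDefinable D P)
    (C K : StrClass.{u} (reductLang Rel)) (δ : StrFun.{u} (reductLang Rel))
    (hFields : ∀ (A : Type u) [(reductLang Rel).Structure A], IsFG C A → IsACFOfFiniteTrdeg Rel A)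
    (hGen : GenericNonAlgebraic C δ (Reduct P))
    (hD : (∅ : Set (Reduct P)).Definable (reductLang Rel) (derivGraph D P))
    (hAdeq : IsStronglyAdequate C K δ (Reduct P)) :
    ExistentiallyDefinable (reductLang Rel) (derivGraph D P) ∧
      IsModelComplete.{u} ((reductLang Rel).completeTheory (Reduct P)) ∧
      IsTrivialOn K C δ := by
  have := hDCF.1
  have : Infinite F := CharZero.infinite F
  have hS := hAdeq.setting
  obtain ⟨U', _, hU', ⟨e⟩⟩ := hAdeq.limit
  have hU : IsStrongFraisseLimit C δ (Reduct P) := hU'.of_equiv hS e.symm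
  -- endomorphisms of the reduct agree with differential automorphisms on finite sets
  have hagree : ∀ (f : Reduct P ↪[reductLang Rel] Reduct P) (T : Set F), T.Finite →
      ∃ σ : F ≃+* F, (∀ x, σ (D x) = D (σ x)) ∧ ∀ x ∈ T, σ x = reductHom f x :=
    fun f T hT => exists_equiv_of_jet hDCF hSat (RingHom.id F) (reductHom f) D (fun _ => rfl)
      (fun x => (reductHom_deriv hDCF hSat hP hS hU hGen hD f x).symm) hT
  have hex : ∀ (n : ℕ) (s : Set (Fin n → Reduct P)),
      (∅ : Set (Reduct P)).Definable (reductLang Rel) s →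
      ExistentiallyDefinable (reductLang Rel) s := by
    intro n s hs
    have hs' : DDef D s := ddef_of_definable hP hs
    refine ExSet.existentiallyDefinable (eDef_of_preserved hSat hP hs' fun f x hx => ?_)
    obtain ⟨σ, hσ, hσx⟩ := hagree f (Set.range x) (Set.finite_range x)
    have : σ ∘ x = f ∘ x := funext fun i => hσx _ ⟨i, rfl⟩
    exact this ▸ (hs'.comp_mem_iff σ hσ x).2 hx
  refine ⟨hex 2 _ hD, isModelComplete_of_existential hex, isTrivialOn_of_dim_eq hS hU ?_⟩
  intro n x x' hle
  obtain ⟨f, rfl⟩ := ELe.exists_end hSat hP (e := x) (e' := x') hle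
  obtain ⟨σ, hσ, hσx⟩ := hagree f (Set.range x) (Set.finite_range x)
  have := dim_image_equiv hS hU.mem (derivReductEquiv hP σ hσ) (Set.finite_range x)
  rw [← Set.range_comp] at this
  rw [← this]
  exact congrArg (fun y => dim C δ (Set.range y)) (funext fun i => hσx _ ⟨i, rfl⟩)
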